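/- Fix an integer $k\ge 2$. For a partition $\alpha\vdash n$ let $\mathcal C_\alpha$ be the conjugacy class of permutations in $\mathfrak S_n$ with cycle type $\alpha$, let $l(\alpha)$ be the number of parts of $\alpha$, and let $c_k(\alpha)$ be the number of tuples $(\sigma_1,\dots,\sigma_j)$ of $k$-cycles in $\mathfrak S_n$ such that $\sigma_1\cdots\sigma_j=\pi$, the group generated by $\sigma_1,\dots,\sigma_j$ is transitive on $\{1,\dots,n\}$, and $j$ is as small as possible subject to these conditions; here $\pi\in\mathcal C_\alpha$ is arbitrary but fixed. Put $\mu_k(\alpha)=\frac{n+l(\alpha)-2}{k-1}$ and, for $m\ge 1$, $$F_k^{(m)}(u,z;p_1,p_2,\dots)=\sum_{\substack{n\ge 1\\ k-1\,\mid\, n+m-2}}\ \sum_{\substack{\alpha\vdash n\\ l(\alpha)=m}} c_k(\alpha)\,|\mathcal C_\alpha|\,p_\alpha\,\frac{u^{\mu_k(\alpha)}}{\mu_k(\alpha)!}\,\frac{z^n}{n!},\qquad p_\alpha=p_{\alpha_1}p_{\alpha_2}\cdots .$$ Let $P_k^{(m)}(x_1,\dots,x_m)=\psi_m(F_k^{(m)})$,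 where $\psi_m$ is the linear operator with $\psi_m(p_\alpha u^iz^j)=\sum_{\sigma\in\mathfrak S_m}x_1^{\alpha_{\sigma(1)}}\cdots x_m^{\alpha_{\sigma(m)}}$ for $l(\alpha)=m$. **Theorem.** There is a unique formal power series $w(x)\in\mathbb Q[[x]]$ with $w=x\,e^{w^{k-1}}$. With $w_i=w(x_i)$, one has, as formal power series in $x_1,x_2$, $$\Big(x_1\frac{\partial}{\partial x_1}+x_2\frac{\partial}{\partial x_2}\Big)P_k^{(2)}(x_1,x_2)=S_k^{(2)}(w_1,w_2)\;x_1\frac{dw_1}{dx_1}\;x_2\frac{dw_2}{dx_2},$$ where $S_k^{(2)}$ is the symmetric polynomial $$S_k^{(2)}(w_1,w_2)=(k-1)\,\frac{(w_1^{k-1}-w_2^{k-1})^2}{(w_1-w_2)^2}.$$ Moreover $$P_k^{(2)}(x_1,x_2)=\log\!\Big(\frac{w_1-w_2}{x_1-x_2}\Big)-\frac{w_1^k-w_2^k}{w_1-w_2},$$ where $\frac{w_1-w_2}{x_1-x_2}$ is a formal power series in $x_1,x_2$ with constant term $1$ and $\frac{w_1^k-w_2^k}{w_1-w_2}$ is a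 formal power series in $x_1,x_2$. -/

import Mathlib

namespace KCycleFactorisation

noncomputable section

/-- The conjugacy class `C_α` of the symmetric group on `n` symbols: the permutations whose cycle
lengths (fixed points included) are the parts of `α`. -/
def conjClass {n : ℕ} (α : n.Partition) : Finset (Equiv.Perm (Fin n)) :=
  {π : Equiv.Perm (Fin n) | π.partition.parts = α.parts}

theorem conjClass_nonempty {n : ℕ} (α : n.Partition) : (conjClass α).Nonempty := by
  obtain ⟨g, hg⟩ := (Equiv.Perm.exists_with_cycleType_iff (α := Fin n)
    (m := α.parts.filter (2 ≤ ·))).mpr ⟨by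
      have h := congrArg Multiset.sum (Multiset.filter_add_not (2 ≤ ·) α.parts)
      rw [Multiset.sum_add, α.parts_sum] at h
      simp only [Fintype.card_fin]
      omega, by simp⟩
  refine ⟨g, ?_⟩
  have hone : α.parts.filter (fun i => ¬ 2 ≤ i) =
      Multiset.replicate (α.parts.filter (fun i => ¬ 2 ≤ i)).card 1 := by
    rw [Multiset.eq_replicate_card]
    intro b hb
    rw [Multiset.mem_filter] at hb
    have := α.parts_pos hb.1
    omega
  have hsum := congrArg Multiset.sum (Multiset.filter_add_not (2 ≤ ·) α.parts)
  rw [Multiset.sum_add, α.parts_sum, hone, Multiset.sum_replicate, ← hg,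
    Equiv.Perm.sum_cycleType] at hsum
  simp only [conjClass, Finset.mem_filter, Finset.mem_univ, true_and]
  rw [Equiv.Perm.parts_partition, hg]
  conv_rhs => rw [← Multiset.filter_add_not (2 ≤ ·) α.parts, hone]
  congr 2
  simp only [Fintype.card_fin, smul_eq_mul, mul_one] at hsum ⊢
  omega

/-- `L = [σ₁, …, σⱼ]` is a transitive ordered factorisation of `π` into `k`-cycles:
every `σᵢ` is a `k`-cycle, `σ₁ ⋯ σⱼ = π`, and the subgroup generated by the factors acts
transitively on the `n` symbols. -/
structure IsTransitiveFactorisation (k : ℕ) {n : ℕ} (π : Equiv.Perm (Fin n))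
    (L : List (Equiv.Perm (Fin n))) : Prop where
  cycle : ∀ σ ∈ L, σ.cycleType = {k}
  prod_eq : L.prod = π
  transitive : MulAction.IsPretransitive (Subgroup.closure {σ | σ ∈ L}) (Fin n)

/-- A transitive ordered factorisation of `π` into `k`-cycles with the least possible number of
factors. -/
def IsMinimalTransitiveFactorisation (k : ℕ) {n : ℕ} (π : Equiv.Perm (Fin n))
    (L : List (Equiv.Perm (Fin n))) : Prop :=
  IsTransitiveFactorisation k π L ∧
    ∀ L', IsTransitiveFactorisation k π L' → L.length ≤ L'.length

/-- `c_k(α)`: the number of minimal transitive ordered factorisations into `k`-cycles of an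
arbitrary but fixed permutation in `C_α`. -/
def c (k : ℕ) {n : ℕ} (α : n.Partition) : ℕ :=
  {L | IsMinimalTransitiveFactorisation k (conjClass_nonempty α).choose L}.ncard

/-- The indeterminates `u, p₁, p₂, …` (the symbol `p 0` is never used). -/
inductive Indet : Type
  | u : Indet
  | p : ℕ → Indet

/-- `μ_k(α) = (n + m - 2)/(k - 1)` for a partition `α` of `n` with `m` parts; only used for
`k ≥ 2`, `m, n ≥ 1` and when the division is exact. -/
def mu (k m n : ℕ) : ℕ := (n + m - 2) / (k - 1)

/-- The generating series
`F_k^{(m)} = ∑_{n ≥ 1, k-1 ∣ n+m-2} ∑_{α ⊢ n, l(α) = m} c_k(α) |C_α| p_α u^μ/μ! z^n/n!`, `m ≥ 1`,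
a power series in `z` whose coefficients are polynomials in `u, p₁, p₂, …`. -/
def F (k m : ℕ) : PowerSeries (MvPolynomial Indet ℚ) :=
  PowerSeries.mk fun n =>
    if 1 ≤ n ∧ (k - 1) ∣ (n + m - 2) then
      ∑ α : n.Partition with α.parts.card = m,
        MvPolynomial.C ((c k α : ℚ) * ((conjClass α).card : ℚ) /
            (((mu k m n).factorial : ℚ) * (n.factorial : ℚ))) *
          MvPolynomial.X Indet.u ^ mu k m n *
          (α.parts.map fun i => MvPolynomial.X (Indet.p i)).prod
    else 0

/-- The multiset `α` for which the monomial with exponents `d` is `p_α` times a power of `u`. -/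
def pParts (d : Indet →₀ ℕ) : Multiset ℕ :=
  d.sum fun v e =>
    match v with
    | Indet.u => 0
    | Indet.p i => Multiset.replicate e i

/-- `ψ_m` on monomials: if `α = (α₁ ≥ ⋯ ≥ α_m)` has `m` parts, then `p_α u^i z^j` is sent to
`∑_{σ ∈ S_m} x₁^{α_σ(1)} ⋯ x_m^{α_σ(m)}`. (Monomials whose `α` does not have `m` parts do not
occur in `F k m`; they are sent to `0`.) -/
def psiMonomial (m : ℕ) (d : Indet →₀ ℕ) : MvPolynomial (Fin m) ℚ :=
  if (pParts d).card = m then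
    ∑ σ : Equiv.Perm (Fin m), ∏ i : Fin m,
      MvPolynomial.X i ^ ((pParts d).sort (· ≥ ·)).getD (σ i : ℕ) 0
  else 0

/-- The linear extension of `ψ_m` to series in `z`. The sum over `j` runs over the powers `z^j`; on
`F k m` every coefficient of the result only receives contributions from finitely many `j`. -/
def psi (m : ℕ) (G : PowerSeries (MvPolynomial Indet ℚ)) : MvPowerSeries (Fin m) ℚ :=
  fun a => ∑ᶠ j : ℕ, ∑ d ∈ (PowerSeries.coeff j G).support,
    MvPolynomial.coeff d (PowerSeries.coeff j G) * MvPolynomial.coeff a (psiMonomial m d)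

/-- `P_k^{(m)}(x₁, …, x_m) = ψ_m(F_k^{(m)})`. -/
def P (k m : ℕ) : MvPowerSeries (Fin m) ℚ := psi m (F k m)

/-- `w` solves the functional equation `w = x e^{w^{k-1}}` in formal power series in `x`. (A
solution has zero constant term, so for `k ≥ 2` the substitution is a genuine one.) -/
def SolvesFunctionalEquation (k : ℕ) (w : PowerSeries ℚ) : Prop :=
  w = PowerSeries.X * (PowerSeries.exp ℚ).subst (w ^ (k - 1))

/-- `w_i = w(x_i)` as a power series in `x₁, …, x_m`. -/
def wAt {m : ℕ} (w : PowerSeries ℚ) (i : Fin m) : MvPowerSeries (Fin m) ℚ :=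
  w.subst (MvPowerSeries.X i : MvPowerSeries (Fin m) ℚ)

/-- The operator `x_i ∂/∂x_i` on power series. -/
def euler {m : ℕ} (i : Fin m) (f : MvPowerSeries (Fin m) ℚ) : MvPowerSeries (Fin m) ℚ :=
  MvPowerSeries.X i * MvPowerSeries.pderiv ℚ i f

/-- `log f` for a power series `f` with constant term `1`. -/
def logSeries {m : ℕ} (f : MvPowerSeries (Fin m) ℚ) : MvPowerSeries (Fin m) ℚ :=
  (PowerSeries.log ℚ).subst (f - 1)

end

end KCycleFactorisation

/-! Multiplying a permutation on the left by the transposition of `x` and `y` cuts a cycle if both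
points lie on it and joins two cycles otherwise; a `k`-cycle through `x` is a product of `k - 1`
transpositions moving `x`. A factorisation of `π` into `m` cycles of length `k` is therefore a walk
of `m(k-1)` cuts and joins from `π` to the identity, which has `|V|` cycles. If `m(k-1) + #cycles =
|V|`, all steps are cuts. Removing the first factor gives a recursion, and the number of
factorisations is `m!` times the product of `w_n` over the cycle lengths `n` (`countAll_eq`), as
soon as `k(n-1)w_n = (k-1)n[xⁿ]wᵏ`. The series with `w = x e^{w^{k-1}}` satisfies this, by
differentiation (`treeSeries_coeff_rec`).

Let `π` now have exactly two cycles, `X` and its complement. The factors generate a group containing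
`π`, so they act transitively iff one of them does not preserve `X`. To obtain a recursion that
closes up, all `π` preserving `X` are considered, with `m(k-1) + #cycles = |V| + 2`, so that there
is exactly one join. The factorisations with a factor mixing the two sides number `m!` times the
sum, over a cycle `C` inside `X` and a cycle `D` outside, of `A(|C|,|D|)` times the weights `w` of
the other cycles (`countMixing_eq`). This requires of `A` only one linear recursion, whose terms
correspond to cutting `C`, cutting `D`, or joining them. For two cycles of lengths `a` and `b` it
gives `c_k = m! A(a,b)` (`c_eq`), and the coefficient of `x₁ᵃx₂ᵇ` in `P` is `A(a,b)/(ab)`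
(`coeff_P_two`).

With `θᵢ = xᵢ∂/∂xᵢ` and `h` the complete symmetric polynomials, the recursion for `A` reads
`(1-(k-1)w₁^{k-1})θ₁P + (1-(k-1)w₂^{k-1})θ₂P = (k-1) h_{k-2}(w₁,w₂) (x₂w₁-x₁w₂)/(x₁-x₂)`. The
claimed closed form satisfies this equation, and also the asserted formula for `θ₁ + θ₂`, by algebra
modulo the differential equation of `w` (`mul_euler_add_mul_euler_annulusSeries`,
`euler_add_euler_annulusSeries`). The equation need not be solved: the count is determined by
induction on `m`, so a verified recursion suffices. Positivity of the coefficients finally ensures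
that `m` factors are really attained whenever any transitive factorisation exists. -/

namespace KCycleFactorisation

/-! ### Cycles of a permutation as sets of points -/

section Orbits

open Finset

variable {V : Type*} [Fintype V] [DecidableEq V]

/-- The cycle of `π` through `x`, as a set of points. -/
def orb (π : Equiv.Perm V) (x : V) : Finset V := {z | π.SameCycle x z}

/-- The set of all cycles of `π`, fixed points included. -/
def orbs (π : Equiv.Perm V) : Finset (Finset V) := univ.image (orb π)

theorem mem_orb {π : Equiv.Perm V} {x z : V} : z ∈ orb π x ↔ π.SameCycle x z := by
  simp [orb]

theorem self_mem_orb (π : Equiv.Perm V) (x : V) : x ∈ orb π x :=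
  mem_orb.2 (Equiv.Perm.SameCycle.refl _ _)

theorem orb_eq_of_mem {π : Equiv.Perm V} {x z : V} (h : z ∈ orb π x) : orb π z = orb π x := by
  ext t
  rw [mem_orb] at h
  rw [mem_orb, mem_orb]
  exact ⟨fun h' => h.trans h', fun h' => h.symm.trans h'⟩

theorem mem_orb_comm {π : Equiv.Perm V} {x z : V} : z ∈ orb π x ↔ x ∈ orb π z := by
  rw [mem_orb, mem_orb]
  exact ⟨fun h => h.symm, fun h => h.symm⟩

theorem apply_mem_orb {π : Equiv.Perm V} {x z : V} (h : z ∈ orb π x) : π z ∈ orb π x := by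
  rw [mem_orb] at *
  exact Equiv.Perm.sameCycle_apply_right.2 h

theorem orb_mem_orbs (π : Equiv.Perm V) (x : V) : orb π x ∈ orbs π :=
  mem_image_of_mem _ (mem_univ _)

theorem mem_orbs {π : Equiv.Perm V} {C : Finset V} : C ∈ orbs π ↔ ∃ x, orb π x = C := by
  simp [orbs]

theorem orb_eq_of_mem_orbs {π : Equiv.Perm V} {C : Finset V} {x : V} (hC : C ∈ orbs π)
    (hx : x ∈ C) : orb π x = C := by
  obtain ⟨z, rfl⟩ := mem_orbs.1 hC
  exact orb_eq_of_mem hx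

theorem orb_card_pos (π : Equiv.Perm V) (x : V) : 0 < #(orb π x) :=
  card_pos.2 ⟨x, self_mem_orb π x⟩

theorem orb_subset {π : Equiv.Perm V} {x : V} {T : Finset V} (hx : x ∈ T)
    (hT : ∀ z ∈ T, π z ∈ T) : orb π x ⊆ T := by
  intro z hz
  obtain ⟨i, rfl⟩ := (mem_orb.1 hz).exists_nat_pow_eq
  induction i with
  | zero => simpa using hx
  | succ i ih =>
    rw [pow_succ', Equiv.Perm.mul_apply]
    exact hT _ (ih (mem_orb.2 ⟨i, by simp⟩))

/-- The image of a closed path is stable under `π` and reachable from its start. Injectivity is not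
needed here; lengths are computed separately. -/
theorem orb_eq_image_of_path {π : Equiv.Perm V} {p : ℕ} {f : ℕ → V} (hp : 0 < p)
    (hf : ∀ i, i + 1 < p → π (f i) = f (i + 1)) (hl : π (f (p - 1)) = f 0) :
    orb π (f 0) = (range p).image f := by
  apply Subset.antisymm
  · apply orb_subset
    · exact mem_image_of_mem _ (mem_range.2 hp)
    · intro z hz
      obtain ⟨i, hi, rfl⟩ := mem_image.1 hz
      rw [mem_range] at hi
      by_cases h : i + 1 < p
      · rw [hf i h]; exact mem_image_of_mem _ (mem_range.2 h)
      · rw [show i = p - 1 by omega, hl]; exact mem_image_of_mem _ (mem_range.2 hp)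
  · intro z hz
    obtain ⟨i, hi, rfl⟩ := mem_image.1 hz
    rw [mem_range] at hi
    clear hz
    induction i with
    | zero => exact self_mem_orb _ _
    | succ i ih => rw [← hf i hi]; exact apply_mem_orb (ih (by omega))

/-- The size of a cycle is the minimal period of `x`. The three conclusions make `i ↦ (π ^ i) x` a
coordinate on the cycle, in which cuts and joins are described. -/
theorem pow_card_orb_aux (π : Equiv.Perm V) (x : V) :
    (π ^ #(orb π x)) x = x ∧ (∀ i < #(orb π x), ∀ j < #(orb π x),
      (π ^ i) x = (π ^ j) x → i = j) ∧ orb π x = (range #(orb π x)).image fun i => (π ^ i) x := by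
  set p := Function.minimalPeriod π x with hpdef
  have hp : 0 < p := Function.minimalPeriod_pos_of_mem_periodicPts
    (π.injective.mem_periodicPts x)
  have hper : (π ^ p) x = x := by
    have := Function.iterate_minimalPeriod (f := π) (x := x)
    rwa [← Equiv.Perm.coe_pow] at this
  have hinj : ∀ i < p, ∀ j < p, (π ^ i) x = (π ^ j) x → i = j := by
    intro i hi j hj h
    refine Function.iterate_injOn_Iio_minimalPeriod (f := π) (x := x) hi hj ?_
    simpa only [← Equiv.Perm.coe_pow] using h
  have himg : orb π x = (range p).image fun i => (π ^ i) x := by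
    have := orb_eq_image_of_path (π := π) (p := p) (f := fun i => (π ^ i) x) hp
      (fun i _ => by simp only [pow_succ', Equiv.Perm.mul_apply])
      (by simp only [← Equiv.Perm.mul_apply, ← pow_succ', Nat.sub_add_cancel hp, hper, pow_zero,
            Equiv.Perm.one_apply])
    simpa using this
  have hcard : #(orb π x) = p := by
    rw [himg, card_image_of_injOn, card_range]
    intro i hi j hj h
    exact hinj i (by simpa using hi) j (by simpa using hj) h
  rw [hcard]
  exact ⟨hper, hinj, himg⟩

theorem pow_card_orb (π : Equiv.Perm V) (x : V) : (π ^ #(orb π x)) x = x :=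
  (pow_card_orb_aux π x).1

theorem pow_apply_inj {π : Equiv.Perm V} {x : V} {i j : ℕ} (hi : i < #(orb π x))
    (hj : j < #(orb π x)) : (π ^ i) x = (π ^ j) x ↔ i = j :=
  ⟨(pow_card_orb_aux π x).2.1 i hi j hj, fun h => by rw [h]⟩

theorem orb_eq_image (π : Equiv.Perm V) (x : V) :
    orb π x = (range #(orb π x)).image fun i => (π ^ i) x :=
  (pow_card_orb_aux π x).2.2

theorem pow_mem_orb (π : Equiv.Perm V) (x : V) (i : ℕ) : (π ^ i) x ∈ orb π x :=
  mem_orb.2 ⟨i, by simp⟩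

theorem exists_pow_of_mem_orb {π : Equiv.Perm V} {x z : V} (h : z ∈ orb π x) :
    ∃ i < #(orb π x), (π ^ i) x = z := by
  rw [orb_eq_image] at h
  simpa using h

theorem orb_congr {π π' : Equiv.Perm V} {z : V} (h : ∀ t ∈ orb π z, π' t = π t) :
    orb π' z = orb π z := by
  have := orb_eq_image_of_path (π := π') (p := #(orb π z)) (f := fun i => (π ^ i) z)
    (orb_card_pos _ _)
    (fun i _ => by
      rw [h _ (pow_mem_orb _ _ _), pow_succ', Equiv.Perm.mul_apply])
    (by
      rw [h _ (pow_mem_orb _ _ _), ← Equiv.Perm.mul_apply, ← pow_succ',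
        Nat.sub_add_cancel (orb_card_pos _ _), pow_card_orb]
      simp)
  simp only [pow_zero, Equiv.Perm.one_apply] at this
  rw [this, ← orb_eq_image]

theorem apply_mem_orb_iff {π : Equiv.Perm V} {x z : V} : π z ∈ orb π x ↔ z ∈ orb π x := by
  rw [mem_orb, mem_orb]
  exact Equiv.Perm.sameCycle_apply_right

theorem orb_swap_mul_of_notMem {π : Equiv.Perm V} {x y z : V} (hx : x ∉ orb π z)
    (hy : y ∉ orb π z) : orb (Equiv.swap x y * π) z = orb π z := by
  apply orb_congr
  intro t ht
  rw [Equiv.Perm.mul_apply]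
  apply Equiv.swap_apply_of_ne_of_ne
  · rintro rfl; exact hx (apply_mem_orb ht)
  · rintro rfl; exact hy (apply_mem_orb ht)

/-! ### Cutting a cycle by a transposition -/

section Cut

variable {π : Equiv.Perm V} {x : V} {r : ℕ}

theorem swap_mul_apply_pow (hrn : r < #(orb π x)) {i : ℕ} (hi : i < #(orb π x))
    (hir : i ≠ r) (hi0 : i ≠ 0) : Equiv.swap x ((π ^ r) x) ((π ^ i) x) = (π ^ i) x := by
  apply Equiv.swap_apply_of_ne_of_ne
  · intro h
    exact hi0 ((pow_apply_inj hi (orb_card_pos π x)).1 (by simpa using h))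
  · rwa [Ne, pow_apply_inj hi hrn]

/-- Along `x, π x, …` the first arrow changed by the transposition is the one into `(π ^ r) x`,
which is redirected to `x`. -/
theorem orb_cut_left (hr : 0 < r) (hrn : r < #(orb π x)) :
    orb (Equiv.swap x ((π ^ r) x) * π) x = (range r).image fun i => (π ^ i) x := by
  have := orb_eq_image_of_path (π := Equiv.swap x ((π ^ r) x) * π) (p := r)
    (f := fun i => (π ^ i) x) hr
    (fun i hi => by
      rw [Equiv.Perm.mul_apply, ← Equiv.Perm.mul_apply π, ← pow_succ']
      exact swap_mul_apply_pow hrn (by omega) (by omega) (by omega))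
    (by
      rw [Equiv.Perm.mul_apply, ← Equiv.Perm.mul_apply π, ← pow_succ', Nat.sub_add_cancel hr,
        Equiv.swap_apply_right]
      simp)
  simpa using this

theorem orb_cut_right (hr : 0 < r) (hrn : r < #(orb π x)) :
    orb (Equiv.swap x ((π ^ r) x) * π) ((π ^ r) x) =
      (range (#(orb π x) - r)).image fun i => (π ^ (r + i)) x := by
  have := orb_eq_image_of_path (π := Equiv.swap x ((π ^ r) x) * π) (p := #(orb π x) - r)
    (f := fun i => (π ^ (r + i)) x) (by omega)
    (fun i hi => by
      rw [Equiv.Perm.mul_apply, ← Equiv.Perm.mul_apply π, ← pow_succ']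
      exact swap_mul_apply_pow hrn (by omega) (by omega) (by omega))
    (by
      rw [Equiv.Perm.mul_apply, ← Equiv.Perm.mul_apply π, ← pow_succ',
        show r + (#(orb π x) - r - 1) + 1 = #(orb π x) by omega, pow_card_orb,
        Equiv.swap_apply_left]
      simp)
  simpa using this

theorem card_orb_cut_left (hr : 0 < r) (hrn : r < #(orb π x)) :
    #(orb (Equiv.swap x ((π ^ r) x) * π) x) = r := by
  rw [orb_cut_left hr hrn, card_image_of_injOn, card_range]
  intro i hi j hj h
  simp only [coe_range, Set.mem_Iio] at hi hj
  exact (pow_apply_inj (by omega) (by omega)).1 h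

theorem card_orb_cut_right (hr : 0 < r) (hrn : r < #(orb π x)) :
    #(orb (Equiv.swap x ((π ^ r) x) * π) ((π ^ r) x)) = #(orb π x) - r := by
  rw [orb_cut_right hr hrn, card_image_of_injOn, card_range]
  intro i hi j hj h
  simp only [coe_range, Set.mem_Iio] at hi hj
  have := (pow_apply_inj (π := π) (x := x) (by omega) (by omega)).1 h
  omega

theorem pow_mem_orb_cut_left_iff (hr : 0 < r) (hrn : r < #(orb π x)) {i : ℕ}
    (hi : i < #(orb π x)) : (π ^ i) x ∈ orb (Equiv.swap x ((π ^ r) x) * π) x ↔ i < r := by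
  rw [orb_cut_left hr hrn, mem_image]
  constructor
  · rintro ⟨j, hj, h⟩
    rw [mem_range] at hj
    rw [pow_apply_inj (by omega) hi] at h
    omega
  · intro h
    exact ⟨i, mem_range.2 h, rfl⟩

theorem pow_mem_orb_cut_right_iff (hr : 0 < r) (hrn : r < #(orb π x)) {i : ℕ}
    (hi : i < #(orb π x)) :
    (π ^ i) x ∈ orb (Equiv.swap x ((π ^ r) x) * π) ((π ^ r) x) ↔ r ≤ i := by
  rw [orb_cut_right hr hrn, mem_image]
  constructor
  · rintro ⟨j, hj, h⟩
    rw [mem_range] at hj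
    rw [pow_apply_inj (by omega) hi] at h
    omega
  · intro h
    exact ⟨i - r, mem_range.2 (by omega), by rw [Nat.add_sub_cancel' h]⟩

theorem cut_pow_apply (hrn : r < #(orb π x)) {i : ℕ} (hi : i < r) :
    ((Equiv.swap x ((π ^ r) x) * π) ^ i) x = (π ^ i) x := by
  induction i with
  | zero => simp
  | succ i ih =>
    rw [pow_succ', Equiv.Perm.mul_apply, ih (by omega), Equiv.Perm.mul_apply,
      ← Equiv.Perm.mul_apply π, ← pow_succ']
    exact swap_mul_apply_pow hrn (by omega) (by omega) (by omega)

theorem orb_cut_union (hr : 0 < r) (hrn : r < #(orb π x)) :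
    orb (Equiv.swap x ((π ^ r) x) * π) x ∪ orb (Equiv.swap x ((π ^ r) x) * π) ((π ^ r) x) =
      orb π x := by
  ext z
  rw [mem_union]
  constructor
  · rintro (h | h)
    · rw [orb_cut_left hr hrn, mem_image] at h
      obtain ⟨i, -, rfl⟩ := h
      exact pow_mem_orb _ _ _
    · rw [orb_cut_right hr hrn, mem_image] at h
      obtain ⟨i, -, rfl⟩ := h
      exact pow_mem_orb _ _ _
  · intro h
    obtain ⟨i, hi, rfl⟩ := exists_pow_of_mem_orb h
    rw [pow_mem_orb_cut_left_iff hr hrn hi, pow_mem_orb_cut_right_iff hr hrn hi]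
    omega

theorem orb_cut_ne (hr : 0 < r) (hrn : r < #(orb π x)) :
    orb (Equiv.swap x ((π ^ r) x) * π) x ≠
      orb (Equiv.swap x ((π ^ r) x) * π) ((π ^ r) x) := by
  intro h
  have h1 := (pow_mem_orb_cut_left_iff hr hrn hrn).1 (by rw [h]; exact self_mem_orb _ _)
  omega

theorem orb_cut_of_notMem {z : V} (hz : z ∉ orb π x) :
    orb (Equiv.swap x ((π ^ r) x) * π) z = orb π z := by
  apply orb_swap_mul_of_notMem
  · rwa [mem_orb_comm]
  · intro h
    rw [mem_orb_comm, orb_eq_of_mem (pow_mem_orb π x r)] at h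
    exact hz h

theorem notMem_erase_of_mem_orb {π' : Equiv.Perm V} {z t : V} (hz : t ∈ orb π x)
    (ht : t ∈ orb π' z) : orb π' z ∉ (orbs π).erase (orb π x) := by
  intro h
  rw [mem_erase] at h
  apply h.1
  rw [← orb_eq_of_mem_orbs h.2 ht, orb_eq_of_mem hz]

theorem orbs_cut (hr : 0 < r) (hrn : r < #(orb π x)) :
    orbs (Equiv.swap x ((π ^ r) x) * π) =
      insert (orb (Equiv.swap x ((π ^ r) x) * π) x)
        (insert (orb (Equiv.swap x ((π ^ r) x) * π) ((π ^ r) x))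
          ((orbs π).erase (orb π x))) := by
  ext C
  rw [mem_insert, mem_insert, mem_erase]
  constructor
  · intro h
    obtain ⟨z, rfl⟩ := mem_orbs.1 h
    by_cases hz : z ∈ orb π x
    · rw [← orb_cut_union hr hrn, mem_union] at hz
      rcases hz with hz | hz
      · exact Or.inl (orb_eq_of_mem hz)
      · exact Or.inr (Or.inl (orb_eq_of_mem hz))
    · refine Or.inr (Or.inr ?_)
      rw [orb_cut_of_notMem hz]
      refine ⟨?_, orb_mem_orbs _ _⟩
      intro h
      exact hz (h ▸ self_mem_orb _ _)
  · rintro (rfl | rfl | ⟨h1, h2⟩)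
    · exact orb_mem_orbs _ _
    · exact orb_mem_orbs _ _
    · obtain ⟨z, rfl⟩ := mem_orbs.1 h2
      have hz : z ∉ orb π x := fun h => h1 (orb_eq_of_mem h)
      rw [← orb_cut_of_notMem hz (r := r)]
      exact orb_mem_orbs _ _

theorem orbs_cut_notMem_right :
    orb (Equiv.swap x ((π ^ r) x) * π) ((π ^ r) x) ∉ (orbs π).erase (orb π x) :=
  notMem_erase_of_mem_orb (pow_mem_orb π x r) (self_mem_orb _ _)

theorem orbs_cut_notMem_left (hr : 0 < r) (hrn : r < #(orb π x)) :
    orb (Equiv.swap x ((π ^ r) x) * π) x ∉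
      insert (orb (Equiv.swap x ((π ^ r) x) * π) ((π ^ r) x)) ((orbs π).erase (orb π x)) := by
  rw [mem_insert]
  rintro (h | h)
  · exact orb_cut_ne hr hrn h
  · exact notMem_erase_of_mem_orb (self_mem_orb π x) (self_mem_orb _ _) h

theorem orbs_cut_erase (hr : 0 < r) (hrn : r < #(orb π x)) :
    (orbs (Equiv.swap x ((π ^ r) x) * π)).erase (orb (Equiv.swap x ((π ^ r) x) * π) x) =
      insert (orb (Equiv.swap x ((π ^ r) x) * π) ((π ^ r) x)) ((orbs π).erase (orb π x)) := by
  rw [orbs_cut hr hrn, erase_insert (orbs_cut_notMem_left hr hrn)]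

theorem card_orbs_cut (hr : 0 < r) (hrn : r < #(orb π x)) :
    #(orbs (Equiv.swap x ((π ^ r) x) * π)) = #(orbs π) + 1 := by
  rw [orbs_cut hr hrn, card_insert_of_notMem (orbs_cut_notMem_left hr hrn),
    card_insert_of_notMem orbs_cut_notMem_right,
    card_erase_of_mem (orb_mem_orbs _ _)]
  have := card_pos.2 ⟨_, orb_mem_orbs π x⟩
  omega

theorem sum_orb_erase {M : Type*} [AddCommMonoid M] (π : Equiv.Perm V) (x : V) (g : V → M) :
    ∑ y ∈ (orb π x).erase x, g y = ∑ r ∈ Ioo 0 #(orb π x), g ((π ^ r) x) := by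
  symm
  refine sum_bij (fun r _ => (π ^ r) x) ?_ ?_ ?_ (fun _ _ => rfl)
  · intro r hr
    rw [mem_Ioo] at hr
    refine mem_erase.2 ⟨?_, pow_mem_orb _ _ _⟩
    intro h
    have := (pow_apply_inj hr.2 (orb_card_pos π x)).1 (by simpa using h)
    omega
  · intro r hr s hs h
    rw [mem_Ioo] at hr hs
    exact (pow_apply_inj hr.2 hs.2).1 h
  · intro y hy
    rw [mem_erase] at hy
    obtain ⟨i, hi, rfl⟩ := exists_pow_of_mem_orb hy.2
    refine ⟨i, mem_Ioo.2 ⟨?_, hi⟩, rfl⟩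
    rcases Nat.eq_zero_or_pos i with rfl | h
    · simp at hy
    · exact h

end Cut

/-! ### Joining two cycles by a transposition -/

section Join

variable {π : Equiv.Perm V} {x y : V}

theorem join_pow_left (hy : y ∉ orb π x) {i : ℕ} (hi : i < #(orb π x)) :
    ((Equiv.swap x y * π) ^ i) x = (π ^ i) x := by
  induction i with
  | zero => simp
  | succ i ih =>
    rw [pow_succ', Equiv.Perm.mul_apply, ih (by omega), Equiv.Perm.mul_apply,
      ← Equiv.Perm.mul_apply π, ← pow_succ']
    apply Equiv.swap_apply_of_ne_of_ne
    · intro h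
      have := (pow_apply_inj hi (orb_card_pos π x)).1 (by simpa using h)
      omega
    · rintro h
      exact hy (h ▸ pow_mem_orb _ _ _)

/-- Read from `x`, the merged cycle runs once through the old cycle of `x` and then enters the other
one at `y`. This places the marked point of `stepSum_marked`. -/
theorem join_pow_card (hy : y ∉ orb π x) : ((Equiv.swap x y * π) ^ #(orb π x)) x = y := by
  obtain ⟨m, hm⟩ : ∃ m, #(orb π x) = m + 1 := ⟨_, (Nat.sub_add_cancel (orb_card_pos π x)).symm⟩
  rw [hm, pow_succ', Equiv.Perm.mul_apply, join_pow_left hy (by omega), Equiv.Perm.mul_apply,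
    ← Equiv.Perm.mul_apply π, ← pow_succ', ← hm, pow_card_orb, Equiv.swap_apply_left]

theorem orb_join (hy : y ∉ orb π x) : orb (Equiv.swap x y * π) x = orb π x ∪ orb π y := by
  have hx : x ∉ orb π y := by rwa [mem_orb_comm]
  have hy' : y ∈ orb (Equiv.swap x y * π) x := by
    rw [mem_orb]; exact ⟨#(orb π x), by simpa using join_pow_card hy⟩
  apply Subset.antisymm
  · apply orb_subset
    · exact mem_union_left _ (self_mem_orb _ _)
    · intro z hz
      rw [Equiv.Perm.mul_apply]
      have hz' : π z ∈ orb π x ∪ orb π y := by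
        rw [mem_union] at *
        rwa [apply_mem_orb_iff, apply_mem_orb_iff]
      rcases eq_or_ne (π z) x with h | h
      · rw [h, Equiv.swap_apply_left]; exact mem_union_right _ (self_mem_orb _ _)
      rcases eq_or_ne (π z) y with h' | h'
      · rw [h', Equiv.swap_apply_right]; exact mem_union_left _ (self_mem_orb _ _)
      · rwa [Equiv.swap_apply_of_ne_of_ne h h']
  · intro z hz
    rw [mem_union] at hz
    rcases hz with hz | hz
    · obtain ⟨i, hi, rfl⟩ := exists_pow_of_mem_orb hz
      rw [← join_pow_left hy hi]
      exact pow_mem_orb _ _ _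
    · obtain ⟨i, hi, rfl⟩ := exists_pow_of_mem_orb hz
      rw [← join_pow_left hx hi, ← orb_eq_of_mem hy', Equiv.swap_comm x y]
      exact pow_mem_orb _ _ _

theorem disjoint_orb (hy : y ∉ orb π x) : Disjoint (orb π x) (orb π y) := by
  rw [disjoint_left]
  intro z hz hz'
  apply hy
  rw [← orb_eq_of_mem hz, orb_eq_of_mem hz']
  exact self_mem_orb _ _

theorem card_orb_join (hy : y ∉ orb π x) :
    #(orb (Equiv.swap x y * π) x) = #(orb π x) + #(orb π y) := by
  rw [orb_join hy, card_union_of_disjoint (disjoint_orb hy)]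

theorem orb_join_notMem :
    orb (Equiv.swap x y * π) x ∉ ((orbs π).erase (orb π x)).erase (orb π y) := by
  intro h
  exact notMem_erase_of_mem_orb (self_mem_orb π x) (self_mem_orb _ _) (mem_of_mem_erase h)

theorem orbs_join (hy : y ∉ orb π x) :
    orbs (Equiv.swap x y * π) = insert (orb (Equiv.swap x y * π) x)
      (((orbs π).erase (orb π x)).erase (orb π y)) := by
  ext C
  rw [mem_insert, mem_erase, mem_erase]
  constructor
  · intro h
    obtain ⟨z, rfl⟩ := mem_orbs.1 h
    by_cases hz : z ∈ orb (Equiv.swap x y * π) x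
    · exact Or.inl (orb_eq_of_mem hz)
    · right
      rw [orb_join hy, mem_union, not_or] at hz
      rw [orb_swap_mul_of_notMem (by rw [mem_orb_comm]; exact hz.1)
        (by rw [mem_orb_comm]; exact hz.2)]
      exact ⟨fun h => hz.2 (h ▸ self_mem_orb _ _), fun h => hz.1 (h ▸ self_mem_orb _ _),
        orb_mem_orbs _ _⟩
  · rintro (rfl | ⟨h1, h2, h3⟩)
    · exact orb_mem_orbs _ _
    · obtain ⟨z, rfl⟩ := mem_orbs.1 h3
      rw [← orb_swap_mul_of_notMem (x := x) (y := y) (π := π) (z := z)]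
      · exact orb_mem_orbs _ _
      · intro h; exact h2 (orb_eq_of_mem h).symm
      · intro h; exact h1 (orb_eq_of_mem h).symm

theorem orb_mem_erase (hy : y ∉ orb π x) : orb π y ∈ (orbs π).erase (orb π x) :=
  mem_erase.2 ⟨fun h => hy (h ▸ self_mem_orb _ _), orb_mem_orbs _ _⟩

theorem card_orbs_join (hy : y ∉ orb π x) :
    #(orbs (Equiv.swap x y * π)) + 1 = #(orbs π) := by
  rw [orbs_join hy, card_insert_of_notMem orb_join_notMem,
    card_erase_of_mem (orb_mem_erase hy), card_erase_of_mem (orb_mem_orbs _ _)]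
  have h1 := card_pos.2 ⟨_, orb_mem_erase hy⟩
  rw [card_erase_of_mem (orb_mem_orbs _ _)] at h1
  omega

theorem orbs_join_erase (hy : y ∉ orb π x) :
    (orbs (Equiv.swap x y * π)).erase (orb (Equiv.swap x y * π) x) =
      ((orbs π).erase (orb π x)).erase (orb π y) := by
  rw [orbs_join hy, erase_insert orb_join_notMem]

end Join

theorem orb_one (x : V) : orb (1 : Equiv.Perm V) x = {x} := by
  ext z
  simp [mem_orb, eq_comm]

theorem card_orbs_one : #(orbs (1 : Equiv.Perm V)) = Fintype.card V := by
  rw [orbs, card_image_of_injective, card_univ]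
  intro x y h
  simpa [orb_one] using h

theorem sum_univ_eq_sum_orbs {M : Type*} [AddCommMonoid M] (π : Equiv.Perm V) (g : V → M) :
    ∑ x, g x = ∑ C ∈ orbs π, ∑ x ∈ C, g x := by
  rw [← sum_fiberwise_of_maps_to (t := orbs π) (g := orb π) (fun x _ => orb_mem_orbs π x)]
  refine sum_congr rfl fun C hC => sum_congr ?_ fun _ _ => rfl
  ext x
  simp only [mem_filter, mem_univ, true_and]
  exact ⟨fun h => h ▸ self_mem_orb _ _, fun h => orb_eq_of_mem_orbs hC h⟩

theorem sum_card_orbs (π : Equiv.Perm V) : ∑ C ∈ orbs π, #C = Fintype.card V := by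
  have := sum_univ_eq_sum_orbs π (fun _ => 1)
  simpa using this.symm

end Orbits

end KCycleFactorisation

namespace KCycleFactorisation

/-! ### Numerical recursions for successive cuts and joins -/

section Recursions

open Finset

/-- Coefficients of the powers of the series `∑ w n xⁿ`. -/
def cutCoeff (w : ℕ → ℚ) : ℕ → ℕ → ℚ
  | 0, n => w n
  | j + 1, n => ∑ r ∈ Ioo 0 n, w (n - r) * cutCoeff w j r

/-- The first-order variation of `cutCoeff` in the direction `α`. -/
def cutVar (w α : ℕ → ℚ) : ℕ → ℕ → ℚ
  | 0, n => α n
  | j + 1, n => ∑ r ∈ Ioo 0 n, (w (n - r) * cutVar w α j r + α (n - r) * cutCoeff w j r)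

/-- The weight of `j` successive cuts of a cycle of length `a + b` with a marked point at
position `a` that must not be used. -/
def markedCutCoeff (w : ℕ → ℚ) : ℕ → ℕ → ℕ → ℚ
  | 0, a, b => w (a + b)
  | j + 1, a, b => ∑ r ∈ Ioo 0 a, w (a + b - r) * cutCoeff w j r +
      ∑ r ∈ Ioo 0 b, w (b - r) * markedCutCoeff w j a r

/-- The weight of `j` successive steps from a cycle of length `a`, one of which joins a cycle of
length `b` at a prescribed point and the others are cuts. -/
def joinCoeff (w : ℕ → ℚ) : ℕ → ℕ → ℕ → ℚ
  | 0, _, _ => 0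
  | j + 1, a, b => ∑ r ∈ Ioo 0 a, w (a - r) * joinCoeff w j r b + markedCutCoeff w j a b

theorem cutVar_sum {ι : Type*} (w : ℕ → ℚ) (s : Finset ι) (α : ι → ℕ → ℚ) (c : ι → ℚ)
    (j n : ℕ) : cutVar w (fun m => ∑ i ∈ s, α i m * c i) j n = ∑ i ∈ s, cutVar w (α i) j n * c i := by
  induction j generalizing n with
  | zero => rfl
  | succ j ih =>
    simp only [cutVar, ih, sum_mul, mul_sum]
    rw [sum_comm]
    refine sum_congr rfl fun r _ => ?_
    rw [← sum_add_distrib]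
    refine sum_congr rfl fun i _ => ?_
    ring

theorem cutVar_mul (w α : ℕ → ℚ) (c : ℚ) (j n : ℕ) :
    cutVar w (fun m => c * α m) j n = c * cutVar w α j n := by
  have := cutVar_sum w {()} (fun _ => α) (fun _ => c) j n
  simpa [mul_comm] using this

end Recursions

/-! ### Weights of cycle systems, with and without a distinguished pair -/

section Weights

open Finset

variable {V : Type*} [Fintype V] [DecidableEq V] (w : ℕ → ℚ) (A : ℕ → ℕ → ℚ)

/-- The product of the weights of the members of a family of sets. -/
def weight (O : Finset (Finset V)) : ℚ := ∏ C ∈ O, w #C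

/-- The sum over all ways to pair a further set of size `n` with a member of `O` inside `Z`. -/
def pairWeight (O : Finset (Finset V)) (Z : Finset V) (n : ℕ) : ℚ :=
  ∑ D ∈ O with D ⊆ Z, A n #D * weight w (O.erase D)

/-- The sum over all ways to pair a member of `O` inside `X` with a member of `O` outside `X`. -/
def annularWeight (O : Finset (Finset V)) (X : Finset V) : ℚ :=
  ∑ C ∈ O with C ⊆ X, pairWeight w A (O.erase C) Xᶜ #C

variable {w A}

omit [Fintype V] in
theorem weight_insert {O : Finset (Finset V)} {C : Finset V} (hC : C ∉ O) :
    weight w (insert C O) = w #C * weight w O := prod_insert hC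

theorem weight_orbs (π : Equiv.Perm V) (x : V) :
    weight w (orbs π) = w #(orb π x) * weight w ((orbs π).erase (orb π x)) := by
  rw [← weight_insert (notMem_erase _ _), insert_erase (orb_mem_orbs _ _)]

omit [Fintype V] in
theorem pairWeight_insert {O : Finset (Finset V)} {C Z : Finset V} (hC : C ∉ O)
    (hCZ : ¬ C ⊆ Z) (n : ℕ) :
    pairWeight w A (insert C O) Z n = w #C * pairWeight w A O Z n := by
  rw [pairWeight, pairWeight, filter_insert, if_neg hCZ, mul_sum]
  refine sum_congr rfl fun D hD => ?_
  rw [mem_filter] at hD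
  have hne : C ≠ D := fun h => hC (h ▸ hD.1)
  rw [erase_insert_of_ne hne, weight_insert (fun h => hC (mem_of_mem_erase h))]
  ring

/-- Either the new set stays outside the distinguished pair, or it is the member of the pair lying
in `X`. -/
theorem annularWeight_insert {O : Finset (Finset V)} {C X : Finset V} (hC : C ∉ O)
    (hCX : C ⊆ X) (hne : C.Nonempty) :
    annularWeight w A (insert C O) X =
      w #C * annularWeight w A O X + pairWeight w A O Xᶜ #C := by
  have hCX' : ¬ C ⊆ Xᶜ := by
    intro h
    obtain ⟨x, hx⟩ := hne
    exact (mem_compl.1 (h hx)) (hCX hx)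
  rw [annularWeight, annularWeight, filter_insert, if_pos hCX, sum_insert (by simp [hC]),
    erase_insert hC, add_comm, mul_sum]
  congr 1
  refine sum_congr rfl fun D hD => ?_
  rw [mem_filter] at hD
  have hne : C ≠ D := fun h => hC (h ▸ hD.1)
  rw [erase_insert_of_ne hne,
    pairWeight_insert (fun h => hC (mem_of_mem_erase h)) hCX']

theorem annularWeight_eq_sum_pairs {O : Finset (Finset V)} (X : Finset V)
    (hO : ∀ C ∈ O, C.Nonempty) :
    annularWeight w A O X = ∑ C ∈ O with C ⊆ X, ∑ D ∈ O with D ⊆ Xᶜ,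
      A #C #D * weight w ((O.erase C).erase D) := by
  refine sum_congr rfl fun C hC => ?_
  rw [mem_filter] at hC
  rw [pairWeight]
  refine sum_congr ?_ fun _ _ => rfl
  ext D
  simp only [mem_filter, mem_erase]
  refine ⟨fun h => ⟨h.1.2, h.2⟩, fun h => ⟨⟨?_, h.1⟩, h.2⟩⟩
  rintro rfl
  obtain ⟨x, hx⟩ := hO _ h.1
  exact (mem_compl.1 (h.2 hx)) (hC.2 hx)

theorem annularWeight_compl (hA : ∀ a b, A a b = A b a) {O : Finset (Finset V)} (X : Finset V)
    (hO : ∀ C ∈ O, C.Nonempty) : annularWeight w A O Xᶜ = annularWeight w A O X := by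
  rw [annularWeight_eq_sum_pairs _ hO, annularWeight_eq_sum_pairs _ hO, sum_comm, compl_compl]
  refine sum_congr rfl fun C _ => sum_congr rfl fun D _ => ?_
  rw [hA, erase_right_comm]

theorem nonempty_of_mem_orbs {π : Equiv.Perm V} {C : Finset V} (h : C ∈ orbs π) :
    C.Nonempty := by
  obtain ⟨x, rfl⟩ := mem_orbs.1 h
  exact ⟨x, self_mem_orb _ _⟩

end Weights

/-! ### Sums over a `k`-cycle, one transposition at a time -/

section Sums

open Finset

variable {V : Type*} [Fintype V] [DecidableEq V]

/-- The sum of `g (formPerm (x :: l) * π)` over the lists `l` of `j` distinct points outside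
`S`. -/
def stepSum (g : Equiv.Perm V → ℚ) (x : V) : ℕ → Finset V → Equiv.Perm V → ℚ
  | 0, _, π => g π
  | j + 1, S, π => ∑ y ∈ Sᶜ, stepSum g x j (insert y S) (Equiv.swap x y * π)

/-- The variant of `stepSum` in which the summand is built with `g` if the list stays on the side
of `x` with respect to `X`, and with `h` otherwise. -/
def sideStepSum (X : Finset V) (g h : Equiv.Perm V → ℚ) (x : V) :
    ℕ → Finset V → Equiv.Perm V → ℚ
  | 0, _, π => g π
  | j + 1, S, π => ∑ y ∈ Sᶜ,
      if y ∈ X ↔ x ∈ X then sideStepSum X g h x j (insert y S) (Equiv.swap x y * π)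
      else stepSum h x j (insert y S) (Equiv.swap x y * π)

theorem sideStepSum_compl (X : Finset V) (g h : Equiv.Perm V → ℚ) (x : V) (j : ℕ)
    (S : Finset V) (π : Equiv.Perm V) :
    sideStepSum Xᶜ g h x j S π = sideStepSum X g h x j S π := by
  induction j generalizing S π with
  | zero => rfl
  | succ j ih => simp only [sideStepSum, mem_compl, not_iff_not, ih]

theorem card_orbs_swap_mul_le (π : Equiv.Perm V) (x y : V) :
    #(orbs (Equiv.swap x y * π)) ≤ #(orbs π) + 1 := by
  by_cases hy : y ∈ orb π x
  · obtain ⟨r, hr, rfl⟩ := exists_pow_of_mem_orb hy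
    rcases Nat.eq_zero_or_pos r with rfl | h
    · rw [pow_zero, Equiv.Perm.one_apply, Equiv.swap_self, ← Equiv.Perm.one_def, one_mul]
      omega
    · rw [card_orbs_cut h hr]
  · have := card_orbs_join hy
    omega

/-- A transposition creates at most one cycle, so the deficit cannot be made up in `j` steps. -/
theorem stepSum_eq_zero {g : Equiv.Perm V → ℚ} {N : ℕ}
    (hg : ∀ π, #(orbs π) < N → g π = 0) (x : V) (j : ℕ) (S : Finset V) (π : Equiv.Perm V)
    (h : j + #(orbs π) < N) : stepSum g x j S π = 0 := by
  induction j generalizing S π with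
  | zero => exact hg π (by omega)
  | succ j ih =>
    refine sum_eq_zero fun y _ => ih _ _ ?_
    have := card_orbs_swap_mul_le π x y
    omega

theorem sum_compl_eq_sum_pow {π : Equiv.Perm V} {x : V} {S : Finset V}
    (hS : S ∩ orb π x = {x}) (f : V → ℚ) (hf : ∀ y ∉ orb π x, f y = 0) :
    ∑ y ∈ Sᶜ, f y = ∑ r ∈ Ioo 0 #(orb π x), f ((π ^ r) x) := by
  rw [← sum_orb_erase]
  symm
  refine sum_subset ?_ ?_
  · intro y hy
    rw [mem_erase] at hy
    rw [mem_compl]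
    intro hyS
    have : y ∈ S ∩ orb π x := mem_inter.2 ⟨hyS, hy.2⟩
    rw [hS, mem_singleton] at this
    exact hy.1 this
  · intro y hy hy'
    apply hf
    intro hyo
    apply hy'
    refine mem_erase.2 ⟨?_, hyo⟩
    rintro rfl
    have : y ∈ S ∩ orb π y := by rw [hS]; exact mem_singleton_self _
    exact (mem_compl.1 hy) (mem_inter.1 this).1

theorem insert_inter_orb_cut {π : Equiv.Perm V} {x : V} {S : Finset V}
    (hS : S ∩ orb π x = {x}) {r : ℕ} (hr : 0 < r) (hrn : r < #(orb π x)) :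
    insert ((π ^ r) x) S ∩ orb (Equiv.swap x ((π ^ r) x) * π) x = {x} := by
  rw [insert_inter_of_notMem]
  · apply Subset.antisymm
    · rw [← hS]
      refine inter_subset_inter_left ?_
      rw [← orb_cut_union hr hrn]
      exact subset_union_left
    · rw [singleton_subset_iff, mem_inter]
      refine ⟨?_, self_mem_orb _ _⟩
      have : x ∈ S ∩ orb π x := by rw [hS]; exact mem_singleton_self _
      exact (mem_inter.1 this).1
  · rw [pow_mem_orb_cut_left_iff hr hrn hrn]
    omega

/-- With `j + #(orbs π) = N` every step has to be a cut. Used points always end up on detached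
pieces, as the condition `S ∩ orb π x = {x}` records, so distinctness of the points never excludes a
cut. A cut at `r` detaches a piece of length `n - r` and goes on with the piece of length `r` at
`x`. -/
theorem stepSum_cut {w : ℕ → ℚ} {g : Equiv.Perm V → ℚ} {N : ℕ} {c : ℚ}
    (hg : ∀ π, #(orbs π) < N → g π = 0)
    (hg' : ∀ π, #(orbs π) = N → g π = c * weight w (orbs π)) (x : V) (j : ℕ) (S : Finset V)
    (π : Equiv.Perm V) (h : j + #(orbs π) = N) (hS : S ∩ orb π x = {x}) :
    stepSum g x j S π =
      c * (cutCoeff w j #(orb π x) * weight w ((orbs π).erase (orb π x))) := by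
  induction j generalizing S π with
  | zero => rw [stepSum, hg' π (by omega), cutCoeff, weight_orbs π x]
  | succ j ih =>
    rw [stepSum, sum_compl_eq_sum_pow hS, cutCoeff, sum_mul, mul_sum]
    · refine sum_congr rfl fun r hr => ?_
      rw [mem_Ioo] at hr
      rw [ih _ _ (by rw [card_orbs_cut hr.1 hr.2]; omega) (insert_inter_orb_cut hS hr.1 hr.2),
        orbs_cut_erase hr.1 hr.2, weight_insert orbs_cut_notMem_right,
        card_orb_cut_left hr.1 hr.2, card_orb_cut_right hr.1 hr.2]
      ring
    · intro y hy
      apply stepSum_eq_zero hg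
      have := card_orbs_join hy
      omega

/-- The situation just after a join: the joined point lies on the cycle of `x` at position `a`, and
it is the one point of that cycle, other than `x`, that may not be chosen. -/
theorem stepSum_marked {w : ℕ → ℚ} {g : Equiv.Perm V → ℚ} {N : ℕ} {c : ℚ}
    (hg : ∀ π, #(orbs π) < N → g π = 0)
    (hg' : ∀ π, #(orbs π) = N → g π = c * weight w (orbs π)) (x : V) (j : ℕ) (S : Finset V)
    (π : Equiv.Perm V) (h : j + #(orbs π) = N) {a b : ℕ} (ha : 0 < a) (hb : 0 < b)
    (hab : #(orb π x) = a + b) (hS : S ∩ orb π x = {x, (π ^ a) x}) :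
    stepSum g x j S π =
      c * (markedCutCoeff w j a b * weight w ((orbs π).erase (orb π x))) := by
  induction j generalizing S π b with
  | zero => rw [stepSum, hg' π (by omega), markedCutCoeff, weight_orbs π x, hab]
  | succ j ih =>
    have hmem : (π ^ a) x ∈ S := by
      have : (π ^ a) x ∈ S ∩ orb π x := by rw [hS]; simp
      exact (mem_inter.1 this).1
    have hsum : ∑ y ∈ Sᶜ, stepSum g x j (insert y S) (Equiv.swap x y * π) =
        ∑ r ∈ (Ioo 0 (a + b)).erase a,
          stepSum g x j (insert ((π ^ r) x) S) (Equiv.swap x ((π ^ r) x) * π) := by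
      have h1 : (S.erase ((π ^ a) x)) ∩ orb π x = {x} := by
        rw [erase_inter, hS]
        rw [pair_comm, erase_insert]
        rw [mem_singleton]
        intro h0
        have := (pow_apply_inj (π := π) (x := x) (i := a) (j := 0) (by omega) (by omega)).1
          (by simpa using h0)
        omega
      have h2 := sum_compl_eq_sum_pow h1
        (fun y => stepSum g x j (insert y S) (Equiv.swap x y * π)) (by
          intro y hy
          apply stepSum_eq_zero hg
          have := card_orbs_join hy
          omega)
      rw [compl_erase, sum_insert (by simpa using hmem), hab,
        ← add_sum_erase (Ioo 0 (a + b)) _ (mem_Ioo.2 ⟨ha, by omega⟩ : a ∈ Ioo 0 (a + b))] at h2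
      exact add_left_cancel h2
    -- A cut at `r < a` detaches the marked point and leaves unrestricted cuts; a cut at `a + s`
    -- keeps the mark at position `a` and shortens the tail from `b` to `s`.
    have hsplit : (Ioo 0 (a + b)).erase a = (Ioo 0 a) ∪ (Ioo 0 b).map (addLeftEmbedding a) := by
      ext r
      simp only [mem_erase, mem_Ioo, mem_union, mem_map, addLeftEmbedding_apply]
      constructor
      · intro hr
        by_cases h : r < a
        · left; omega
        · right; exact ⟨r - a, by omega, by omega⟩
      · rintro (hr | ⟨s, hs, rfl⟩) <;> omega
    have hdisj : Disjoint (Ioo 0 a) ((Ioo 0 b).map (addLeftEmbedding a)) := by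
      rw [disjoint_left]
      intro r hr hr'
      rw [mem_map] at hr'
      obtain ⟨s, hs, rfl⟩ := hr'
      simp only [mem_Ioo, addLeftEmbedding_apply] at hr hs
      omega
    rw [stepSum, hsum, hsplit, sum_union hdisj, sum_map, markedCutCoeff, add_mul, mul_add,
      sum_mul, mul_sum, sum_mul, mul_sum]
    congr 1
    · refine sum_congr rfl fun r hr => ?_
      rw [mem_Ioo] at hr
      have hrn : r < #(orb π x) := by omega
      rw [stepSum_cut hg hg' x j _ _ (by rw [card_orbs_cut hr.1 hrn]; omega),
        orbs_cut_erase hr.1 hrn, weight_insert orbs_cut_notMem_right,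
        card_orb_cut_left hr.1 hrn, card_orb_cut_right hr.1 hrn, hab]
      · ring
      · rw [insert_inter_of_notMem]
        · ext z
          rw [mem_inter, mem_singleton]
          constructor
          · rintro ⟨hz, hz'⟩
            have hzo : z ∈ orb π x := by
              rw [← orb_cut_union hr.1 hrn]; exact mem_union_left _ hz'
            have : z ∈ S ∩ orb π x := mem_inter.2 ⟨hz, hzo⟩
            rw [hS, mem_insert, mem_singleton] at this
            rcases this with rfl | rfl
            · rfl
            · rw [pow_mem_orb_cut_left_iff hr.1 hrn (by omega)] at hz'
              omega
          · rintro rfl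
            have : z ∈ S ∩ orb π z := by rw [hS]; simp
            exact ⟨(mem_inter.1 this).1, self_mem_orb _ _⟩
        · rw [pow_mem_orb_cut_left_iff hr.1 hrn hrn]
          omega
    · refine sum_congr rfl fun r hr => ?_
      rw [mem_Ioo] at hr
      rw [addLeftEmbedding_apply]
      have hr0 : 0 < a + r := by omega
      have hrn : a + r < #(orb π x) := by omega
      rw [ih _ _ (by rw [card_orbs_cut hr0 hrn]; omega) hr.1 (card_orb_cut_left hr0 hrn),
        orbs_cut_erase hr0 hrn, weight_insert orbs_cut_notMem_right,
        card_orb_cut_right hr0 hrn, hab, show a + b - (a + r) = b - r by omega]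
      · ring
      · rw [cut_pow_apply hrn (by omega), insert_inter_of_notMem]
        · ext z
          rw [mem_inter]
          constructor
          · rintro ⟨hz, hz'⟩
            rw [← hS, mem_inter]
            refine ⟨hz, ?_⟩
            rw [← orb_cut_union hr0 hrn]; exact mem_union_left _ hz'
          · intro hz
            have hzS : z ∈ S ∩ orb π x := by rw [hS]; exact hz
            refine ⟨(mem_inter.1 hzS).1, ?_⟩
            rw [mem_insert, mem_singleton] at hz
            rcases hz with rfl | rfl
            · exact self_mem_orb _ _
            · rw [pow_mem_orb_cut_left_iff hr0 hrn (by omega)]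
              omega
        · rw [pow_mem_orb_cut_left_iff hr0 hrn hrn]
          omega

end Sums

end KCycleFactorisation

namespace KCycleFactorisation

/-! ### The same sums relative to an invariant set `X` -/

section SideSums

open Finset

variable {V : Type*} [Fintype V] [DecidableEq V]

/-- `π` preserves the set `X`. -/
def Preserves (X : Finset V) (π : Equiv.Perm V) : Prop := ∀ z, π z ∈ X ↔ z ∈ X

instance (X : Finset V) : DecidablePred (Preserves X) := fun _ => by
  unfold Preserves; infer_instance

theorem Preserves.orb_subset {X : Finset V} {π : Equiv.Perm V} (h : Preserves X π) {x : V}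
    (hx : x ∈ X) : orb π x ⊆ X :=
  KCycleFactorisation.orb_subset hx fun z hz => (h z).2 hz

theorem Preserves.compl {X : Finset V} {π : Equiv.Perm V} (h : Preserves X π) :
    Preserves Xᶜ π := fun z => by rw [mem_compl, mem_compl, h z]

omit [Fintype V] [DecidableEq V] in
theorem Preserves.mul {X : Finset V} {π π' : Equiv.Perm V} (h : Preserves X π)
    (h' : Preserves X π') : Preserves X (π * π') := fun z => by
  rw [Equiv.Perm.mul_apply, h, h']

omit [Fintype V] [DecidableEq V] in
theorem Preserves.inv {X : Finset V} {π : Equiv.Perm V} (h : Preserves X π) :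
    Preserves X π⁻¹ := fun z => by
  rw [← h, ← Equiv.Perm.mul_apply, mul_inv_cancel, Equiv.Perm.one_apply]

omit [Fintype V] in
theorem preserves_swap {X : Finset V} {x y : V} (h : y ∈ X ↔ x ∈ X) :
    Preserves X (Equiv.swap x y) := by
  intro z
  rcases eq_or_ne z x with rfl | h1
  · rw [Equiv.swap_apply_left, h]
  rcases eq_or_ne z y with rfl | h2
  · rw [Equiv.swap_apply_right, h]
  · rw [Equiv.swap_apply_of_ne_of_ne h1 h2]

theorem Preserves.mem_iff_of_mem_orb {X : Finset V} {π : Equiv.Perm V} (h : Preserves X π)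
    {x y : V} (hy : y ∈ orb π x) : y ∈ X ↔ x ∈ X :=
  ⟨fun hyX => h.orb_subset hyX (mem_orb_comm.1 hy), fun hx => h.orb_subset hx hy⟩

/-- Since `π` preserves `X`, a step to the other side is a join. It loses a cycle instead of gaining
one, which explains the gap of two between the thresholds for `h` and `g`. -/
theorem sideStepSum_eq_zero {X : Finset V} {g h : Equiv.Perm V → ℚ} {N : ℕ}
    (hh : ∀ π, #(orbs π) < N → h π = 0)
    (hg : ∀ π, Preserves X π → #(orbs π) < N + 2 → g π = 0) (x : V) (j : ℕ) (S : Finset V)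
    (π : Equiv.Perm V) (hX : Preserves X π) (hj : j + #(orbs π) < N + 2) (hxS : x ∈ S) :
    sideStepSum X g h x j S π = 0 := by
  induction j generalizing S π with
  | zero => exact hg π hX (by omega)
  | succ j ih =>
    refine sum_eq_zero fun y hy => ?_
    split_ifs with hyX
    · refine ih _ _ ((preserves_swap hyX).mul hX) ?_ (mem_insert_of_mem hxS)
      have := card_orbs_swap_mul_le π x y
      omega
    · apply stepSum_eq_zero hh
      have : y ∉ orb π x := fun h => hyX (hX.mem_iff_of_mem_orb h)
      have := card_orbs_join this
      omega

theorem sum_eq_sum_orbs_filter {X : Finset V} {π : Equiv.Perm V} (hX : Preserves X π)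
    (f : V → ℚ) : ∑ y ∈ X, f y = ∑ D ∈ orbs π with D ⊆ X, ∑ y ∈ D, f y := by
  have h := sum_univ_eq_sum_orbs π (fun y => if y ∈ X then f y else 0)
  rw [← sum_filter, filter_mem_eq_inter, univ_inter] at h
  rw [h, sum_filter]
  refine sum_congr rfl fun D hD => ?_
  split_ifs with hDX
  · exact sum_congr rfl fun y hy => if_pos (hDX hy)
  · refine sum_eq_zero fun y hy => if_neg fun hyX => hDX ?_
    rw [← orb_eq_of_mem_orbs hD hy]
    exact hX.orb_subset hyX

/-- The three terms are: only cuts, with the distinguished pair avoiding the cycle of `x`; only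
cuts, with one piece of that cycle in the pair; and one join, made by the present `k`-cycle, with a
cycle `D` on the other side. The second is a first variation because exactly one of the factors `w`
is replaced by a pair weight. -/
theorem sideStepSum_cut {w : ℕ → ℚ} {A : ℕ → ℕ → ℚ} {X : Finset V} {g h : Equiv.Perm V → ℚ}
    {N : ℕ} {c : ℚ}
    (hh : ∀ π, #(orbs π) < N → h π = 0)
    (hh' : ∀ π, #(orbs π) = N → h π = c * weight w (orbs π))
    (hg : ∀ π, Preserves X π → #(orbs π) < N + 2 → g π = 0)
    (hg' : ∀ π, Preserves X π → #(orbs π) = N + 2 → g π = c * annularWeight w A (orbs π) X)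
    (x : V) (hx : x ∈ X) (j : ℕ) (S : Finset V) (π : Equiv.Perm V) (hX : Preserves X π)
    (hj : j + #(orbs π) = N + 2) (hS : S ∩ orb π x = {x}) (hSX : S ⊆ X) :
    sideStepSum X g h x j S π =
      c * (cutCoeff w j #(orb π x) * annularWeight w A ((orbs π).erase (orb π x)) X +
        cutVar w (pairWeight w A ((orbs π).erase (orb π x)) Xᶜ) j #(orb π x) +
        ∑ D ∈ ((orbs π).erase (orb π x)) with D ⊆ Xᶜ,
          #D * (joinCoeff w j #(orb π x) #D * weight w (((orbs π).erase (orb π x)).erase D))) := by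
  induction j generalizing S π with
  | zero =>
    rw [sideStepSum, hg' π hX (by omega), ← insert_erase (orb_mem_orbs π x),
      annularWeight_insert (notMem_erase _ _) (hX.orb_subset hx) ⟨x, self_mem_orb _ _⟩,
      erase_insert (notMem_erase _ _)]
    simp [cutCoeff, cutVar, joinCoeff]
  | succ j ih =>
    have hxS : x ∈ S := by
      have : x ∈ S ∩ orb π x := by rw [hS]; exact mem_singleton_self _
      exact (mem_inter.1 this).1
    have hsplit : ∀ y, (if y ∈ X ↔ x ∈ X then
          sideStepSum X g h x j (insert y S) (Equiv.swap x y * π)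
          else stepSum h x j (insert y S) (Equiv.swap x y * π)) =
        (if y ∈ X then sideStepSum X g h x j (insert y S) (Equiv.swap x y * π) else 0) +
        (if y ∈ Xᶜ then stepSum h x j (insert y S) (Equiv.swap x y * π) else 0) := by
      intro y
      by_cases hy : y ∈ X <;> simp [hx, hy]
    rw [sideStepSum, sum_congr rfl fun y _ => hsplit y, sum_add_distrib]
    have hcut : ∑ y ∈ Sᶜ,
        (if y ∈ X then sideStepSum X g h x j (insert y S) (Equiv.swap x y * π) else 0) =
        ∑ r ∈ Ioo 0 #(orb π x), sideStepSum X g h x j (insert ((π ^ r) x) S)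
          (Equiv.swap x ((π ^ r) x) * π) := by
      rw [sum_compl_eq_sum_pow hS]
      · refine sum_congr rfl fun r _ => if_pos ?_
        exact hX.orb_subset hx (pow_mem_orb _ _ _)
      · intro y hy
        split_ifs with hyX
        · refine sideStepSum_eq_zero hh hg x j _ _
            ((preserves_swap (by simp [hx, hyX])).mul hX) ?_ (mem_insert_of_mem hxS)
          have := card_orbs_join hy
          omega
        · rfl
    -- All points of `D` contribute equally, whence the factor `#D`. After the join the used points
    -- on the merged cycle are exactly `x` and `y`, as `stepSum_marked` requires.
    have hjoin : ∑ y ∈ Sᶜ,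
        (if y ∈ Xᶜ then stepSum h x j (insert y S) (Equiv.swap x y * π) else 0) =
        ∑ D ∈ ((orbs π).erase (orb π x)) with D ⊆ Xᶜ, c * (#D *
          (markedCutCoeff w j #(orb π x) #D *
            weight w (((orbs π).erase (orb π x)).erase D))) := by
      have hS' : (Sᶜ).filter (· ∈ Xᶜ) = Xᶜ := by
        ext y
        simp only [mem_filter, mem_compl]
        exact ⟨fun h => h.2, fun h => ⟨fun h' => h (hSX h'), h⟩⟩
      rw [← sum_filter, hS', sum_eq_sum_orbs_filter hX.compl]
      have hf : (orbs π).filter (· ⊆ Xᶜ) = ((orbs π).erase (orb π x)).filter (· ⊆ Xᶜ) := by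
        ext D
        simp only [mem_filter, mem_erase]
        refine ⟨fun h => ⟨⟨?_, h.1⟩, h.2⟩, fun h => ⟨h.1.2, h.2⟩⟩
        rintro rfl
        exact (mem_compl.1 (h.2 (self_mem_orb π x))) hx
      rw [hf]
      refine sum_congr rfl fun D hD => ?_
      rw [mem_filter, mem_erase] at hD
      have : ∀ y ∈ D, stepSum h x j (insert y S) (Equiv.swap x y * π) =
          c * (markedCutCoeff w j #(orb π x) #D *
            weight w (((orbs π).erase (orb π x)).erase D)) := by
        intro y hy
        have hDy : orb π y = D := orb_eq_of_mem_orbs hD.1.2 hy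
        have hyx : y ∉ orb π x := fun h' => hD.1.1 (by rw [← hDy, orb_eq_of_mem h'])
        have hcard := card_orbs_join hyx
        rw [stepSum_marked hh hh' x j _ _ (by omega) (orb_card_pos π x) (orb_card_pos π y)
          (card_orb_join hyx), orbs_join_erase hyx, hDy]
        rw [join_pow_card hyx, orb_join hyx, insert_inter_of_mem
          (mem_union_right _ (self_mem_orb _ _)), inter_union_distrib_left, hS]
        have : S ∩ orb π y = ∅ := by
          rw [← disjoint_iff_inter_eq_empty]
          refine disjoint_left.2 fun z hz hz' => ?_
          rw [hDy] at hz'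
          exact mem_compl.1 (hD.2 hz') (hSX hz)
        rw [this, union_empty, pair_comm]
      rw [sum_congr rfl this, sum_const, nsmul_eq_mul]
      ring
    have hstep : ∀ r ∈ Ioo 0 #(orb π x), sideStepSum X g h x j (insert ((π ^ r) x) S)
        (Equiv.swap x ((π ^ r) x) * π) =
        c * ((w (#(orb π x) - r) * cutCoeff w j r) *
            annularWeight w A ((orbs π).erase (orb π x)) X +
          (w (#(orb π x) - r) * cutVar w (pairWeight w A ((orbs π).erase (orb π x)) Xᶜ) j r +
            pairWeight w A ((orbs π).erase (orb π x)) Xᶜ (#(orb π x) - r) * cutCoeff w j r) +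
          ∑ D ∈ ((orbs π).erase (orb π x)) with D ⊆ Xᶜ, #D *
            ((w (#(orb π x) - r) * joinCoeff w j r #D) *
              weight w (((orbs π).erase (orb π x)).erase D))) := by
      intro r hr
      rw [mem_Ioo] at hr
      have hyX : (π ^ r) x ∈ X := hX.orb_subset hx (pow_mem_orb _ _ _)
      have hX' := (preserves_swap (x := x) (by simp [hx, hyX] : (π ^ r) x ∈ X ↔ x ∈ X)).mul hX
      have hCX := hX'.orb_subset hyX
      have hne : (orb (Equiv.swap x ((π ^ r) x) * π) ((π ^ r) x)).Nonempty :=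
        ⟨_, self_mem_orb _ _⟩
      have hCX' : ¬ orb (Equiv.swap x ((π ^ r) x) * π) ((π ^ r) x) ⊆ Xᶜ := fun h =>
        mem_compl.1 (h (self_mem_orb _ _)) hyX
      rw [ih _ _ hX' (by rw [card_orbs_cut hr.1 hr.2]; omega)
          (insert_inter_orb_cut hS hr.1 hr.2) (insert_subset hyX hSX),
        orbs_cut_erase hr.1 hr.2, annularWeight_insert orbs_cut_notMem_right hCX hne,
        funext (pairWeight_insert orbs_cut_notMem_right hCX'), cutVar_mul, filter_insert,
        if_neg hCX', card_orb_cut_left hr.1 hr.2, card_orb_cut_right hr.1 hr.2]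
      have hD : ∀ D ∈ ((orbs π).erase (orb π x)).filter (· ⊆ Xᶜ),
          weight w ((insert (orb (Equiv.swap x ((π ^ r) x) * π) ((π ^ r) x))
            ((orbs π).erase (orb π x))).erase D) =
          w (#(orb π x) - r) * weight w (((orbs π).erase (orb π x)).erase D) := by
        intro D hD
        rw [mem_filter] at hD
        rw [erase_insert_of_ne (by rintro rfl; exact orbs_cut_notMem_right hD.1),
          weight_insert (fun h => orbs_cut_notMem_right (mem_of_mem_erase h)),
          card_orb_cut_right hr.1 hr.2]
      rw [sum_congr rfl fun D hD' => by rw [hD D hD']]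
      congr 1
      congr 1
      · ring
      · refine sum_congr rfl fun D _ => ?_
        ring
    rw [hcut, hjoin, sum_congr rfl hstep, ← mul_sum, ← mul_sum, ← mul_add, sum_add_distrib,
      sum_add_distrib, ← sum_mul, sum_comm, cutCoeff, cutVar, add_assoc, ← sum_add_distrib]
    congr 2
    refine sum_congr rfl fun D _ => ?_
    rw [joinCoeff, ← mul_sum, ← sum_mul]
    ring

end SideSums

end KCycleFactorisation

namespace KCycleFactorisation

/-! ### Cycles of length `k` as lists of distinct points -/

section Tuples

open Finset

variable {V : Type*} [Fintype V] [DecidableEq V]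

/-- The lists of `j` distinct points outside `S`. -/
def pointLists : ℕ → Finset V → Finset (List V)
  | 0, _ => {[]}
  | j + 1, S => Sᶜ.biUnion fun y => (pointLists j (insert y S)).image (List.cons y)

theorem mem_pointLists {j : ℕ} {S : Finset V} {l : List V} :
    l ∈ pointLists j S ↔ l.length = j ∧ l.Nodup ∧ ∀ y ∈ l, y ∉ S := by
  induction j generalizing S l with
  | zero =>
    rw [pointLists, mem_singleton, List.length_eq_zero_iff]
    constructor
    · rintro rfl; simp
    · exact fun h => h.1
  | succ j ih =>
    rw [pointLists, mem_biUnion]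
    constructor
    · rintro ⟨y, hy, hl⟩
      obtain ⟨l', hl', rfl⟩ := mem_image.1 hl
      rw [ih] at hl'
      rw [mem_compl] at hy
      refine ⟨by simp [hl'.1], List.nodup_cons.2 ⟨fun h => hl'.2.2 y h (mem_insert_self _ _),
        hl'.2.1⟩, ?_⟩
      intro z hz
      rcases List.mem_cons.1 hz with rfl | hz
      · exact hy
      · exact fun h => hl'.2.2 z hz (mem_insert_of_mem h)
    · rintro ⟨h1, h2, h3⟩
      match l, h1, h2, h3 with
      | y :: l', h1, h2, h3 =>
        refine ⟨y, mem_compl.2 (h3 y (by simp)), mem_image_of_mem _ (ih.2 ⟨by simpa using h1,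
          (List.nodup_cons.1 h2).2, ?_⟩)⟩
        intro z hz h
        rcases mem_insert.1 h with rfl | h
        · exact (List.nodup_cons.1 h2).1 hz
        · exact h3 z (List.mem_cons_of_mem _ hz) h

theorem sum_pointLists_succ {M : Type*} [AddCommMonoid M] (j : ℕ) (S : Finset V)
    (f : List V → M) :
    ∑ l ∈ pointLists (j + 1) S, f l = ∑ y ∈ Sᶜ, ∑ l ∈ pointLists j (insert y S), f (y :: l) := by
  rw [pointLists, sum_biUnion]
  · refine sum_congr rfl fun y _ => ?_
    rw [sum_image]
    intro l _ l' _ h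
    exact (List.cons.inj h).2
  · intro y _ y' _ hne
    simp only [Function.onFun]
    rw [disjoint_left]
    intro l hl hl'
    obtain ⟨m, -, rfl⟩ := mem_image.1 hl
    obtain ⟨m', -, h⟩ := mem_image.1 hl'
    exact hne (List.cons.inj h).1.symm

omit [Fintype V] in
-- Having the transposition on the right puts it next to `π` in `formPerm (x :: y :: l) * π`, so
-- reading the list from the front performs the cuts and joins in order.
theorem formPerm_cons_cons_eq_mul_swap {x y : V} {l : List V} (hx : x ∉ l) (hy : y ∉ l) :
    List.formPerm (x :: y :: l) = List.formPerm (x :: l) * Equiv.swap x y := by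
  match l with
  | [] => simp
  | z :: l =>
    rw [List.formPerm_cons_cons, List.formPerm_cons_cons, List.formPerm_cons_cons]
    have h1 := List.formPerm_apply_of_notMem hx
    have h2 := List.formPerm_apply_of_notMem hy
    have hcomm : List.formPerm (z :: l) * Equiv.swap x y =
        Equiv.swap x y * List.formPerm (z :: l) := by
      have := Equiv.mul_swap_eq_swap_mul (List.formPerm (z :: l)) x y
      rwa [h1, h2] at this
    have hxz : x ≠ z := fun h => hx (by simp [h])
    have hyz : y ≠ z := fun h => hy (by simp [h])
    rw [mul_assoc, hcomm, ← mul_assoc, ← mul_assoc]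
    congr 1
    rw [Equiv.mul_swap_eq_swap_mul, Equiv.swap_apply_right,
      Equiv.swap_apply_of_ne_of_ne hxz.symm hyz.symm]

theorem stepSum_eq_sum_lists (g : Equiv.Perm V → ℚ) (x : V) (j : ℕ) (S : Finset V)
    (π : Equiv.Perm V) (hx : x ∈ S) :
    stepSum g x j S π = ∑ l ∈ pointLists j S, g (List.formPerm (x :: l) * π) := by
  induction j generalizing S π with
  | zero => simp [stepSum, pointLists]
  | succ j ih =>
    rw [stepSum, sum_pointLists_succ]
    refine sum_congr rfl fun y hy => ?_
    rw [ih _ _ (mem_insert_of_mem hx)]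
    refine sum_congr rfl fun l hl => ?_
    rw [mem_pointLists] at hl
    rw [formPerm_cons_cons_eq_mul_swap (fun h => hl.2.2 x h (mem_insert_of_mem hx))
      (fun h => hl.2.2 y h (mem_insert_self _ _)), mul_assoc]

theorem sideStepSum_eq_sum_lists (X : Finset V) (g h : Equiv.Perm V → ℚ) (x : V) (j : ℕ)
    (S : Finset V) (π : Equiv.Perm V) (hx : x ∈ S) :
    sideStepSum X g h x j S π = ∑ l ∈ pointLists j S,
      if ∀ y ∈ l, (y ∈ X ↔ x ∈ X) then g (List.formPerm (x :: l) * π)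
      else h (List.formPerm (x :: l) * π) := by
  induction j generalizing S π with
  | zero => simp [sideStepSum, pointLists]
  | succ j ih =>
    rw [sideStepSum, sum_pointLists_succ]
    refine sum_congr rfl fun y hy => ?_
    have hform : ∀ l ∈ pointLists j (insert y S), List.formPerm (x :: y :: l) * π =
        List.formPerm (x :: l) * (Equiv.swap x y * π) := by
      intro l hl
      rw [mem_pointLists] at hl
      rw [formPerm_cons_cons_eq_mul_swap (fun h => hl.2.2 x h (mem_insert_of_mem hx))
        (fun h => hl.2.2 y h (mem_insert_self _ _)), mul_assoc]
    split_ifs with hyX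
    · rw [ih _ _ (mem_insert_of_mem hx)]
      refine sum_congr rfl fun l hl => ?_
      rw [hform l hl]
      simp [hyX]
    · rw [stepSum_eq_sum_lists _ _ _ _ _ (mem_insert_of_mem hx)]
      refine sum_congr rfl fun l hl => ?_
      rw [hform l hl, if_neg]
      intro h'
      exact hyX (h' y (by simp))

/-- All listed points lie on one cycle, and a preserved set contains a cycle or misses it. -/
theorem preserves_formPerm_iff (X : Finset V) {x : V} {l : List V} (hl : (x :: l).Nodup) :
    Preserves X (List.formPerm (x :: l)) ↔ ∀ y ∈ l, (y ∈ X ↔ x ∈ X) := by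
  match l with
  | [] => simp [Preserves]
  | z :: l =>
    constructor
    · intro h y hy
      apply h.mem_iff_of_mem_orb
      rw [mem_orb]
      have := List.pairwise_sameCycle_formPerm hl (by simp)
      exact List.rel_of_pairwise_cons this hy
    · intro h t
      by_cases ht : t ∈ x :: z :: l
      · have h1 : ∀ y ∈ x :: z :: l, (y ∈ X ↔ x ∈ X) := by
          intro y hy
          rcases List.mem_cons.1 hy with rfl | hy
          · rfl
          · exact h y hy
        rw [h1 t ht, h1 _ (List.formPerm_apply_mem_of_mem ht)]
      · rw [List.formPerm_apply_of_notMem ht]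

theorem sum_kCycles_through (k : ℕ) (hk : 2 ≤ k) (f : Equiv.Perm V → ℚ) (x : V) :
    ∑ σ : Equiv.Perm V with σ.cycleType = {k} ∧ x ∈ σ.support, f σ =
      ∑ l ∈ pointLists (k - 1) {x}, f (List.formPerm (x :: l)) := by
  have hnd : ∀ l ∈ pointLists (k - 1) {x}, (x :: l).Nodup ∧ (x :: l).length = k := by
    intro l hl
    rw [mem_pointLists] at hl
    refine ⟨List.nodup_cons.2 ⟨fun h => hl.2.2 x h (mem_singleton_self _), hl.2.1⟩, ?_⟩
    rw [List.length_cons, hl.1]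
    omega
  symm
  refine sum_bij (fun l _ => List.formPerm (x :: l)) ?_ ?_ ?_ (fun _ _ => rfl)
  · intro l hl
    obtain ⟨h1, h2⟩ := hnd l hl
    rw [mem_filter]
    refine ⟨mem_univ _, ?_, ?_⟩
    · have := List.isCycle_formPerm h1 (by omega)
      rw [this.cycleType, List.support_formPerm_of_nodup _ h1, List.toFinset_card_of_nodup h1, h2]
      rintro z hz
      rw [hz] at h2
      simp at h2
      omega
    · rw [List.support_formPerm_of_nodup _ h1]
      · simp
      · rintro z hz
        rw [hz] at h2
        simp at h2
        omega
  · intro l hl l' hl' h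
    obtain ⟨h1, h2⟩ := hnd l hl
    obtain ⟨h1', h2'⟩ := hnd l' hl'
    -- Reading the cycle from `x` with `toList` recovers the list from the permutation.
    have e1 := Equiv.Perm.toList_formPerm_nontrivial (x :: l) (by omega) h1
    have e2 := Equiv.Perm.toList_formPerm_nontrivial (x :: l') (by omega) h1'
    simp only [List.get_eq_getElem, List.getElem_cons_zero] at e1 e2
    rw [h, e2] at e1
    exact (List.cons.inj e1).2.symm
  · intro σ hσ
    rw [mem_filter] at hσ
    obtain ⟨-, hσ, hx⟩ := hσ
    have hcyc : σ.IsCycle := by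
      rw [← Equiv.Perm.card_cycleType_eq_one, hσ]; rfl
    have hcard : #σ.support = k := by
      have := hcyc.cycleType
      rw [hσ] at this
      exact (Multiset.singleton_inj.1 this).symm
    have hcof : σ.cycleOf x = σ := hcyc.cycleOf_eq (Equiv.Perm.mem_support.1 hx)
    have hlen : (σ.toList x).length = k := by rw [Equiv.Perm.length_toList, hcof, hcard]
    obtain ⟨z, l, hl⟩ : ∃ z l, σ.toList x = z :: l := by
      cases h : σ.toList x with
      | nil => rw [h] at hlen; simp at hlen; omega
      | cons z l => exact ⟨z, l, rfl⟩
    have hz : z = x := by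
      have := Equiv.Perm.toList_getElem_zero (p := σ) (x := x) hx
      simpa [hl] using this
    subst hz
    have hnodup := Equiv.Perm.nodup_toList σ z
    rw [hl] at hnodup hlen
    refine ⟨l, ?_, ?_⟩
    · rw [mem_pointLists]
      refine ⟨by simp at hlen; omega, (List.nodup_cons.1 hnodup).2, ?_⟩
      intro y hy h
      rw [mem_singleton] at h
      subst h
      exact (List.nodup_cons.1 hnodup).1 hy
    · rw [← hl, Equiv.Perm.formPerm_toList, hcof]

/-- Double counting of pairs of a `k`-cycle and a point moved by it: there are `k` such points, and
each starts exactly one list. -/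
theorem mul_sum_kCycles (k : ℕ) (hk : 2 ≤ k) (f : Equiv.Perm V → ℚ) :
    (k : ℚ) * ∑ σ : Equiv.Perm V with σ.cycleType = {k}, f σ =
      ∑ x, ∑ l ∈ pointLists (k - 1) {x}, f (List.formPerm (x :: l)) := by
  rw [← sum_congr rfl fun x _ => sum_kCycles_through k hk f x]
  simp_rw [sum_filter]
  rw [sum_comm, mul_sum]
  refine sum_congr rfl fun σ _ => ?_
  split_ifs with h
  · have hcard : #σ.support = k := by
      rw [← Equiv.Perm.sum_cycleType, h, Multiset.sum_singleton]
    simp only [h, true_and]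
    rw [← sum_filter, filter_mem_eq_inter, univ_inter, sum_const, hcard, nsmul_eq_mul]
  · simp [h]

end Tuples

end KCycleFactorisation

namespace KCycleFactorisation

/-! ### Counting all factorisations and those mixing the two sides of `X` -/

section Counts

open Finset

variable {V : Type*} [Fintype V] [DecidableEq V] (k : ℕ)

/-- The number of factorisations of `π` into `m` cycles of length `k`. -/
def countAll : ℕ → Equiv.Perm V → ℚ
  | 0, π => if π = 1 then 1 else 0
  | m + 1, π => ∑ σ : Equiv.Perm V with σ.cycleType = {k}, countAll m (σ * π)

/-- The number of factorisations of `π` into `m` cycles of length `k`, at least one of which does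
not preserve `X`. -/
def countMixing (X : Finset V) : ℕ → Equiv.Perm V → ℚ
  | 0, _ => 0
  | m + 1, π => ∑ σ : Equiv.Perm V with σ.cycleType = {k},
      if Preserves X σ then countMixing X m (σ * π) else countAll k m (σ * π)

variable {k}

theorem mul_countAll_succ (hk : 2 ≤ k) (m : ℕ) (π : Equiv.Perm V) :
    (k : ℚ) * countAll k (m + 1) π = ∑ x, stepSum (countAll k m) x (k - 1) {x} π := by
  rw [countAll, mul_sum_kCycles k hk (fun σ => countAll k m (σ * π))]
  refine sum_congr rfl fun x _ => ?_
  rw [stepSum_eq_sum_lists _ _ _ _ _ (mem_singleton_self x)]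

theorem mul_countMixing_succ (hk : 2 ≤ k) (X : Finset V) (m : ℕ) (π : Equiv.Perm V) :
    (k : ℚ) * countMixing k X (m + 1) π =
      ∑ x, sideStepSum X (countMixing k X m) (countAll k m) x (k - 1) {x} π := by
  rw [countMixing, mul_sum_kCycles k hk
    (fun σ => if Preserves X σ then countMixing k X m (σ * π) else countAll k m (σ * π))]
  refine sum_congr rfl fun x _ => ?_
  rw [sideStepSum_eq_sum_lists _ _ _ _ _ _ _ (mem_singleton_self x)]
  refine sum_congr rfl fun l hl => ?_
  rw [mem_pointLists] at hl
  simp only [preserves_formPerm_iff X (List.nodup_cons.2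
    ⟨fun h => hl.2.2 x h (mem_singleton_self _), hl.2.1⟩)]

theorem card_orbs_le (π : Equiv.Perm V) : #(orbs π) ≤ Fintype.card V := by
  rw [← sum_card_orbs π, card_eq_sum_ones]
  exact sum_le_sum fun C hC => card_pos.2 (nonempty_of_mem_orbs hC)

theorem eq_one_of_card_orbs {π : Equiv.Perm V} (h : #(orbs π) = Fintype.card V) : π = 1 := by
  ext x
  by_contra hne
  have : ∑ C ∈ orbs π, 1 < ∑ C ∈ orbs π, #C := by
    refine sum_lt_sum (fun C hC => card_pos.2 (nonempty_of_mem_orbs hC))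
      ⟨_, orb_mem_orbs π x, ?_⟩
    rw [one_lt_card]
    exact ⟨x, self_mem_orb _ _, π x, apply_mem_orb (self_mem_orb _ _), fun h => hne (by simp [← h])⟩
  rw [sum_card_orbs, ← card_eq_sum_ones] at this
  omega

theorem countAll_eq_zero (hk : 2 ≤ k) (m : ℕ) (π : Equiv.Perm V)
    (h : m * (k - 1) + #(orbs π) < Fintype.card V) : countAll k m π = 0 := by
  induction m generalizing π with
  | zero =>
    rw [countAll, if_neg]
    rintro rfl
    rw [card_orbs_one] at h
    omega
  | succ m ih =>
    have hk0 : (k : ℚ) ≠ 0 := by positivity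
    refine (mul_eq_zero.1 ?_).resolve_left hk0
    rw [mul_countAll_succ hk]
    refine sum_eq_zero fun x _ => ?_
    refine stepSum_eq_zero (N := Fintype.card V - m * (k - 1)) (fun π' hπ' => ih π' (by omega))
      _ _ _ _ ?_
    rw [Nat.succ_mul] at h
    omega

theorem countMixing_eq_zero (hk : 2 ≤ k) {X : Finset V} (m : ℕ) (π : Equiv.Perm V)
    (hX : Preserves X π) (h : m * (k - 1) + #(orbs π) < Fintype.card V + 2) :
    countMixing k X m π = 0 := by
  induction m generalizing π with
  | zero => rfl
  | succ m ih =>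
    have hk0 : (k : ℚ) ≠ 0 := by positivity
    refine (mul_eq_zero.1 ?_).resolve_left hk0
    rw [mul_countMixing_succ hk]
    refine sum_eq_zero fun x _ => ?_
    rw [Nat.succ_mul] at h
    -- The threshold `Fintype.card V - m * (k - 1)` must not be truncated; otherwise `h` would fail,
    -- since `π` has at least one cycle.
    rcases le_or_gt (m * (k - 1)) (Fintype.card V) with hle | hlt
    · exact sideStepSum_eq_zero (N := Fintype.card V - m * (k - 1))
        (fun π' hπ' => countAll_eq_zero hk m π' (by omega))
        (fun π' hX' hπ' => ih π' hX' (by omega)) _ _ _ _ hX (by omega) (mem_singleton_self x)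
    · exfalso
      have := card_pos.2 ⟨_, orb_mem_orbs π x⟩
      omega

theorem singleton_inter_orb (π : Equiv.Perm V) (x : V) : {x} ∩ orb π x = {x} :=
  inter_eq_left.2 (singleton_subset_iff.2 (self_mem_orb _ _))

/-- Removing the first factor, a cycle of length `n` contributes `n * cutCoeff w (k - 1) n`, which
`hw` converts into `k(n-1)/(k-1)` times `w n`. As the numbers `n - 1` add up to `(m+1)(k-1)`, the
factor `m + 1` of the next factorial appears. -/
theorem countAll_eq (hk : 2 ≤ k) {w : ℕ → ℚ} (hw1 : w 1 = 1)
    (hw : ∀ n : ℕ, (k : ℚ) * ((n : ℚ) - 1) * w n = ((k : ℚ) - 1) * n * cutCoeff w (k - 1) n) (m : ℕ)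
    (π : Equiv.Perm V) (h : m * (k - 1) + #(orbs π) = Fintype.card V) :
    countAll k m π = m.factorial * weight w (orbs π) := by
  have hk1 : ((k : ℚ) - 1) ≠ 0 := by
    have : (2 : ℚ) ≤ k := by exact_mod_cast hk
    linarith
  induction m generalizing π with
  | zero =>
    have : π = 1 := eq_one_of_card_orbs (by omega)
    subst this
    rw [countAll, if_pos rfl, Nat.factorial_zero, Nat.cast_one, one_mul, weight, prod_eq_one]
    intro C hC
    obtain ⟨x, rfl⟩ := mem_orbs.1 hC
    rw [orb_one, card_singleton, hw1]
  | succ m ih =>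
    have hk0 : (k : ℚ) ≠ 0 := by positivity
    refine mul_left_cancel₀ (mul_ne_zero hk0 hk1) ?_
    rw [mul_comm (k : ℚ), mul_assoc, mul_countAll_succ hk]
    rw [Nat.succ_mul] at h
    have hstep : ∀ x : V, stepSum (countAll k m) x (k - 1) {x} π = m.factorial *
        (cutCoeff w (k - 1) #(orb π x) * weight w ((orbs π).erase (orb π x))) := fun x =>
      stepSum_cut (N := Fintype.card V - m * (k - 1))
        (fun π' hπ' => countAll_eq_zero hk m π' (by omega))
        (fun π' hπ' => ih π' (by omega)) _ _ _ _ (by omega) (singleton_inter_orb π x)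
    rw [sum_congr rfl fun x _ => hstep x, ← mul_sum, sum_univ_eq_sum_orbs π]
    have hC : ∀ C ∈ orbs π, ((k : ℚ) - 1) * ∑ x ∈ C, cutCoeff w (k - 1) #(orb π x) *
        weight w ((orbs π).erase (orb π x)) = k * ((#C : ℚ) - 1) * weight w (orbs π) := by
      intro C hC
      obtain ⟨z, rfl⟩ := mem_orbs.1 hC
      rw [sum_congr rfl fun x hx => by rw [orb_eq_of_mem hx], sum_const, nsmul_eq_mul,
        weight_orbs π z]
      linear_combination -weight w ((orbs π).erase (orb π z)) * hw (#(orb π z))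
    rw [mul_left_comm, mul_sum, sum_congr rfl hC, ← sum_mul, ← mul_sum, sum_sub_distrib,
      ← Nat.cast_sum, sum_card_orbs, sum_const, nsmul_eq_mul, ← h, Nat.factorial_succ]
    push_cast [Nat.cast_sub (by omega : 1 ≤ k)]
    ring

/-- The argument of `countAll_eq`, with starting points on both sides of `X`. By `hw` the cuts yield
`k ∑ (#C - 1)` times the annular weight, that is `k((m+1)(k-1) - 2)` times it; the terms involving
the distinguished pair have to supply the missing `2k`, and `hAw` is exactly the condition that they
do. -/
theorem countMixing_eq (hk : 2 ≤ k) {w : ℕ → ℚ} {A : ℕ → ℕ → ℚ} (hw1 : w 1 = 1)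
    (hw : ∀ n : ℕ, (k : ℚ) * ((n : ℚ) - 1) * w n = ((k : ℚ) - 1) * n * cutCoeff w (k - 1) n)
    (hA : ∀ a b, A a b = A b a)
    (hAw : ∀ a b, 0 < a → 0 < b → (k : ℚ) * (a + b) * A a b = ((k : ℚ) - 1) *
      (a * cutVar w (fun i => A i b) (k - 1) a + b * cutVar w (fun i => A i a) (k - 1) b +
        a * b * (joinCoeff w (k - 1) a b + joinCoeff w (k - 1) b a)))
    {X : Finset V} (m : ℕ) (π : Equiv.Perm V) (hX : Preserves X π)
    (h : m * (k - 1) + #(orbs π) = Fintype.card V + 2) :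
    countMixing k X m π = m.factorial * annularWeight w A (orbs π) X := by
  have hk1 : ((k : ℚ) - 1) ≠ 0 := by
    have : (2 : ℚ) ≤ k := by exact_mod_cast hk
    linarith
  induction m generalizing π with
  | zero =>
    have := card_orbs_le π
    omega
  | succ m ih =>
    -- For nonempty `V` there is at least one cycle, and `h` then gives `m * (k - 1) ≤ Fintype.card
    -- V`, so the subtraction in the threshold is exact.
    rcases isEmpty_or_nonempty V with hV | ⟨⟨x0⟩⟩
    · have h0 : orbs π = ∅ := by simp [orbs]
      have hk0 : (k : ℚ) ≠ 0 := by positivity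
      rw [h0]
      refine mul_left_cancel₀ hk0 ?_
      rw [mul_countMixing_succ hk]
      simp [annularWeight]
    have hpos : 0 < #(orbs π) := card_pos.2 ⟨_, orb_mem_orbs π x0⟩
    have hk0 : (k : ℚ) ≠ 0 := by positivity
    refine mul_left_cancel₀ (mul_ne_zero hk0 hk1) ?_
    rw [mul_comm (k : ℚ), mul_assoc, mul_countMixing_succ hk]
    rw [Nat.succ_mul] at h
    have hmle : m * (k - 1) ≤ Fintype.card V := by
      omega
    have hne : ∀ C ∈ orbs π, C.Nonempty := fun C hC => nonempty_of_mem_orbs hC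
    have hstep : ∀ Y : Finset V, (Y = X ∨ Y = Xᶜ) → ∀ x ∈ Y,
        sideStepSum X (countMixing k X m) (countAll k m) x (k - 1) {x} π = m.factorial *
          (cutCoeff w (k - 1) #(orb π x) * annularWeight w A ((orbs π).erase (orb π x)) Y +
            cutVar w (pairWeight w A ((orbs π).erase (orb π x)) Yᶜ) (k - 1) #(orb π x) +
            ∑ D ∈ ((orbs π).erase (orb π x)) with D ⊆ Yᶜ, #D * (joinCoeff w (k - 1) #(orb π x) #D *
              weight w (((orbs π).erase (orb π x)).erase D))) := by
      intro Y hY x hx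
      have hs : sideStepSum X (countMixing k X m) (countAll k m) x (k - 1) {x} π =
          sideStepSum Y (countMixing k X m) (countAll k m) x (k - 1) {x} π := by
        rcases hY with rfl | rfl
        · rfl
        · rw [sideStepSum_compl]
      have hYX : ∀ {π' : Equiv.Perm V}, Preserves Y π' → Preserves X π' := by
        intro π' hπ'
        rcases hY with rfl | rfl
        · exact hπ'
        · simpa using hπ'.compl
      have hY' : Preserves Y π := by
        rcases hY with rfl | rfl
        · exact hX
        · exact hX.compl
      rw [hs]
      refine sideStepSum_cut (N := Fintype.card V - m * (k - 1))
        (fun π' hπ' => countAll_eq_zero hk m π' (by omega))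
        (fun π' hπ' => countAll_eq hk hw1 hw m π' (by omega))
        (fun π' hY' hπ' => countMixing_eq_zero hk m π' (hYX hY') (by omega))
        (fun π' hY' hπ' => ?_) x hx _ _ _ hY' (by omega) (singleton_inter_orb π x)
        (singleton_subset_iff.2 hx)
      rw [ih π' (hYX hY') (by omega)]
      rcases hY with rfl | rfl
      · rfl
      · rw [annularWeight_compl hA _ fun C hC => nonempty_of_mem_orbs hC]
    have hsum : ∀ Y : Finset V, (Y = X ∨ Y = Xᶜ) →
        ((k : ℚ) - 1) * ∑ x ∈ Y,
          sideStepSum X (countMixing k X m) (countAll k m) x (k - 1) {x} π = m.factorial *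
        (k * ((∑ C ∈ orbs π with C ⊆ Y, ((#C : ℚ) - 1)) * annularWeight w A (orbs π) X) +
        ∑ C ∈ orbs π with C ⊆ Y, ∑ D ∈ orbs π with D ⊆ Yᶜ,
          (((k : ℚ) - 1) * (#C * cutVar w (fun i => A i #D) (k - 1) #C +
            #C * #D * joinCoeff w (k - 1) #C #D) - k * ((#C : ℚ) - 1) * A #C #D) *
            weight w (((orbs π).erase C).erase D)) := by
      intro Y hY
      have hY' : Preserves Y π := by
        rcases hY with rfl | rfl
        · exact hX
        · exact hX.compl
      have hYX : annularWeight w A (orbs π) X = annularWeight w A (orbs π) Y := by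
        rcases hY with rfl | rfl
        · rfl
        · rw [annularWeight_compl hA _ hne]
      rw [sum_congr rfl (hstep Y hY), sum_eq_sum_orbs_filter hY', mul_sum, sum_mul, mul_sum,
        ← sum_add_distrib, mul_sum]
      refine sum_congr rfl fun C hC => ?_
      rw [mem_filter] at hC
      obtain ⟨hCO, hCY⟩ := hC
      have hfil : ((orbs π).erase C).filter (· ⊆ Yᶜ) = (orbs π).filter (· ⊆ Yᶜ) := by
        ext D
        simp only [mem_filter, mem_erase]
        refine ⟨fun h => ⟨h.1.2, h.2⟩, fun h => ⟨⟨?_, h.1⟩, h.2⟩⟩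
        rintro rfl
        obtain ⟨x, hx⟩ := hne _ hCO
        exact (mem_compl.1 (h.2 hx)) (hCY hx)
      have hins : annularWeight w A (orbs π) X = w #C * annularWeight w A ((orbs π).erase C) Y +
          pairWeight w A ((orbs π).erase C) Yᶜ #C := by
        rw [hYX, ← annularWeight_insert (notMem_erase _ _) hCY (hne C hCO), insert_erase hCO]
      have hvar : cutVar w (pairWeight w A ((orbs π).erase C) Yᶜ) (k - 1) #C =
          ∑ D ∈ orbs π with D ⊆ Yᶜ, cutVar w (fun i => A i #D) (k - 1) #C *
            weight w (((orbs π).erase C).erase D) := by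
        rw [← cutVar_sum, ← hfil]
        rfl
      have hpair : pairWeight w A ((orbs π).erase C) Yᶜ #C = ∑ D ∈ orbs π with D ⊆ Yᶜ,
          A #C #D * weight w (((orbs π).erase C).erase D) := by
        rw [← hfil]
        rfl
      rw [sum_congr rfl fun x hx => by rw [orb_eq_of_mem_orbs hCO hx], sum_const, nsmul_eq_mul,
        hfil, hvar]
      have hexp : ∑ D ∈ orbs π with D ⊆ Yᶜ,
          (((k : ℚ) - 1) * (#C * cutVar w (fun i => A i #D) (k - 1) #C +
            #C * #D * joinCoeff w (k - 1) #C #D) - k * ((#C : ℚ) - 1) * A #C #D) *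
            weight w (((orbs π).erase C).erase D) =
          ((k : ℚ) - 1) * #C * (∑ D ∈ orbs π with D ⊆ Yᶜ,
            cutVar w (fun i => A i #D) (k - 1) #C * weight w (((orbs π).erase C).erase D)) +
          ((k : ℚ) - 1) * #C * (∑ D ∈ orbs π with D ⊆ Yᶜ, #D * (joinCoeff w (k - 1) #C #D *
              weight w (((orbs π).erase C).erase D))) -
          k * ((#C : ℚ) - 1) * pairWeight w A ((orbs π).erase C) Yᶜ #C := by
        rw [hpair, mul_sum, mul_sum, mul_sum, ← sum_add_distrib, ← sum_sub_distrib]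
        refine sum_congr rfl fun D _ => ?_
        ring
      rw [hexp, hins]
      linear_combination
        -(m.factorial : ℚ) * annularWeight w A ((orbs π).erase C) Y * hw (#C)
    have hfilter : ∀ f : Finset V → ℚ, ∑ C ∈ orbs π, f C =
        ∑ C ∈ orbs π with C ⊆ X, f C + ∑ C ∈ orbs π with C ⊆ Xᶜ, f C := by
      intro f
      rw [← sum_filter_add_sum_filter_not (orbs π) (· ⊆ X)]
      congr 1
      refine sum_congr ?_ fun _ _ => rfl
      ext C
      simp only [mem_filter, and_congr_right_iff]
      intro hC
      obtain ⟨x, rfl⟩ := mem_orbs.1 hC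
      constructor
      · intro h'
        refine hX.compl.orb_subset (mem_compl.2 fun hx => h' (hX.orb_subset hx))
      · intro h' h''
        exact mem_compl.1 (h' (self_mem_orb _ _)) (h'' (self_mem_orb _ _))
    have htot : ∑ C ∈ orbs π with C ⊆ X, ((#C : ℚ) - 1) +
        ∑ C ∈ orbs π with C ⊆ Xᶜ, ((#C : ℚ) - 1) = (m + 1) * ((k : ℚ) - 1) - 2 := by
      rw [← hfilter, sum_sub_distrib, ← Nat.cast_sum, sum_card_orbs, sum_const, nsmul_eq_mul]
      have : ((m * (k - 1) + (k - 1) + #(orbs π) : ℕ) : ℚ) = ((Fintype.card V + 2 : ℕ) : ℚ) := by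
        exact_mod_cast h
      push_cast [Nat.cast_sub (by omega : 1 ≤ k)] at this
      linear_combination -this
    rw [← sum_add_sum_compl X, mul_add, hsum X (Or.inl rfl), hsum Xᶜ (Or.inr rfl), compl_compl,
      sum_comm (s := (orbs π).filter (· ⊆ Xᶜ)), ← mul_add, add_add_add_comm, ← sum_add_distrib,
      ← mul_add, ← add_mul, htot, Nat.factorial_succ]
    -- Termwise, `hAw` leaves `k(a+b) - k(a-1) - k(b-1) = 2k` times `A a b`.
    have hlast : ∑ C ∈ orbs π with C ⊆ X, (∑ D ∈ orbs π with D ⊆ Xᶜ,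
          (((k : ℚ) - 1) * (#C * cutVar w (fun i => A i #D) (k - 1) #C +
            #C * #D * joinCoeff w (k - 1) #C #D) - k * ((#C : ℚ) - 1) * A #C #D) *
            weight w (((orbs π).erase C).erase D) +
        ∑ D ∈ orbs π with D ⊆ Xᶜ,
          (((k : ℚ) - 1) * (#D * cutVar w (fun i => A i #C) (k - 1) #D +
            #D * #C * joinCoeff w (k - 1) #D #C) - k * ((#D : ℚ) - 1) * A #D #C) *
            weight w (((orbs π).erase D).erase C)) =
        2 * k * annularWeight w A (orbs π) X := by
      rw [annularWeight_eq_sum_pairs X hne, mul_sum]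
      refine sum_congr rfl fun C hC => ?_
      rw [← sum_add_distrib, mul_sum]
      refine sum_congr rfl fun D hD => ?_
      rw [mem_filter] at hC hD
      rw [erase_right_comm (a := D), hA (#D) (#C)]
      linear_combination -weight w (((orbs π).erase C).erase D) *
        hAw (#C) (#D) (card_pos.2 (hne C hC.1)) (card_pos.2 (hne D hD.1))
    rw [hlast]
    push_cast
    ring

end Counts

end KCycleFactorisation

namespace KCycleFactorisation

/-! ### From the recursive counts to lists of factors -/

section Lists

open Finset

variable {V : Type*} [Fintype V] [DecidableEq V] {k : ℕ}

/-- The factorisations of `π` into `m` cycles of length `k`. -/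
def factorisations (k : ℕ) : ℕ → Equiv.Perm V → Finset (List (Equiv.Perm V))
  | 0, π => if π = 1 then {[]} else ∅
  | m + 1, π => ({σ : Equiv.Perm V | σ.cycleType = {k}} : Finset (Equiv.Perm V)).biUnion fun σ =>
      (factorisations k m (σ * π)).image (List.cons σ⁻¹)

theorem mem_factorisations {m : ℕ} {π : Equiv.Perm V} {L : List (Equiv.Perm V)} :
    L ∈ factorisations k m π ↔ L.length = m ∧ (∀ σ ∈ L, σ.cycleType = {k}) ∧ L.prod = π := by
  induction m generalizing L π with
  | zero =>
    rw [factorisations, List.length_eq_zero_iff]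
    split_ifs with h
    · rw [mem_singleton]
      constructor
      · rintro rfl; simp [h]
      · exact fun h' => h'.1
    · simp only [notMem_empty, false_iff]
      rintro ⟨rfl, -, h'⟩
      exact h (by simpa using h'.symm)
  | succ m ih =>
    rw [factorisations, mem_biUnion]
    constructor
    · rintro ⟨σ, hσ, hL⟩
      obtain ⟨L', hL', rfl⟩ := mem_image.1 hL
      obtain ⟨h1, h2, h3⟩ := ih.1 hL'
      rw [mem_filter] at hσ
      refine ⟨by simp [h1], ?_, ?_⟩
      · intro τ hτ
        rcases List.mem_cons.1 hτ with rfl | hτ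
        · rw [Equiv.Perm.cycleType_inv, hσ.2]
        · exact h2 τ hτ
      · rw [List.prod_cons, h3, inv_mul_cancel_left]
    · rintro ⟨h1, h2, h3⟩
      match L, h1, h2, h3 with
      | σ :: L', h1, h2, h3 =>
        -- The summation variable multiplies `π`, so it is the inverse of the first factor, again a
        -- `k`-cycle.
        refine ⟨σ⁻¹, by simp [h2 σ (by simp)], ?_⟩
        rw [inv_inv]
        refine mem_image_of_mem _ (ih.2 ⟨by simpa using h1,
          fun τ hτ => h2 τ (List.mem_cons_of_mem _ hτ), ?_⟩)
        rw [← h3, List.prod_cons, inv_mul_cancel_left]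

theorem card_biUnion_cons (T : Finset (Equiv.Perm V))
    (f : Equiv.Perm V → Finset (List (Equiv.Perm V))) :
    #(T.biUnion fun σ => (f σ).image (List.cons σ⁻¹)) = ∑ σ ∈ T, #(f σ) := by
  rw [card_biUnion]
  · refine sum_congr rfl fun σ _ => card_image_of_injective _ ?_
    intro l l' h
    exact (List.cons.inj h).2
  · intro σ _ τ _ hne
    simp only [Function.onFun]
    rw [disjoint_left]
    intro l hl hl'
    obtain ⟨m, -, rfl⟩ := mem_image.1 hl
    obtain ⟨m', -, h⟩ := mem_image.1 hl'
    exact hne (inv_injective (List.cons.inj h).1.symm)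

theorem card_factorisations (m : ℕ) (π : Equiv.Perm V) :
    (#(factorisations k m π) : ℚ) = countAll k m π := by
  induction m generalizing π with
  | zero =>
    rw [factorisations, countAll]
    split_ifs <;> simp
  | succ m ih =>
    rw [factorisations, countAll, card_biUnion_cons, Nat.cast_sum]
    exact sum_congr rfl fun σ _ => ih _

omit [Fintype V] [DecidableEq V] in
theorem preserves_inv_iff {X : Finset V} {σ : Equiv.Perm V} :
    Preserves X σ⁻¹ ↔ Preserves X σ :=
  ⟨fun h => by simpa using h.inv, fun h => h.inv⟩

theorem card_mixing_factorisations (X : Finset V) (m : ℕ) (π : Equiv.Perm V) :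
    (#{L ∈ factorisations k m π | ¬ ∀ σ ∈ L, Preserves X σ} : ℚ) = countMixing k X m π := by
  induction m generalizing π with
  | zero =>
    rw [factorisations, countMixing, Nat.cast_eq_zero, card_eq_zero, filter_eq_empty_iff]
    intro L hL
    split_ifs at hL with h
    · rw [mem_singleton] at hL
      simp [hL]
    · simp at hL
  | succ m ih =>
    have hset : ({L ∈ factorisations k (m + 1) π | ¬ ∀ σ ∈ L, Preserves X σ} : Finset _) =
        ({σ : Equiv.Perm V | σ.cycleType = {k}} : Finset (Equiv.Perm V)).biUnion fun σ =>
          (if Preserves X σ then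
            ({L ∈ factorisations k m (σ * π) | ¬ ∀ σ ∈ L, Preserves X σ} : Finset _)
            else factorisations k m (σ * π)).image (List.cons σ⁻¹) := by
      rw [factorisations, filter_biUnion]
      refine biUnion_congr rfl fun σ _ => ?_
      rw [filter_image]
      congr 1
      split_ifs with h
      · refine filter_congr fun L _ => ?_
        simp [preserves_inv_iff, h]
      · refine filter_true_of_mem fun L _ hL => h ?_
        exact preserves_inv_iff.1 (hL _ (by simp))
    rw [hset, card_biUnion_cons, countMixing, Nat.cast_sum]
    refine sum_congr rfl fun σ _ => ?_
    split_ifs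
    · exact ih _
    · exact card_factorisations _ _

end Lists

/-! ### Transitivity when the product has two cycles -/

section Transitive

open Finset

/-- The group contains the product, hence is transitive on `X` and on `Xᶜ`; a single factor carrying
a point across links the two. -/
theorem isPretransitive_closure_iff {V : Type*} [Fintype V] [DecidableEq V] {X : Finset V}
    {L : List (Equiv.Perm V)} (hX : X ∈ orbs L.prod) (hXc : Xᶜ ∈ orbs L.prod) :
    MulAction.IsPretransitive (Subgroup.closure {σ | σ ∈ L}) V ↔
      ¬ ∀ σ ∈ L, Preserves X σ := by
  constructor
  · intro ht hall
    have hpres : ∀ g ∈ Subgroup.closure {σ | σ ∈ L}, Preserves X g := by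
      intro g hg
      induction hg using Subgroup.closure_induction with
      | mem σ hσ => exact hall σ hσ
      | one => intro z; rfl
      | mul σ τ _ _ h1 h2 => exact h1.mul h2
      | inv σ _ h => exact h.inv
    obtain ⟨x, hx⟩ := nonempty_of_mem_orbs hX
    obtain ⟨y, hy⟩ := nonempty_of_mem_orbs hXc
    obtain ⟨g, hg⟩ := ht.exists_smul_eq x y
    have h := hpres g g.2 x
    have hg' : (g : Equiv.Perm V) x = y := hg
    rw [hg'] at h
    exact (mem_compl.1 hy) (h.2 hx)
  · intro hall
    push Not at hall
    obtain ⟨σ, hσL, hσ⟩ := hall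
    set G := Subgroup.closure {σ | σ ∈ L} with hG
    have hσG : σ ∈ G := Subgroup.subset_closure hσL
    have hπG : L.prod ∈ G := Subgroup.list_prod_mem _ fun τ hτ => Subgroup.subset_closure hτ
    have hrel : ∀ C ∈ orbs L.prod, ∀ x ∈ C, ∀ y ∈ C, ∃ g ∈ G, g x = y := by
      intro C hC x hx y hy
      rw [← orb_eq_of_mem_orbs hC hx, mem_orb] at hy
      obtain ⟨i, hi⟩ := hy
      exact ⟨_, G.zpow_mem hπG i, hi⟩
    obtain ⟨p, hp, q, hq, g, hg, hgpq⟩ : ∃ p ∈ X, ∃ q ∈ Xᶜ, ∃ g ∈ G, g p = q := by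
      simp only [Preserves, not_forall] at hσ
      obtain ⟨z, hz⟩ := hσ
      by_cases hzX : z ∈ X
      · refine ⟨z, hzX, σ z, mem_compl.2 fun h => hz (by simp [h, hzX]), σ, hσG, rfl⟩
      · refine ⟨σ z, ?_, z, mem_compl.2 hzX, σ⁻¹, G.inv_mem hσG, by simp⟩
        by_contra h
        exact hz (by simp [h, hzX])
    have hto : ∀ t, ∃ g ∈ G, g p = t := by
      intro t
      by_cases ht : t ∈ X
      · exact hrel X hX p hp t ht
      · obtain ⟨h, hh, rfl⟩ := hrel Xᶜ hXc q hq t (mem_compl.2 ht)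
        exact ⟨h * g, G.mul_mem hh hg, by simp [hgpq]⟩
    refine ⟨fun s t => ?_⟩
    obtain ⟨g1, h1, rfl⟩ := hto s
    obtain ⟨g2, h2, rfl⟩ := hto t
    refine ⟨⟨g2 * g1⁻¹, G.mul_mem h2 (G.inv_mem h1)⟩, ?_⟩
    change (g2 * g1⁻¹) (g1 p) = g2 p
    simp

end Transitive

/-! ### Cycle sizes and the partition of a permutation -/

section Partition

open Finset

variable {V : Type*} [Fintype V] [DecidableEq V]

theorem support_cycleOf_eq_orb {π : Equiv.Perm V} {x : V} (hx : x ∈ π.support) :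
    (π.cycleOf x).support = orb π x := by
  ext z
  rw [mem_orb, Equiv.Perm.mem_support_cycleOf_iff]
  simp [hx]

theorem one_lt_card_orb_iff {π : Equiv.Perm V} {x : V} : 1 < #(orb π x) ↔ x ∈ π.support := by
  constructor
  · intro h
    by_contra hx
    rw [Equiv.Perm.notMem_support] at hx
    have : orb π x ⊆ {x} := orb_subset (mem_singleton_self x) (by simp [hx])
    have := card_le_card this
    rw [card_singleton] at this
    omega
  · intro hx
    rw [one_lt_card]
    exact ⟨π x, apply_mem_orb (self_mem_orb _ _), x, self_mem_orb _ _,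
      Equiv.Perm.mem_support.1 hx⟩

theorem filter_orbs_eq_image (π : Equiv.Perm V) :
    ({C ∈ orbs π | 1 < #C} : Finset _) = π.cycleFactorsFinset.image Equiv.Perm.support := by
  ext C
  rw [mem_filter, mem_image]
  constructor
  · rintro ⟨hC, hcard⟩
    obtain ⟨x, rfl⟩ := mem_orbs.1 hC
    rw [one_lt_card_orb_iff] at hcard
    exact ⟨_, Equiv.Perm.cycleOf_mem_cycleFactorsFinset_iff.2 hcard,
      support_cycleOf_eq_orb hcard⟩
  · rintro ⟨τ, hτ, rfl⟩
    have hcyc := (Equiv.Perm.mem_cycleFactorsFinset_iff.1 hτ).1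
    obtain ⟨x, hx⟩ := hcyc.nonempty_support
    have hxπ : x ∈ π.support := Equiv.Perm.mem_cycleFactorsFinset_support_le hτ hx
    rw [Equiv.Perm.cycle_is_cycleOf hx hτ, support_cycleOf_eq_orb hxπ]
    exact ⟨orb_mem_orbs _ _, one_lt_card_orb_iff.2 hxπ⟩

/-- The cycles of length at least two correspond to the cycle factors, and the remaining orbits are
singletons, which supply the parts equal to `1`. -/
theorem map_card_orbs (π : Equiv.Perm V) :
    (orbs π).val.map card = π.partition.parts := by
  have hinj : Set.InjOn Equiv.Perm.support (π.cycleFactorsFinset : Set (Equiv.Perm V)) := by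
    intro σ hσ τ hτ h
    have hcyc := (Equiv.Perm.mem_cycleFactorsFinset_iff.1 hσ).1
    obtain ⟨x, hx⟩ := hcyc.nonempty_support
    rw [Equiv.Perm.cycle_is_cycleOf hx hσ,
      Equiv.Perm.cycle_is_cycleOf (show x ∈ τ.support from h ▸ hx) hτ]
  have h1 : ((orbs π).filter (1 < #·)).val.map card = π.cycleType := by
    rw [filter_orbs_eq_image, image_val_of_injOn hinj, Multiset.map_map, Equiv.Perm.cycleType_def]
  have h2 : ((orbs π).filter (¬ 1 < #·)).val.map card =
      Multiset.replicate #((orbs π).filter (¬ 1 < #·)) 1 := by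
    rw [Multiset.eq_replicate]
    refine ⟨by rw [Multiset.card_map, card_val], ?_⟩
    intro n hn
    obtain ⟨C, hC, rfl⟩ := Multiset.mem_map.1 hn
    rw [mem_val, mem_filter] at hC
    have := card_pos.2 (nonempty_of_mem_orbs hC.1)
    omega
  have h3 : (orbs π).val.map card = ((orbs π).filter (1 < #·)).val.map card +
      ((orbs π).filter (¬ 1 < #·)).val.map card := by
    rw [← Multiset.map_add, filter_val, filter_val, Multiset.filter_add_not]
  have hsum : ((orbs π).val.map card).sum = Fintype.card V := sum_card_orbs π
  rw [h3, h1, h2, Multiset.sum_add, Multiset.sum_replicate, Equiv.Perm.sum_cycleType] at hsum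
  rw [h3, h1, h2, Equiv.Perm.parts_partition, ← hsum]
  simp

end Partition

/-! ### Size of a conjugacy class with two cycles -/

section ConjClass

open Finset

theorem mem_conjClass_iff {n : ℕ} {α : n.Partition} {π : Equiv.Perm (Fin n)} :
    π ∈ conjClass α ↔ π.cycleType = α.parts.filter (2 ≤ ·) := by
  have hα : α.parts = α.parts.filter (2 ≤ ·) +
      Multiset.replicate (n - (α.parts.filter (2 ≤ ·)).sum) 1 := by
    obtain ⟨π, hπ⟩ := conjClass_nonempty α
    simp only [conjClass, mem_filter, mem_univ, true_and] at hπ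
    rw [← hπ, Equiv.Perm.parts_partition, Multiset.filter_add]
    have h1 : π.cycleType.filter (2 ≤ ·) = π.cycleType :=
      Multiset.filter_eq_self.2 fun i hi => Equiv.Perm.two_le_of_mem_cycleType hi
    have h2 : ∀ m, (Multiset.replicate m 1).filter (2 ≤ ·) = 0 := by
      intro m
      rw [Multiset.filter_eq_nil]
      intro a ha
      rw [Multiset.eq_of_mem_replicate ha]
      omega
    rw [h1, h2, add_zero, Equiv.Perm.sum_cycleType, Fintype.card_fin]
  simp only [conjClass, mem_filter, mem_univ, true_and]
  constructor
  · intro h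
    rw [← h, Equiv.Perm.filter_parts_partition_eq_cycleType]
  · intro h
    rw [Equiv.Perm.parts_partition, ← Equiv.Perm.sum_cycleType, h, Fintype.card_fin]
    exact hα.symm

/-- The centraliser rotates each cycle and, if `a = b`, may also exchange the two. -/
theorem card_conjClass_pair {n a b : ℕ} (α : n.Partition) (hα : α.parts = {a, b}) :
    #(conjClass α) * (a * b * if a = b then 2 else 1) = n.factorial := by
  have hset : conjClass α =
      ({π | π.cycleType = α.parts.filter (2 ≤ ·)} : Finset (Equiv.Perm (Fin n))) := by
    ext π
    rw [mem_conjClass_iff]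
    simp
  have hsum : a + b = n := by
    have := α.parts_sum
    rw [hα] at this
    simpa using this
  have ha : 0 < a := α.parts_pos (by simp [hα])
  have hb : 0 < b := α.parts_pos (by simp [hα])
  have key := Equiv.Perm.card_of_cycleType_mul_eq (Fin n) (α.parts.filter (2 ≤ ·))
  have hle : (α.parts.filter (2 ≤ ·)).sum ≤ Fintype.card (Fin n) := by
    have h := congrArg Multiset.sum (Multiset.filter_add_not (2 ≤ ·) α.parts)
    rw [Multiset.sum_add, α.parts_sum] at h
    rw [Fintype.card_fin]
    omega
  rw [if_pos ⟨hle, fun i hi => (Multiset.mem_filter.1 hi).2⟩, Fintype.card_fin] at key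
  rw [hset, ← key, hα]
  congr 1
  rw [Multiset.insert_eq_cons, Multiset.filter_cons, Multiset.filter_singleton]
  -- The cycle type forgets parts equal to `1`, so these need separate treatment.
  rcases eq_or_ne a b with rfl | hab
  · by_cases h2 : 2 ≤ a
    · simp [h2, ← hsum]
    · obtain rfl : a = 1 := by omega
      simp [← hsum]
  · by_cases h2 : 2 ≤ a
    · by_cases h3 : 2 ≤ b
      · simp [h2, h3, ← hsum, hab]
      · obtain rfl : b = 1 := by omega
        simp [h2, ← hsum, hab]
    · obtain rfl : a = 1 := by omega
      have h3 : 2 ≤ b := by omega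
      simp [h3, ← hsum, hab]

end ConjClass
end KCycleFactorisation

namespace KCycleFactorisation

/-! ### Minimal transitive factorisations of a permutation with two cycles -/

section TwoCycles

open Finset

theorem exists_orbs_eq_pair {V : Type*} [Fintype V] [DecidableEq V] {π : Equiv.Perm V} {a b : ℕ}
    (h : π.partition.parts = {a, b}) :
    ∃ X : Finset V, #X = a ∧ #Xᶜ = b ∧ X ≠ Xᶜ ∧ orbs π = {X, Xᶜ} := by
  rw [← map_card_orbs] at h
  have hcard : #(orbs π) = 2 := by
    have := congrArg Multiset.card h
    simpa using this
  obtain ⟨C, D, hCD, hO⟩ := card_eq_two.1 hcard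
  have hmap : (orbs π).val.map card = {#C, #D} := by
    rw [hO, insert_val_of_notMem (by simpa using hCD)]
    simp
  rw [hmap] at h
  have hD : D = Cᶜ := by
    ext x
    have hx := orb_mem_orbs π x
    rw [hO, mem_insert, mem_singleton] at hx
    have hxx := self_mem_orb π x
    rw [mem_compl]
    constructor
    · intro hxD hxC
      apply hCD
      rw [← orb_eq_of_mem_orbs (π := π) (by simp [hO]) hxC,
        ← orb_eq_of_mem_orbs (π := π) (C := D) (by simp [hO]) hxD]
    · intro hxC
      rcases hx with hx | hx
      · exact absurd (hx ▸ hxx) hxC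
      · exact hx ▸ hxx
  subst hD
  rw [Multiset.insert_eq_cons, Multiset.insert_eq_cons, Multiset.cons_eq_cons] at h
  rcases h with ⟨h1, h2⟩ | ⟨-, cs, h1, h2⟩
  · exact ⟨C, h1, Multiset.singleton_inj.1 h2, hCD, hO⟩
  · have hcs : cs = 0 := by
      have := congrArg Multiset.card h1
      simpa using this
    subst hcs
    refine ⟨Cᶜ, ?_, ?_, ?_, ?_⟩
    · simpa using h1
    · rw [compl_compl]
      simpa using h2.symm
    · rw [compl_compl]; exact hCD.symm
    · rw [compl_compl, hO, pair_comm]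

theorem annularWeight_pair {V : Type*} [Fintype V] [DecidableEq V] (w : ℕ → ℚ)
    (A : ℕ → ℕ → ℚ) {X : Finset V} (h1 : X.Nonempty) (h2 : Xᶜ.Nonempty) (hne : X ≠ Xᶜ) :
    annularWeight w A {X, Xᶜ} X = A #X #Xᶜ := by
  rw [annularWeight_eq_sum_pairs]
  · have hs : ¬ Xᶜ ⊆ X := by
      intro h
      obtain ⟨x, hx⟩ := h2
      exact mem_compl.1 hx (h hx)
    have hs' : ¬ X ⊆ Xᶜ := by
      intro h
      obtain ⟨x, hx⟩ := h1
      exact mem_compl.1 (h hx) hx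
    rw [filter_insert, filter_singleton, if_pos (Subset.refl _), if_neg hs, filter_insert,
      filter_singleton, if_neg hs', if_pos (Subset.refl _), insert_empty_eq, sum_singleton,
      sum_singleton, erase_insert (by simpa using hne)]
    simp [weight]
  · intro C hC
    rw [mem_insert, mem_singleton] at hC
    rcases hC with rfl | rfl
    · exact h1
    · exact h2

/-- Transitive factorisations are the mixing ones; none has fewer than `m = n/(k-1)` factors, and
those with `m` factors are counted by `countMixing`. The hypothesis `hApos` serves only to exclude
that the minimum exceeds `m`. -/
theorem c_eq {k : ℕ} (hk : 2 ≤ k) {w : ℕ → ℚ} {A : ℕ → ℕ → ℚ} (hw1 : w 1 = 1)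
    (hw : ∀ n : ℕ, (k : ℚ) * ((n : ℚ) - 1) * w n = ((k : ℚ) - 1) * n * cutCoeff w (k - 1) n)
    (hA : ∀ a b, A a b = A b a)
    (hAw : ∀ a b, 0 < a → 0 < b → (k : ℚ) * (a + b) * A a b = ((k : ℚ) - 1) *
      (a * cutVar w (fun i => A i b) (k - 1) a + b * cutVar w (fun i => A i a) (k - 1) b +
        a * b * (joinCoeff w (k - 1) a b + joinCoeff w (k - 1) b a)))
    (hApos : ∀ a b, 0 < a → 0 < b → (k - 1) ∣ a + b → 2 * (k - 1) ≤ a + b → A a b ≠ 0)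
    {n a b : ℕ} (α : n.Partition) (hα : α.parts = {a, b}) (hn : (k - 1) ∣ n) :
    (c k α : ℚ) = (mu k 2 n).factorial * A a b := by
  obtain ⟨π, hπ⟩ : ∃ π, π = (conjClass_nonempty α).choose := ⟨_, rfl⟩
  have hparts : π.partition.parts = α.parts := by
    have := (conjClass_nonempty α).choose_spec
    rw [← hπ] at this
    simpa [conjClass] using this
  rw [hα] at hparts
  have hsum : a + b = n := by
    have := α.parts_sum
    rw [hα] at this
    simpa using this
  have ha : 0 < a := α.parts_pos (by simp [hα])
  have hb : 0 < b := α.parts_pos (by simp [hα])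
  obtain ⟨X, hXa, hXb, hne, hO⟩ := exists_orbs_eq_pair hparts
  have hXO : X ∈ orbs π := by simp [hO]
  have hXcO : Xᶜ ∈ orbs π := by simp [hO]
  have hX : Preserves X π := by
    intro z
    constructor
    · intro h
      rw [← orb_eq_of_mem_orbs hXO h, mem_orb_comm, mem_orb]
      exact ⟨1, by simp⟩
    · intro h
      have := orb_eq_of_mem_orbs hXO h
      rw [← this]
      exact apply_mem_orb (self_mem_orb _ _)
  obtain ⟨m, hm⟩ := hn
  have hk1 : 0 < k - 1 := by omega
  have hmu : mu k 2 n = m := by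
    rw [mu, Nat.add_sub_cancel, hm, Nat.mul_div_cancel_left _ hk1]
  have hcardO : #(orbs π) = 2 := by rw [hO, card_pair hne]
  have hcount : countMixing k X m π = m.factorial * A a b := by
    rw [countMixing_eq hk hw1 hw hA hAw m π hX (by rw [hcardO, Fintype.card_fin, hm, mul_comm]),
      hO, annularWeight_pair w A (nonempty_of_mem_orbs hXO) (nonempty_of_mem_orbs hXcO) hne, hXa,
      hXb]
  have htrans : ∀ L, IsTransitiveFactorisation k π L ↔
      L ∈ ({L ∈ factorisations k L.length π | ¬ ∀ σ ∈ L, Preserves X σ} : Finset _) := by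
    intro L
    rw [mem_filter, mem_factorisations]
    constructor
    · rintro ⟨h1, h2, h3⟩
      exact ⟨⟨rfl, h1, h2⟩, (isPretransitive_closure_iff (h2 ▸ hXO) (h2 ▸ hXcO)).1 h3⟩
    · rintro ⟨⟨-, h1, h2⟩, h3⟩
      exact ⟨h1, h2, (isPretransitive_closure_iff (h2 ▸ hXO) (h2 ▸ hXcO)).2 h3⟩
  have hlow : ∀ L, IsTransitiveFactorisation k π L → m ≤ L.length := by
    intro L hL
    by_contra hlt
    rw [not_le] at hlt
    rw [htrans] at hL
    have h0 := countMixing_eq_zero hk (X := X) L.length π hX (by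
      have h := Nat.mul_lt_mul_of_pos_right hlt hk1
      rw [mul_comm m, ← hm] at h
      rw [hcardO, Fintype.card_fin]
      omega)
    rw [← card_mixing_factorisations, Nat.cast_eq_zero, card_eq_zero] at h0
    rw [h0] at hL
    exact notMem_empty _ hL
  have hset : {L | IsMinimalTransitiveFactorisation k π L} =
      (({L ∈ factorisations k m π | ¬ ∀ σ ∈ L, Preserves X σ} : Finset _) :
        Set (List (Equiv.Perm (Fin n)))) := by
    have hmem : ∀ L, L ∈ ({L ∈ factorisations k m π | ¬ ∀ σ ∈ L, Preserves X σ} : Finset _) →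
        IsTransitiveFactorisation k π L ∧ L.length = m := by
      intro L hL
      have hlen : L.length = m := (mem_factorisations.1 (mem_filter.1 hL).1).1
      exact ⟨(htrans L).2 (by rw [hlen]; exact hL), hlen⟩
    ext L
    rw [Set.mem_ofPred_eq, mem_coe]
    constructor
    · rintro ⟨h1, h2⟩
      have hlen : L.length = m := by
        by_cases hne0 : ({L ∈ factorisations k m π | ¬ ∀ σ ∈ L, Preserves X σ} :
            Finset _).Nonempty
        · obtain ⟨L', hL'⟩ := hne0
          obtain ⟨h3, h4⟩ := hmem L' hL'
          exact le_antisymm (h4 ▸ h2 L' h3) (hlow L h1)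
        · exfalso
          rw [not_nonempty_iff_eq_empty, ← card_eq_zero, ← Nat.cast_eq_zero (R := ℚ),
            card_mixing_factorisations, hcount] at hne0
          -- If length `m` is not attained, then `A a b = 0`, so `n < 2(k-1)`; being a multiple of
          -- `k-1`, `n` is less than `k`. No `k`-cycle exists on so few points, and the empty list
          -- is not transitive.
          have hA0 : A a b = 0 := by
            have := Nat.factorial_ne_zero m
            simpa [this] using hne0
          have hn2 : ¬ 2 * (k - 1) ≤ a + b := fun h =>
            hApos a b ha hb (by rw [hsum, hm]; exact dvd_mul_right _ _) h hA0
          have hm1 : m < 2 := by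
            by_contra hm2
            rw [hsum, hm, mul_comm] at hn2
            exact hn2 (Nat.mul_le_mul_left _ (by omega))
          have hnk : n < k := by
            have : (k - 1) * m ≤ (k - 1) * 1 := Nat.mul_le_mul_left _ (by omega)
            omega
          have hnil : L = [] := by
            rw [List.eq_nil_iff_forall_not_mem]
            intro σ hσ
            have hs := Equiv.Perm.sum_cycleType σ
            rw [h1.cycle σ hσ, Multiset.sum_singleton] at hs
            have := card_le_univ σ.support
            rw [Fintype.card_fin] at this
            omega
          rw [htrans, hnil] at h1
          simp at h1
      rw [← hlen]
      exact (htrans L).1 h1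
    · intro hL
      obtain ⟨h1, h2⟩ := hmem L hL
      exact ⟨h1, fun L' hL' => h2 ▸ hlow L' hL'⟩
  rw [c, ← hπ, hset, Set.ncard_coe_finset, card_mixing_factorisations, hcount, hmu]

end TwoCycles

end KCycleFactorisation

namespace KCycleFactorisation

/-! ### The coefficients of `P k 2` -/

section Coefficients

open Finset

/-- The exponents of the monomial `u^m p_s`. -/
noncomputable def exponents (m : ℕ) (s : Multiset ℕ) : Indet →₀ ℕ :=
  Finsupp.single Indet.u m + (s.map fun i => Finsupp.single (Indet.p i) 1).sum

theorem pParts_add (d e : Indet →₀ ℕ) : pParts (d + e) = pParts d + pParts e := by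
  classical
  unfold pParts
  rw [Finsupp.sum_add_index']
  · intro v
    cases v <;> simp
  · intro v i j
    cases v <;> simp [Multiset.replicate_add]

theorem pParts_exponents (m : ℕ) (s : Multiset ℕ) : pParts (exponents m s) = s := by
  rw [exponents, pParts_add]
  have h1 : pParts (Finsupp.single Indet.u m) = 0 := by
    unfold pParts
    rw [Finsupp.sum_single_index rfl]
  rw [h1, zero_add]
  induction s using Multiset.induction_on with
  | empty => simp [pParts]
  | cons i s ih =>
    rw [Multiset.map_cons, Multiset.sum_cons, pParts_add, ih]
    have : pParts (Finsupp.single (Indet.p i) 1) = {i} := by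
      unfold pParts
      rw [Finsupp.sum_single_index] <;> simp
    rw [this, Multiset.singleton_add]

theorem monomial_exponents (q : ℚ) (m : ℕ) (s : Multiset ℕ) :
    MvPolynomial.C q * MvPolynomial.X Indet.u ^ m *
      (s.map fun i => (MvPolynomial.X (Indet.p i) : MvPolynomial Indet ℚ)).prod =
    MvPolynomial.monomial (exponents m s) q := by
  have h : (s.map fun i => (MvPolynomial.X (Indet.p i) : MvPolynomial Indet ℚ)).prod =
      MvPolynomial.monomial ((s.map fun i => Finsupp.single (Indet.p i) 1).sum) 1 := by
    induction s using Multiset.induction_on with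
    | empty => simp
    | cons i s ih =>
      rw [Multiset.map_cons, Multiset.prod_cons, ih, Multiset.map_cons, Multiset.sum_cons,
        MvPolynomial.X, MvPolynomial.monomial_mul, one_mul]
  rw [h, MvPolynomial.X_pow_eq_monomial, MvPolynomial.C_mul_monomial,
    MvPolynomial.monomial_mul, mul_one, mul_one, exponents]

/-- `psi` is written as a sum over supports; this expresses its linearity, and allows coinciding
exponents. -/
theorem sum_support_sum_monomial {σ ι : Type*} (s : Finset ι) (e : ι → σ →₀ ℕ) (q : ι → ℚ)
    (f : (σ →₀ ℕ) → ℚ) :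
    ∑ d ∈ (∑ i ∈ s, MvPolynomial.monomial (e i) (q i)).support,
      MvPolynomial.coeff d (∑ i ∈ s, MvPolynomial.monomial (e i) (q i)) * f d =
    ∑ i ∈ s, q i * f (e i) := by
  classical
  set g := ∑ i ∈ s, MvPolynomial.monomial (e i) (q i) with hg
  rw [sum_subset (subset_union_left (s₂ := s.image e))
    (fun d _ hd => by rw [MvPolynomial.notMem_support_iff.1 hd, zero_mul])]
  rw [sum_congr rfl fun d _ => by rw [hg, MvPolynomial.coeff_sum, sum_mul], sum_comm]
  refine sum_congr rfl fun i hi => ?_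
  rw [sum_eq_single (e i)]
  · rw [MvPolynomial.coeff_monomial, if_pos rfl]
  · intro d _ hd
    rw [MvPolynomial.coeff_monomial, if_neg hd.symm, zero_mul]
  · intro h
    exact absurd (mem_union_right _ (mem_image_of_mem e hi)) h

theorem perm_fin_two_univ :
    (univ : Finset (Equiv.Perm (Fin 2))) = {1, Equiv.swap 0 1} := by decide

theorem pair_eq_pair_iff {a b i j : ℕ} :
    (({a, b} : Multiset ℕ) = {i, j}) ↔ (a = i ∧ b = j) ∨ (a = j ∧ b = i) := by
  constructor
  · intro h
    have h1 : a ∈ ({i, j} : Multiset ℕ) := h ▸ (by simp)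
    have h2 : a + b = i + j := by
      have := congrArg Multiset.sum h
      simpa using this
    simp only [Multiset.insert_eq_cons, Multiset.mem_cons, Multiset.mem_singleton] at h1
    omega
  · rintro (⟨rfl, rfl⟩ | ⟨rfl, rfl⟩)
    · rfl
    · exact Multiset.pair_comm _ _

/-- The two permutations produce the same monomial exactly when both exponents agree, whence the
value `2`. -/
theorem coeff_psiMonomial_pair (d : Fin 2 →₀ ℕ) {e : Indet →₀ ℕ} (he : (pParts e).card = 2) :
    MvPolynomial.coeff d (psiMonomial 2 e) =
      if pParts e = {d 0, d 1} then (if d 0 = d 1 then 2 else 1) else 0 := by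
  obtain ⟨a, b, hab, hs⟩ : ∃ a b, b ≤ a ∧ pParts e = {a, b} := by
    obtain ⟨a, b, h⟩ := Multiset.card_eq_two.1 he
    rcases le_total b a with h' | h'
    · exact ⟨a, b, h', h⟩
    · exact ⟨b, a, h', by rw [h, Multiset.pair_comm]⟩
  have hsort : (pParts e).sort (· ≥ ·) = [a, b] := by
    rw [hs, Multiset.insert_eq_cons, Multiset.sort_cons _ _ _ (by simpa using hab),
      Multiset.sort_singleton]
  have hX : ∀ i j : ℕ, MvPolynomial.coeff d
      ((MvPolynomial.X 0 : MvPolynomial (Fin 2) ℚ) ^ i * MvPolynomial.X 1 ^ j) =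
      if d 0 = i ∧ d 1 = j then 1 else 0 := by
    intro i j
    rw [MvPolynomial.X_pow_eq_monomial, MvPolynomial.X_pow_eq_monomial,
      MvPolynomial.monomial_mul, MvPolynomial.coeff_monomial, mul_one]
    refine if_congr ?_ rfl rfl
    constructor
    · rintro rfl; simp
    · rintro ⟨rfl, rfl⟩
      ext t
      fin_cases t <;> simp
  rw [psiMonomial, if_pos he, hsort, perm_fin_two_univ, sum_pair (by decide), Fin.prod_univ_two,
    Fin.prod_univ_two, MvPolynomial.coeff_add]
  simp only [Equiv.Perm.one_apply, Equiv.swap_apply_left, Equiv.swap_apply_right, Fin.val_zero,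
    Fin.val_one, List.getD_cons_zero, List.getD_cons_succ]
  rw [hX, hX, hs]
  have hiff : (({a, b} : Multiset ℕ) = {d 0, d 1}) ↔
      (d 0 = a ∧ d 1 = b) ∨ (d 0 = b ∧ d 1 = a) := by
    rw [pair_eq_pair_iff]
    constructor
    · rintro (⟨h1, h2⟩ | ⟨h1, h2⟩)
      · exact Or.inl ⟨h1.symm, h2.symm⟩
      · exact Or.inr ⟨h2.symm, h1.symm⟩
    · rintro (⟨h1, h2⟩ | ⟨h1, h2⟩)
      · exact Or.inl ⟨h1.symm, h2.symm⟩
      · exact Or.inr ⟨h2.symm, h1.symm⟩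
  simp only [hiff]
  by_cases h1 : d 0 = a ∧ d 1 = b
  · by_cases h2 : d 0 = b ∧ d 1 = a
    · have : d 0 = d 1 := by omega
      rw [if_pos h1, if_pos h2, if_pos (Or.inl h1), if_pos this]
      norm_num
    · have : d 0 ≠ d 1 := by omega
      rw [if_pos h1, if_neg h2, if_pos (Or.inl h1), if_neg this]
      norm_num
  · by_cases h2 : d 0 = b ∧ d 1 = a
    · have : d 0 ≠ d 1 := by omega
      rw [if_neg h1, if_pos h2, if_pos (Or.inr h2), if_neg this]
      norm_num
    · rw [if_neg h1, if_neg h2, if_neg (by tauto)]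
      norm_num

theorem coeff_P_two_eq_finsum (k : ℕ) (d : Fin 2 →₀ ℕ) :
    MvPowerSeries.coeff d (P k 2) = ∑ᶠ n : ℕ, if 1 ≤ n ∧ (k - 1) ∣ n then
      ∑ α : n.Partition with α.parts.card = 2,
        ((c k α : ℚ) * ((conjClass α).card : ℚ) / (((mu k 2 n).factorial : ℚ) * n.factorial)) *
          (if α.parts = {d 0, d 1} then (if d 0 = d 1 then 2 else 1) else 0)
      else 0 := by
  change ∑ᶠ n : ℕ, _ = _
  refine finsum_congr fun n => ?_
  rw [F, PowerSeries.coeff_mk, Nat.add_sub_cancel]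
  by_cases h : 1 ≤ n ∧ (k - 1) ∣ n
  · rw [if_pos h, if_pos h]
    simp only [monomial_exponents]
    rw [sum_support_sum_monomial]
    refine sum_congr rfl fun α hα => ?_
    rw [mem_filter] at hα
    rw [coeff_psiMonomial_pair d (by rw [pParts_exponents]; exact hα.2), pParts_exponents]
  · rw [if_neg h, if_neg h]
    simp

theorem coeff_P_two_eq_zero (k : ℕ) (d : Fin 2 →₀ ℕ)
    (h : ¬ (0 < d 0 ∧ 0 < d 1 ∧ (k - 1) ∣ d 0 + d 1)) :
    MvPowerSeries.coeff d (P k 2) = 0 := by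
  rw [coeff_P_two_eq_finsum]
  refine finsum_eq_zero_of_forall_eq_zero fun n => ?_
  by_cases hn : 1 ≤ n ∧ (k - 1) ∣ n
  · rw [if_pos hn]
    refine sum_eq_zero fun α _ => ?_
    rw [if_neg, mul_zero]
    intro hα
    have hsum := α.parts_sum
    rw [hα] at hsum
    simp only [Multiset.insert_eq_cons, Multiset.sum_cons, Multiset.sum_singleton] at hsum
    exact h ⟨α.parts_pos (by simp [hα]), α.parts_pos (by simp [hα]), hsum ▸ hn.2⟩
  · rw [if_neg hn]

/-- The factor `2` that `psi` produces for equal parts cancels the one in the order of the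
centraliser, so the formula is uniform. -/
theorem coeff_P_two (k : ℕ) (d : Fin 2 →₀ ℕ) (α : (d 0 + d 1).Partition)
    (hα : α.parts = {d 0, d 1}) (h : (k - 1) ∣ d 0 + d 1) :
    MvPowerSeries.coeff d (P k 2) =
      c k α / ((mu k 2 (d 0 + d 1)).factorial * (d 0 * d 1 : ℚ)) := by
  have h0 : 0 < d 0 := α.parts_pos (by simp [hα])
  have h1 : 0 < d 1 := α.parts_pos (by simp [hα])
  rw [coeff_P_two_eq_finsum, finsum_eq_single _ (d 0 + d 1)]
  · rw [if_pos ⟨by omega, h⟩, sum_eq_single α]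
    · rw [if_pos hα]
      have hc := card_conjClass_pair α hα
      have hc' : ((#(conjClass α) : ℕ) : ℚ) * (d 0 * d 1 * if d 0 = d 1 then 2 else 1) =
          ((d 0 + d 1).factorial : ℚ) := by
        rw [← hc]
        push_cast
        rfl
      have hn : ((d 0 + d 1).factorial : ℚ) ≠ 0 := by positivity
      have hm : ((mu k 2 (d 0 + d 1)).factorial : ℚ) ≠ 0 := by positivity
      have h0' : (d 0 : ℚ) ≠ 0 := by positivity
      have h1' : (d 1 : ℚ) ≠ 0 := by positivity
      rw [div_mul_eq_mul_div, div_eq_div_iff (by positivity) (by positivity), ← hc']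
      ring
    · intro β _ hβ
      rw [if_neg, mul_zero]
      intro h'
      exact hβ (Nat.Partition.ext (h'.trans hα.symm))
    · intro h'
      exact absurd (mem_filter.2 ⟨mem_univ _, by rw [hα]; rfl⟩) h'
  · intro n hn
    by_cases h' : 1 ≤ n ∧ (k - 1) ∣ n
    · rw [if_pos h']
      refine sum_eq_zero fun β _ => ?_
      rw [if_neg, mul_zero]
      intro hβ
      have hsum := β.parts_sum
      rw [hβ] at hsum
      simp only [Multiset.insert_eq_cons, Multiset.sum_cons, Multiset.sum_singleton] at hsum
      exact hn hsum.symm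
    · rw [if_neg h']

end Coefficients

end KCycleFactorisation

namespace KCycleFactorisation

/-! ### The equation `w = x e^{w^{k-1}}` -/

section FunctionalEquation

open PowerSeries

/-- One step of the iteration whose fixed points are the solutions of `w = x e^{w^{k-1}}`. -/
noncomputable def treeStep (k : ℕ) (v : PowerSeries ℚ) : PowerSeries ℚ :=
  X * (exp ℚ).subst (v ^ (k - 1))

theorem hasSubst_pow {k : ℕ} (hk : 2 ≤ k) {v : PowerSeries ℚ} (hv : constantCoeff v = 0) :
    HasSubst (v ^ (k - 1)) := by
  apply HasSubst.of_constantCoeff_zero'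
  rw [map_pow, hv, zero_pow (by omega)]

theorem constantCoeff_treeStep (k : ℕ) (v : PowerSeries ℚ) :
    constantCoeff (treeStep k v) = 0 := by
  rw [treeStep, map_mul, constantCoeff_X, zero_mul]

/-- The factor `X` makes `treeStep` a contraction in the `X`-adic topology; existence and uniqueness
of the fixed point follow. -/
theorem X_pow_dvd_treeStep_sub {k : ℕ} (hk : 2 ≤ k) {v v' : PowerSeries ℚ}
    (hv : constantCoeff v = 0) (hv' : constantCoeff v' = 0) {n : ℕ} (h : X ^ n ∣ v - v') :
    X ^ (n + 1) ∣ treeStep k v - treeStep k v' := by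
  rw [treeStep, treeStep, ← mul_sub, pow_succ']
  refine mul_dvd_mul_left _ (X_pow_dvd_iff.2 fun m hm => ?_)
  rw [map_sub, coeff_subst' (hasSubst_pow hk hv), coeff_subst' (hasSubst_pow hk hv'), sub_eq_zero]
  refine finsum_congr fun d => ?_
  congr 1
  have h1 : X ^ n ∣ (v ^ (k - 1)) ^ d - (v' ^ (k - 1)) ^ d := by
    rw [← pow_mul, ← pow_mul]
    exact h.trans (sub_dvd_pow_sub_pow _ _ _)
  rw [← sub_eq_zero, ← map_sub]
  exact X_pow_dvd_iff.1 h1 m hm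

theorem treeStep_fixed_unique {k : ℕ} (hk : 2 ≤ k) {v v' : PowerSeries ℚ}
    (hv : v = treeStep k v) (hv' : v' = treeStep k v') : v = v' := by
  have h0 : constantCoeff v = 0 := by rw [hv]; exact constantCoeff_treeStep _ _
  have h0' : constantCoeff v' = 0 := by rw [hv']; exact constantCoeff_treeStep _ _
  have h : ∀ n, X ^ n ∣ v - v' := by
    intro n
    induction n with
    | zero => simp
    | succ n ih =>
      rw [hv, hv']
      exact X_pow_dvd_treeStep_sub hk h0 h0' ih
  ext n
  rw [← sub_eq_zero, ← map_sub]
  exact X_pow_dvd_iff.1 (h (n + 1)) n (Nat.lt_succ_self n)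

theorem constantCoeff_iterate_treeStep (k n : ℕ) :
    constantCoeff ((treeStep k)^[n] 0) = 0 := by
  cases n with
  | zero => simp
  | succ n =>
    rw [Function.iterate_succ_apply']
    exact constantCoeff_treeStep _ _

/-- The limit of the iteration of `treeStep`. -/
noncomputable def treeSeries (k : ℕ) : PowerSeries ℚ :=
  PowerSeries.mk fun n => coeff n ((treeStep k)^[n + 1] 0)

theorem X_pow_dvd_treeSeries_sub {k : ℕ} (hk : 2 ≤ k) (n : ℕ) :
    X ^ n ∣ treeSeries k - (treeStep k)^[n] 0 := by
  have h : ∀ n, X ^ n ∣ (treeStep k)^[n + 1] 0 - (treeStep k)^[n] 0 := by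
    intro n
    induction n with
    | zero => simp
    | succ n ih =>
      rw [Function.iterate_succ_apply' _ (n + 1), Function.iterate_succ_apply' _ n]
      refine X_pow_dvd_treeStep_sub hk ?_ (constantCoeff_iterate_treeStep k n) ?_
      · rw [← Function.iterate_succ_apply' (treeStep k)]
        exact constantCoeff_iterate_treeStep k (n + 1)
      · rw [← Function.iterate_succ_apply' (treeStep k)]
        exact ih
  rw [X_pow_dvd_iff]
  intro m hm
  rw [map_sub, treeSeries, coeff_mk, sub_eq_zero]
  obtain ⟨t, rfl⟩ : ∃ t, n = m + 1 + t := ⟨n - (m + 1), by omega⟩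
  clear hm
  induction t with
  | zero => rfl
  | succ t ih =>
    rw [ih, ← sub_eq_zero, ← map_sub, ← neg_sub, map_neg, neg_eq_zero, ← add_assoc]
    exact X_pow_dvd_iff.1 (h (m + 1 + t)) m (by omega)

theorem constantCoeff_treeSeries (k : ℕ) : constantCoeff (treeSeries k) = 0 := by
  rw [← coeff_zero_eq_constantCoeff_apply, treeSeries, coeff_mk, coeff_zero_eq_constantCoeff_apply]
  exact constantCoeff_iterate_treeStep k 1

theorem treeSeries_eq {k : ℕ} (hk : 2 ≤ k) : treeSeries k = treeStep k (treeSeries k) := by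
  ext n
  rw [← sub_eq_zero, ← map_sub]
  have h1 := X_pow_dvd_treeSeries_sub hk (n + 1)
  have h2 := X_pow_dvd_treeStep_sub hk (constantCoeff_treeSeries k)
    (constantCoeff_iterate_treeStep k n) (X_pow_dvd_treeSeries_sub hk n)
  rw [← Function.iterate_succ_apply' (treeStep k)] at h2
  have h3 := dvd_sub h1 h2
  rw [sub_sub_sub_cancel_right] at h3
  exact X_pow_dvd_iff.1 h3 n (Nat.lt_succ_self n)

theorem coeff_one_treeSeries {k : ℕ} (hk : 2 ≤ k) : coeff 1 (treeSeries k) = 1 := by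
  have hs := hasSubst_pow hk (constantCoeff_treeSeries k)
  rw [treeSeries_eq hk, treeStep, ← zero_add 1, coeff_succ_X_mul, coeff_subst' hs,
    finsum_eq_single _ 0]
  · simp
  · intro d hd
    have : coeff 0 ((treeSeries k ^ (k - 1)) ^ d) = 0 := by
      rw [coeff_zero_eq_constantCoeff_apply, map_pow, map_pow, constantCoeff_treeSeries,
        zero_pow (by omega), zero_pow hd]
    rw [this, smul_zero]

/-- Differentiate `w = X E` with `E = exp (w^{k-1})`, multiply by `X`, and eliminate `E` through `X
E = w`. -/
theorem treeSeries_ode {k : ℕ} (hk : 2 ≤ k) :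
    X * d⁄dX ℚ (treeSeries k) * (1 - ((k : PowerSeries ℚ) - 1) * treeSeries k ^ (k - 1)) =
      treeSeries k := by
  set w := treeSeries k with hw
  have hs := hasSubst_pow hk (constantCoeff_treeSeries k)
  have heq : w = X * (exp ℚ).subst (w ^ (k - 1)) := treeSeries_eq hk
  have hd : d⁄dX ℚ w = (exp ℚ).subst (w ^ (k - 1)) +
      X * ((exp ℚ).subst (w ^ (k - 1)) * (((k - 1 : ℕ) : PowerSeries ℚ) * w ^ (k - 1 - 1) *
        d⁄dX ℚ w)) := by
    conv_lhs => rw [heq]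
    rw [Derivation.leibniz, derivative_subst hs, derivative_exp, derivative_pow, derivative_X]
    simp only [smul_eq_mul]
    ring
  obtain ⟨j, rfl⟩ : ∃ j, k = j + 2 := ⟨k - 2, by omega⟩
  set E := (exp ℚ).subst (w ^ (j + 2 - 1)) with hE
  simp only [show j + 2 - 1 = j + 1 by omega, show j + 1 - 1 = j by omega] at hd ⊢
  push_cast at hd ⊢
  have h1 : X * d⁄dX ℚ w = w + w * (((j : PowerSeries ℚ) + 1) * w ^ j * (X * d⁄dX ℚ w)) := by
    conv_lhs => rw [hd]
    rw [mul_add, ← heq]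
    linear_combination (-(X * (((j : PowerSeries ℚ) + 1) * w ^ j * d⁄dX ℚ w))) * heq
  linear_combination h1

/-- With `θ = x d/dx`, the differential equation says `k(θw - w) = (k-1) θ(wᵏ)`. -/
theorem treeSeries_coeff_rec {k : ℕ} (hk : 2 ≤ k) (n : ℕ) :
    (k : ℚ) * ((n : ℚ) - 1) * coeff n (treeSeries k) =
      ((k : ℚ) - 1) * n * coeff n (treeSeries k ^ k) := by
  have hX : ∀ f : PowerSeries ℚ, coeff n (X * d⁄dX ℚ f) = n * coeff n f := by
    intro f
    cases n with
    | zero => simp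
    | succ n =>
      rw [coeff_succ_X_mul, coeff_derivative]
      push_cast
      ring
  have h1 := treeSeries_ode hk
  have h2 : X * d⁄dX ℚ (treeSeries k ^ k) =
      (k : PowerSeries ℚ) * treeSeries k ^ (k - 1) * (X * d⁄dX ℚ (treeSeries k)) := by
    rw [derivative_pow]
    ring
  have h3 : C (k : ℚ) * (X * d⁄dX ℚ (treeSeries k)) - C (k : ℚ) * treeSeries k =
      C ((k : ℚ) - 1) * (X * d⁄dX ℚ (treeSeries k ^ k)) := by
    rw [h2, map_sub, map_one, map_natCast]
    linear_combination (k : PowerSeries ℚ) * h1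
  have h4 := congrArg (coeff n) h3
  rw [map_sub, coeff_C_mul, coeff_C_mul, coeff_C_mul, hX, hX] at h4
  linear_combination h4

end FunctionalEquation

/-! ### Support and positivity of the coefficients of `w` -/

section Supports

open PowerSeries

/-- The exponents of `f` are all congruent to `i` modulo `q`. -/
def SupportedMod (q : ℕ) (i : ℕ) (f : PowerSeries ℚ) : Prop :=
  ∀ n, coeff n f ≠ 0 → n ≡ i [MOD q]

theorem SupportedMod.mul {q i j : ℕ} {f g : PowerSeries ℚ} (hf : SupportedMod q i f)
    (hg : SupportedMod q j g) : SupportedMod q (i + j) (f * g) := by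
  intro n hn
  rw [coeff_mul] at hn
  obtain ⟨p, hp, hne⟩ := Finset.exists_ne_zero_of_sum_ne_zero hn
  rw [← Finset.HasAntidiagonal.mem_antidiagonal.1 hp]
  exact (hf _ (left_ne_zero_of_mul hne)).add (hg _ (right_ne_zero_of_mul hne))

theorem SupportedMod.pow {q i : ℕ} {f : PowerSeries ℚ} (hf : SupportedMod q i f) (m : ℕ) :
    SupportedMod q (m * i) (f ^ m) := by
  induction m with
  | zero =>
    intro n hn
    rw [pow_zero, coeff_one] at hn
    simp only [ne_eq, ite_eq_right_iff, one_ne_zero, imp_false, not_not] at hn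
    rw [hn, zero_mul]
  | succ m ih =>
    rw [pow_succ, Nat.succ_mul]
    exact ih.mul hf

theorem supportedMod_treeStep {k : ℕ} (hk : 2 ≤ k) {v : PowerSeries ℚ}
    (h0 : constantCoeff v = 0) (hv : SupportedMod (k - 1) 1 v) :
    SupportedMod (k - 1) 1 (treeStep k v) := by
  have hX : SupportedMod (k - 1) 1 (X : PowerSeries ℚ) := by
    intro n hn
    rw [coeff_X] at hn
    simp only [ne_eq, ite_eq_right_iff, one_ne_zero, imp_false, not_not] at hn
    rw [hn]
  refine hX.mul (j := 0) ?_
  intro n hn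
  rw [coeff_subst' (hasSubst_pow hk h0)] at hn
  obtain ⟨d, hd⟩ : ∃ d, coeff d (exp ℚ) • coeff n ((v ^ (k - 1)) ^ d) ≠ 0 := by
    by_contra! h
    exact hn (finsum_eq_zero_of_forall_eq_zero h)
  have h1 := (hv.pow (k - 1)).pow d n (right_ne_zero_of_smul hd)
  refine h1.trans ?_
  rw [mul_one, Nat.modEq_zero_iff_dvd]
  exact dvd_mul_left _ _

theorem supportedMod_treeSeries {k : ℕ} (hk : 2 ≤ k) : SupportedMod (k - 1) 1 (treeSeries k) := by
  have h : ∀ n, SupportedMod (k - 1) 1 ((treeStep k)^[n] 0) := by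
    intro n
    induction n with
    | zero => intro n hn; simp at hn
    | succ n ih =>
      rw [Function.iterate_succ_apply']
      exact supportedMod_treeStep hk (constantCoeff_iterate_treeStep k n) ih
  intro n hn
  rw [treeSeries, coeff_mk] at hn
  exact h _ n hn

theorem coeff_mul_nonneg {f g : PowerSeries ℚ} (hf : ∀ n, 0 ≤ coeff n f)
    (hg : ∀ n, 0 ≤ coeff n g) (n : ℕ) : 0 ≤ coeff n (f * g) := by
  rw [coeff_mul]
  exact Finset.sum_nonneg fun p _ => mul_nonneg (hf _) (hg _)

theorem coeff_pow_nonneg {f : PowerSeries ℚ} (hf : ∀ n, 0 ≤ coeff n f) (m n : ℕ) :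
    0 ≤ coeff n (f ^ m) := by
  induction m generalizing n with
  | zero =>
    rw [pow_zero, coeff_one]
    split_ifs <;> norm_num
  | succ m ih =>
    rw [pow_succ]
    exact coeff_mul_nonneg ih hf n

theorem coeff_treeSeries_nonneg {k : ℕ} (hk : 2 ≤ k) (n : ℕ) : 0 ≤ coeff n (treeSeries k) := by
  have h : ∀ n m, 0 ≤ coeff m ((treeStep k)^[n] 0) := by
    intro n
    induction n with
    | zero => intro m; simp
    | succ n ih =>
      rw [Function.iterate_succ_apply', treeStep]
      refine coeff_mul_nonneg ?_ ?_
      · intro m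
        rw [coeff_X]
        split_ifs <;> norm_num
      · intro m
        rw [coeff_subst' (hasSubst_pow hk (constantCoeff_iterate_treeStep k n))]
        refine finsum_nonneg fun d => ?_
        rw [coeff_exp, smul_eq_mul]
        exact mul_nonneg (by simp) (coeff_pow_nonneg (coeff_pow_nonneg ih _) _ _)
  rw [treeSeries, coeff_mk]
  exact h _ _

theorem mul_coeff_le_coeff_mul {f g : PowerSeries ℚ} (hf : ∀ n, 0 ≤ coeff n f)
    (hg : ∀ n, 0 ≤ coeff n g) (i j : ℕ) : coeff i f * coeff j g ≤ coeff (i + j) (f * g) := by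
  rw [coeff_mul]
  exact Finset.single_le_sum (f := fun p : ℕ × ℕ => coeff p.1 f * coeff p.2 g)
    (fun p _ => mul_nonneg (hf _) (hg _))
    (Finset.HasAntidiagonal.mem_antidiagonal.2 (rfl : (i, j).1 + (i, j).2 = _))

theorem one_le_coeff_pow_self {f : PowerSeries ℚ} (hf : ∀ n, 0 ≤ coeff n f)
    (h1 : coeff 1 f = 1) (m : ℕ) : 1 ≤ coeff m (f ^ m) := by
  induction m with
  | zero => simp
  | succ m ih =>
    rw [pow_succ]
    refine ih.trans ?_
    have := mul_coeff_le_coeff_mul (coeff_pow_nonneg hf m) hf m 1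
    rwa [h1, mul_one] at this

/-- By the recursion it suffices that the coefficient of `wᵏ` be positive. It dominates the product
of the coefficient of `x^{k-1}` in `w^{k-1}` with the previous nonzero coefficient of `w`. -/
theorem coeff_treeSeries_pos {k : ℕ} (hk : 2 ≤ k) (t : ℕ) :
    0 < coeff (1 + (k - 1) * t) (treeSeries k) := by
  induction t with
  | zero => rw [mul_zero, add_zero, coeff_one_treeSeries hk]; norm_num
  | succ t ih =>
    have hw := coeff_treeSeries_nonneg hk
    have h1 := mul_coeff_le_coeff_mul (coeff_pow_nonneg hw (k - 1)) hw (k - 1) (1 + (k - 1) * t)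
    rw [← pow_succ, Nat.sub_add_cancel (by omega : 1 ≤ k)] at h1
    have h2 := one_le_coeff_pow_self hw (coeff_one_treeSeries hk) (k - 1)
    have h3 : 0 < coeff (1 + (k - 1) * (t + 1)) (treeSeries k ^ k) := by
      rw [show 1 + (k - 1) * (t + 1) = k - 1 + (1 + (k - 1) * t) by ring]
      exact lt_of_lt_of_le (mul_pos (by linarith) ih) h1
    have hrec := treeSeries_coeff_rec hk (1 + (k - 1) * (t + 1))
    have hk' : (2 : ℚ) ≤ k := by exact_mod_cast hk
    have hpos : 0 < ((k : ℚ) - 1) * ((1 + (k - 1) * (t + 1) : ℕ) : ℚ) *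
        coeff (1 + (k - 1) * (t + 1)) (treeSeries k ^ k) :=
      mul_pos (mul_pos (by linarith) (by positivity)) h3
    rw [← hrec] at hpos
    exact lt_of_le_of_ne (hw _) fun h => by rw [← h, mul_zero] at hpos; exact lt_irrefl _ hpos

end Supports

end KCycleFactorisation

namespace KCycleFactorisation

/-! ### Chain rule and Euler operators in several variables -/

section ChainRule

open MvPowerSeries

variable {m : ℕ}

/-- For polynomials the rule is algebraic. Writing `f = X^N g` plus a truncation, the defect of the
rule for `f` is `a^N` times that for `g`, hence of order at least `N`, for every `N`. -/
theorem pderiv_subst {a : MvPowerSeries (Fin m) ℚ} (ha : constantCoeff a = 0) (i : Fin m)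
    (f : PowerSeries ℚ) :
    pderiv ℚ i (f.subst a) = (PowerSeries.derivative ℚ f).subst a * pderiv ℚ i a := by
  have hs : PowerSeries.HasSubst a := PowerSeries.HasSubst.of_constantCoeff_zero ha
  have hpoly : ∀ p : Polynomial ℚ, pderiv ℚ i ((p : PowerSeries ℚ).subst a) =
      (PowerSeries.derivative ℚ (p : PowerSeries ℚ)).subst a * pderiv ℚ i a := by
    intro p
    rw [PowerSeries.subst_coe hs, PowerSeries.derivative_coe, PowerSeries.subst_coe hs,
      Derivation.comp_aeval_eq, smul_eq_mul]
  ext e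
  rw [← sub_eq_zero, ← map_sub]
  set N := e.degree + 1 with hN
  set g : PowerSeries ℚ := PowerSeries.mk fun i => PowerSeries.coeff (i + N) f
  have hf : f = PowerSeries.X ^ N * g + (f.trunc N : PowerSeries ℚ) :=
    PowerSeries.eq_X_pow_mul_shift_add_trunc N f
  have key : pderiv ℚ i (f.subst a) - (PowerSeries.derivative ℚ f).subst a * pderiv ℚ i a =
      a ^ N * (pderiv ℚ i (g.subst a) - (PowerSeries.derivative ℚ g).subst a * pderiv ℚ i a) := by
    have h1 : f.subst a = a ^ N * g.subst a + (f.trunc N : PowerSeries ℚ).subst a := by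
      conv_lhs => rw [hf]
      rw [PowerSeries.subst_add hs, PowerSeries.subst_mul hs, PowerSeries.subst_pow hs,
        PowerSeries.subst_X hs]
    have h2 : (PowerSeries.derivative ℚ f).subst a =
        a ^ N * (PowerSeries.derivative ℚ g).subst a + g.subst a * (N * a ^ (N - 1)) +
          (PowerSeries.derivative ℚ (f.trunc N : PowerSeries ℚ)).subst a := by
      conv_lhs => rw [hf]
      rw [map_add, Derivation.leibniz, PowerSeries.derivative_pow, PowerSeries.derivative_X,
        mul_one, smul_eq_mul, smul_eq_mul, PowerSeries.subst_add hs, PowerSeries.subst_add hs,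
        PowerSeries.subst_mul hs, PowerSeries.subst_mul hs, PowerSeries.subst_mul hs,
        PowerSeries.subst_pow hs, PowerSeries.subst_pow hs, PowerSeries.subst_X hs]
      congr 4
      rw [← PowerSeries.coe_substAlgHom hs, map_natCast]
    rw [h1, h2, map_add, hpoly, Derivation.leibniz, pderiv_pow, smul_eq_mul, smul_eq_mul]
    ring
  rw [key]
  refine coeff_of_lt_order (lt_of_lt_of_le ?_ (le_order_mul))
  refine lt_of_lt_of_le ?_ (le_add_right (le_order_pow_of_constantCoeff_eq_zero N ha))
  exact_mod_cast Nat.lt_succ_self _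

theorem euler_sub (i : Fin m) (f g : MvPowerSeries (Fin m) ℚ) :
    euler i (f - g) = euler i f - euler i g := by
  rw [euler, euler, euler, map_sub, mul_sub]

theorem euler_mul (i : Fin m) (f g : MvPowerSeries (Fin m) ℚ) :
    euler i (f * g) = f * euler i g + g * euler i f := by
  rw [euler, euler, euler, Derivation.leibniz, smul_eq_mul, smul_eq_mul]
  ring

theorem euler_pow (i : Fin m) (f : MvPowerSeries (Fin m) ℚ) (n : ℕ) :
    euler i (f ^ n) = n * f ^ (n - 1) * euler i f := by
  rw [euler, euler, pderiv_pow]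
  ring

theorem euler_X_self (i : Fin m) : euler i (X i) = X i := by
  rw [euler, pderiv_X_self, mul_one]

theorem euler_X_of_ne {i j : Fin m} (h : j ≠ i) : euler i (X j) = 0 := by
  rw [euler, pderiv_X_of_ne h, mul_zero]

theorem coeff_euler (i : Fin m) (f : MvPowerSeries (Fin m) ℚ) (d : Fin m →₀ ℕ) :
    coeff d (euler i f) = d i * coeff d f := by
  rw [euler, X, coeff_monomial_mul]
  split_ifs with h
  · have hd : d - Finsupp.single i 1 + Finsupp.single i 1 = d := tsub_add_cancel_of_le h
    rw [coeff_pderiv, one_mul, hd, mul_comm]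
    congr 1
    rw [← Nat.cast_add_one]
    congr 1
    conv_rhs => rw [← hd]
    simp
  · have : d i = 0 := by
      by_contra h'
      exact h (Finsupp.single_le_iff.2 (Nat.one_le_iff_ne_zero.2 h'))
    rw [this, Nat.cast_zero, zero_mul]

theorem wAt_mul (f g : PowerSeries ℚ) (i : Fin m) : wAt (f * g) i = wAt f i * wAt g i :=
  PowerSeries.subst_mul (PowerSeries.HasSubst.X i) f g

theorem wAt_pow (f : PowerSeries ℚ) (n : ℕ) (i : Fin m) : wAt (f ^ n) i = wAt f i ^ n :=
  PowerSeries.subst_pow (PowerSeries.HasSubst.X i) f n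

theorem coeff_wAt (f : PowerSeries ℚ) (i : Fin m) (d : Fin m →₀ ℕ) :
    coeff d (wAt f i) = if d = Finsupp.single i (d i) then PowerSeries.coeff (d i) f else 0 :=
  PowerSeries.coeff_subst_single i f d

theorem euler_wAt_self (f : PowerSeries ℚ) (i : Fin m) :
    euler i (wAt f i) = wAt (PowerSeries.X * PowerSeries.derivative ℚ f) i := by
  rw [euler, wAt, pderiv_subst (constantCoeff_X i), pderiv_X_self, mul_one, wAt_mul, wAt, wAt,
    PowerSeries.subst_X (PowerSeries.HasSubst.X i)]

theorem euler_wAt_of_ne (f : PowerSeries ℚ) {i j : Fin m} (h : j ≠ i) : euler i (wAt f j) = 0 := by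
  rw [euler, wAt, pderiv_subst (constantCoeff_X j), pderiv_X_of_ne h, mul_zero, mul_zero]

theorem constantCoeff_logSeries {f : MvPowerSeries (Fin m) ℚ} (hf : constantCoeff f = 1) :
    constantCoeff (logSeries f) = 0 := by
  refine PowerSeries.constantCoeff_subst_eq_zero ?_ _ (PowerSeries.constantCoeff_log)
  rw [map_sub, hf, map_one, sub_self]

/-- Logarithmic derivative without division, from `(1 + X) log'(1 + X) = 1`. -/
theorem mul_euler_logSeries {f : MvPowerSeries (Fin m) ℚ} (hf : constantCoeff f = 1) (i : Fin m) :
    f * euler i (logSeries f) = euler i f := by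
  have h0 : constantCoeff (f - 1) = 0 := by rw [map_sub, hf, map_one, sub_self]
  have hs : PowerSeries.HasSubst (f - 1) := PowerSeries.HasSubst.of_constantCoeff_zero h0
  have h1 : (1 + PowerSeries.X) * PowerSeries.derivative ℚ (PowerSeries.log ℚ) = 1 := by
    rw [PowerSeries.deriv_log]
    ext n
    cases n with
    | zero => simp
    | succ n =>
      rw [add_mul, one_mul, map_add, PowerSeries.coeff_succ_X_mul, PowerSeries.coeff_one]
      simp [pow_succ]
  have h2 := congrArg (PowerSeries.subst (f - 1)) h1
  rw [PowerSeries.subst_mul hs, PowerSeries.subst_add hs, PowerSeries.subst_X hs,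
    ← PowerSeries.coe_substAlgHom hs, map_one, PowerSeries.coe_substAlgHom hs,
    add_sub_cancel] at h2
  rw [euler, euler, logSeries, pderiv_subst h0, map_sub, pderiv_one, sub_zero]
  linear_combination (X i * pderiv ℚ i f) * h2

/-- `wAt f i` contains no other variable, so only the exponent of the `i`-th one is shared between
the factors. -/
theorem coeff_add_single_wAt_mul (f : PowerSeries ℚ) (i : Fin m) (G : MvPowerSeries (Fin m) ℚ)
    {e : Fin m →₀ ℕ} (he : e i = 0) (n : ℕ) :
    coeff (e + Finsupp.single i n) (wAt f i * G) =
      ∑ p ∈ Finset.HasAntidiagonal.antidiagonal n,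
        PowerSeries.coeff p.1 f * coeff (e + Finsupp.single i p.2) G := by
  classical
  rw [coeff_mul]
  symm
  refine Finset.sum_of_injOn
    (fun p => (Finsupp.single i p.1, e + Finsupp.single i p.2)) ?_ ?_ ?_ ?_
  · intro p _ q _ hpq
    rw [Prod.mk.injEq] at hpq
    exact Prod.ext (Finsupp.single_injective i hpq.1)
      (Finsupp.single_injective i (add_left_cancel hpq.2))
  · intro p hp
    have hp' := Finset.HasAntidiagonal.mem_antidiagonal.1 (Finset.mem_coe.1 hp)
    refine Finset.mem_coe.2 (Finset.HasAntidiagonal.mem_antidiagonal.2 ?_)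
    show Finsupp.single i p.1 + (e + Finsupp.single i p.2) = _
    rw [← hp', Finsupp.single_add]
    abel
  · rintro ⟨d, d'⟩ hd hnot
    rw [coeff_wAt]
    split_ifs with h
    · exfalso
      have hd' := Finset.HasAntidiagonal.mem_antidiagonal.1 hd
      have hdn := DFunLike.congr_fun hd' i
      simp only [Finsupp.add_apply, he, Finsupp.single_eq_same, zero_add] at hdn
      refine hnot ⟨(d i, d' i), Finset.mem_coe.2 (Finset.HasAntidiagonal.mem_antidiagonal.2 hdn), ?_⟩
      refine Prod.ext h.symm (Finsupp.ext fun j => ?_)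
      have hj := DFunLike.congr_fun hd' j
      by_cases hij : j = i
      · subst hij
        simp [he]
      · rw [h] at hj
        simp only [Finsupp.add_apply, Finsupp.single_apply, if_neg (Ne.symm hij)] at hj ⊢
        omega
    · exact zero_mul _
  · intro p _
    show _ = coeff (Finsupp.single i p.1) (wAt f i) * coeff (e + Finsupp.single i p.2) G
    rw [coeff_wAt, Finsupp.single_eq_same, if_pos rfl]

end ChainRule

/-! ### Coefficients in two variables -/

section Bicoeff

open MvPowerSeries

/-- The coefficient of `x₁ᵃ x₂ᵇ`. -/
noncomputable def bicoeff (a b : ℕ) : MvPowerSeries (Fin 2) ℚ →ₗ[ℚ] ℚ :=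
  coeff (Finsupp.single 0 a + Finsupp.single 1 b)

theorem coeff_eq_bicoeff (d : Fin 2 →₀ ℕ) (f : MvPowerSeries (Fin 2) ℚ) :
    coeff d f = bicoeff (d 0) (d 1) f := by
  have h : d = Finsupp.single 0 (d 0) + Finsupp.single 1 (d 1) := by
    ext i
    fin_cases i <;> simp
  rw [bicoeff, ← h]

theorem ext_bicoeff {f g : MvPowerSeries (Fin 2) ℚ} (h : ∀ a b, bicoeff a b f = bicoeff a b g) :
    f = g := by
  ext d
  rw [coeff_eq_bicoeff, coeff_eq_bicoeff, h]

theorem bicoeff_zero_zero (f : MvPowerSeries (Fin 2) ℚ) : bicoeff 0 0 f = constantCoeff f := by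
  rw [bicoeff, Finsupp.single_zero, Finsupp.single_zero, add_zero,
    coeff_zero_eq_constantCoeff_apply]

theorem bicoeff_euler_zero (f : MvPowerSeries (Fin 2) ℚ) (a b : ℕ) :
    bicoeff a b (euler 0 f) = a * bicoeff a b f := by
  rw [bicoeff, coeff_euler]
  simp

theorem bicoeff_euler_one (f : MvPowerSeries (Fin 2) ℚ) (a b : ℕ) :
    bicoeff a b (euler 1 f) = b * bicoeff a b f := by
  rw [bicoeff, coeff_euler]
  simp

theorem bicoeff_wAt_zero_mul (f : PowerSeries ℚ) (G : MvPowerSeries (Fin 2) ℚ) (a b : ℕ) :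
    bicoeff a b (wAt f 0 * G) =
      ∑ p ∈ Finset.HasAntidiagonal.antidiagonal a, PowerSeries.coeff p.1 f * bicoeff p.2 b G := by
  rw [bicoeff, add_comm, coeff_add_single_wAt_mul _ _ _ (by simp)]
  refine Finset.sum_congr rfl fun p _ => ?_
  rw [bicoeff, add_comm]

theorem bicoeff_wAt_one_mul (f : PowerSeries ℚ) (G : MvPowerSeries (Fin 2) ℚ) (a b : ℕ) :
    bicoeff a b (wAt f 1 * G) =
      ∑ p ∈ Finset.HasAntidiagonal.antidiagonal b, PowerSeries.coeff p.1 f * bicoeff a p.2 G := by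
  rw [bicoeff, coeff_add_single_wAt_mul _ _ _ (by simp)]
  rfl

theorem bicoeff_wAt_zero (f : PowerSeries ℚ) (a b : ℕ) :
    bicoeff a b (wAt f 0) = if b = 0 then PowerSeries.coeff a f else 0 := by
  rw [bicoeff, coeff_wAt]
  simp

theorem bicoeff_wAt_one (f : PowerSeries ℚ) (a b : ℕ) :
    bicoeff a b (wAt f 1) = if a = 0 then PowerSeries.coeff b f else 0 := by
  rw [bicoeff, coeff_wAt]
  simp

theorem bicoeff_X_zero_mul (f : MvPowerSeries (Fin 2) ℚ) (a b : ℕ) :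
    bicoeff a b (X 0 * f) = if a = 0 then 0 else bicoeff (a - 1) b f := by
  have h : X 0 * f = wAt PowerSeries.X 0 * f := by
    rw [wAt, PowerSeries.subst_X (PowerSeries.HasSubst.X _)]
  rw [h, bicoeff_wAt_zero_mul]
  cases a with
  | zero => simp
  | succ a =>
    rw [Finset.sum_eq_single (1, a)]
    · simp
    · intro p hp hne
      rw [PowerSeries.coeff_X, if_neg, zero_mul]
      intro h1
      have := Finset.HasAntidiagonal.mem_antidiagonal.1 hp
      exact hne (Prod.ext h1 (by simp only; omega))
    · intro hp
      exact absurd (Finset.HasAntidiagonal.mem_antidiagonal.2 (add_comm 1 a)) hp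

theorem bicoeff_X_one_mul (f : MvPowerSeries (Fin 2) ℚ) (a b : ℕ) :
    bicoeff a b (X 1 * f) = if b = 0 then 0 else bicoeff a (b - 1) f := by
  have h : X 1 * f = wAt PowerSeries.X 1 * f := by
    rw [wAt, PowerSeries.subst_X (PowerSeries.HasSubst.X _)]
  rw [h, bicoeff_wAt_one_mul]
  cases b with
  | zero => simp
  | succ b =>
    rw [Finset.sum_eq_single (1, b)]
    · simp
    · intro p hp hne
      rw [PowerSeries.coeff_X, if_neg, zero_mul]
      intro h1
      have := Finset.HasAntidiagonal.mem_antidiagonal.1 hp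
      exact hne (Prod.ext h1 (by simp only; omega))
    · intro hp
      exact absurd (Finset.HasAntidiagonal.mem_antidiagonal.2 (add_comm 1 b)) hp

/-- Exchange of the two variables. -/
noncomputable def swapVars : MvPowerSeries (Fin 2) ℚ →ₐ[ℚ] MvPowerSeries (Fin 2) ℚ :=
  (renameEquiv ℚ (Equiv.swap (0 : Fin 2) 1)).toAlgHom

theorem bicoeff_swapVars (f : MvPowerSeries (Fin 2) ℚ) (a b : ℕ) :
    bicoeff a b (swapVars f) = bicoeff b a f := by
  have h := coeff_embDomain_rename (Equiv.swap (0 : Fin 2) 1).toEmbedding f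
    (Finsupp.single 0 b + Finsupp.single 1 a)
  rw [bicoeff, bicoeff, ← h]
  change coeff _ (rename _ f) = _
  congr 1
  rw [Finsupp.embDomain_eq_mapDomain, Finsupp.mapDomain_add, Finsupp.mapDomain_single,
    Finsupp.mapDomain_single]
  simp [add_comm]

theorem swapVars_wAt_zero (f : PowerSeries ℚ) : swapVars (wAt f 0) = wAt f 1 := by
  refine ext_bicoeff fun a b => ?_
  rw [bicoeff_swapVars, bicoeff_wAt_zero, bicoeff_wAt_one]

theorem swapVars_wAt_one (f : PowerSeries ℚ) : swapVars (wAt f 1) = wAt f 0 := by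
  refine ext_bicoeff fun a b => ?_
  rw [bicoeff_swapVars, bicoeff_wAt_zero, bicoeff_wAt_one]

end Bicoeff

end KCycleFactorisation

namespace KCycleFactorisation

/-! ### Complete symmetric polynomials in two variables -/

section CompleteSymmetric

variable {R : Type*} [CommRing R]

/-- The complete homogeneous symmetric polynomial of degree `j` in `a` and `b`. -/
def hsym (a b : R) : ℕ → R
  | 0 => 1
  | j + 1 => b * hsym a b j + a ^ (j + 1)

/-- The quotients in the theorem are replaced throughout by `hsym`, which is characterised by this
relation in a domain with `a ≠ b`. -/
theorem sub_mul_hsym (a b : R) (j : ℕ) : (a - b) * hsym a b j = a ^ (j + 1) - b ^ (j + 1) := by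
  induction j with
  | zero => simp [hsym]
  | succ j ih =>
    rw [hsym]
    linear_combination b * ih

theorem map_hsym {S F : Type*} [CommRing S] [FunLike F R S] [RingHomClass F R S] (f : F)
    (a b : R) (j : ℕ) : f (hsym a b j) = hsym (f a) (f b) j := by
  induction j with
  | zero => simp [hsym]
  | succ j ih => rw [hsym, map_add, map_mul, ih, map_pow, hsym]

theorem hsym_succ' (a b : R) (j : ℕ) : hsym a b (j + 1) = a * hsym a b j + b ^ (j + 1) := by
  rw [hsym]
  linear_combination -sub_mul_hsym a b j

theorem hsym_comm (a b : R) (j : ℕ) : hsym a b j = hsym b a j := by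
  induction j with
  | zero => rfl
  | succ j ih => rw [hsym_succ', ih, hsym]

end CompleteSymmetric

/-! ### The closed form and its two differential equations -/

section AnnulusSeries

open MvPowerSeries

/-- The series `(w(x₁) - w(x₂)) / (x₁ - x₂)`. -/
noncomputable def divDiff (w : PowerSeries ℚ) : MvPowerSeries (Fin 2) ℚ :=
  fun d => PowerSeries.coeff (d 0 + d 1 + 1) w

theorem bicoeff_divDiff (w : PowerSeries ℚ) (a b : ℕ) :
    bicoeff a b (divDiff w) = PowerSeries.coeff (a + b + 1) w := by
  change PowerSeries.coeff _ w = _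
  simp

/-- The series `(x₂ w(x₁) - x₁ w(x₂)) / (x₁ - x₂)`. -/
noncomputable def sumSeries (w : PowerSeries ℚ) : MvPowerSeries (Fin 2) ℚ :=
  fun d => if d 0 = 0 ∨ d 1 = 0 then 0 else PowerSeries.coeff (d 0 + d 1) w

theorem bicoeff_sumSeries (w : PowerSeries ℚ) (a b : ℕ) :
    bicoeff a b (sumSeries w) = if a = 0 ∨ b = 0 then 0 else PowerSeries.coeff (a + b) w := by
  change (if _ then _ else PowerSeries.coeff _ w) = _
  simp

theorem X_sub_X_mul_divDiff (w : PowerSeries ℚ) :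
    (X 0 - X 1) * divDiff w = wAt w 0 - wAt w 1 := by
  refine ext_bicoeff fun a b => ?_
  rw [sub_mul, map_sub, map_sub, bicoeff_X_zero_mul, bicoeff_X_one_mul, bicoeff_wAt_zero,
    bicoeff_wAt_one, bicoeff_divDiff, bicoeff_divDiff]
  rcases a with _ | a <;> rcases b with _ | b <;> simp
  rw [← add_assoc, add_right_comm a 1 b, sub_self]

/-- The coefficient `w_{a+b}` of `sumSeries` is the weight of the cycle obtained by joining cycles
of lengths `a` and `b`; in closed form it is a divided difference. -/
theorem X_sub_X_mul_sumSeries {w : PowerSeries ℚ} (h0 : PowerSeries.constantCoeff w = 0) :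
    (X 0 - X 1) * sumSeries w = X 1 * wAt w 0 - X 0 * wAt w 1 := by
  refine ext_bicoeff fun a b => ?_
  rw [sub_mul, map_sub, map_sub, bicoeff_X_zero_mul, bicoeff_X_one_mul, bicoeff_X_zero_mul,
    bicoeff_X_one_mul, bicoeff_wAt_zero, bicoeff_wAt_one, bicoeff_sumSeries, bicoeff_sumSeries]
  rcases a with _ | _ | a <;> rcases b with _ | _ | b <;> simp [h0, add_comm]
  rw [show a + 1 + (1 + (b + 1)) = b + 1 + (1 + (a + 1)) by ring, sub_self]

theorem constantCoeff_divDiff {w : PowerSeries ℚ} (h1 : PowerSeries.coeff 1 w = 1) :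
    constantCoeff (divDiff w) = 1 := by
  rw [← bicoeff_zero_zero, bicoeff_divDiff, h1]

theorem X_sub_X_ne_zero : (X 0 - X 1 : MvPowerSeries (Fin 2) ℚ) ≠ 0 := by
  intro h
  have h1 := congrArg (bicoeff 1 0) h
  rw [map_zero, map_sub, ← mul_one (X 0), ← mul_one (X 1), bicoeff_X_zero_mul,
    bicoeff_X_one_mul, if_neg one_ne_zero, if_pos rfl, Nat.sub_self, bicoeff_zero_zero] at h1
  simp at h1

theorem wAt_sub_wAt_ne_zero {w : PowerSeries ℚ} (h1 : PowerSeries.coeff 1 w = 1) :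
    (wAt w 0 - wAt w 1 : MvPowerSeries (Fin 2) ℚ) ≠ 0 := by
  intro h
  have h2 := congrArg (bicoeff 1 0) h
  rw [map_zero, map_sub, bicoeff_wAt_zero, bicoeff_wAt_one, if_pos rfl, if_neg one_ne_zero, h1] at h2
  norm_num at h2

/-- The claimed value `log ((w₁ - w₂) / (x₁ - x₂)) - (w₁ᵏ - w₂ᵏ) / (w₁ - w₂)` of `P k 2`. -/
noncomputable def annulusSeries (k : ℕ) : MvPowerSeries (Fin 2) ℚ :=
  logSeries (divDiff (treeSeries k)) - hsym (wAt (treeSeries k) 0) (wAt (treeSeries k) 1) (k - 1)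

theorem euler_wAt_treeSeries {k m : ℕ} (hk : 2 ≤ k) (i : Fin m) :
    euler i (wAt (treeSeries k) i) * (1 - C ((k : ℚ) - 1) * wAt (treeSeries k) i ^ (k - 1)) =
      wAt (treeSeries k) i := by
  have hs : PowerSeries.HasSubst (X i : MvPowerSeries (Fin m) ℚ) := PowerSeries.HasSubst.X i
  have h := congrArg (PowerSeries.substAlgHom hs) (treeSeries_ode hk)
  simp only [map_mul, map_sub, map_one, map_natCast, map_pow, PowerSeries.coe_substAlgHom] at h
  rw [euler_wAt_self, wAt_mul, map_sub, map_one, map_natCast]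
  exact h

variable {k : ℕ}

theorem mul_euler_zero_logSeries (w : PowerSeries ℚ) (h1 : PowerSeries.coeff 1 w = 1) :
    (wAt w 0 - wAt w 1) * euler 0 (logSeries (divDiff w)) =
      euler 0 (wAt w 0) - X 0 * divDiff w := by
  have h := congrArg (euler 0) (X_sub_X_mul_divDiff w)
  rw [euler_mul, euler_sub, euler_sub, euler_X_self, euler_X_of_ne one_ne_zero,
    euler_wAt_of_ne w one_ne_zero] at h
  rw [← X_sub_X_mul_divDiff]
  linear_combination h + (X 0 - X 1) * mul_euler_logSeries (constantCoeff_divDiff h1) 0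

theorem mul_euler_one_logSeries (w : PowerSeries ℚ) (h1 : PowerSeries.coeff 1 w = 1) :
    (wAt w 0 - wAt w 1) * euler 1 (logSeries (divDiff w)) =
      X 1 * divDiff w - euler 1 (wAt w 1) := by
  have h := congrArg (euler 1) (X_sub_X_mul_divDiff w)
  rw [euler_mul, euler_sub, euler_sub, euler_X_self, euler_X_of_ne zero_ne_one,
    euler_wAt_of_ne w zero_ne_one] at h
  rw [← X_sub_X_mul_divDiff]
  linear_combination h + (X 0 - X 1) * mul_euler_logSeries (constantCoeff_divDiff h1) 1

theorem mul_euler_zero_hsym (w : PowerSeries ℚ) (j : ℕ) :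
    (wAt w 0 - wAt w 1) * euler 0 (hsym (wAt w 0) (wAt w 1) j) +
        euler 0 (wAt w 0) * hsym (wAt w 0) (wAt w 1) j =
      ((j + 1 : ℕ) : MvPowerSeries (Fin 2) ℚ) * wAt w 0 ^ j * euler 0 (wAt w 0) := by
  have h := congrArg (euler 0) (sub_mul_hsym (wAt w 0 : MvPowerSeries (Fin 2) ℚ) (wAt w 1) j)
  rw [euler_mul, euler_sub, euler_sub, euler_pow, euler_pow,
    euler_wAt_of_ne w one_ne_zero, Nat.add_sub_cancel] at h
  linear_combination h

theorem mul_euler_one_hsym (w : PowerSeries ℚ) (j : ℕ) :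
    (wAt w 0 - wAt w 1) * euler 1 (hsym (wAt w 0) (wAt w 1) j) -
        euler 1 (wAt w 1) * hsym (wAt w 0) (wAt w 1) j =
      -(((j + 1 : ℕ) : MvPowerSeries (Fin 2) ℚ) * wAt w 1 ^ j * euler 1 (wAt w 1)) := by
  have h := congrArg (euler 1) (sub_mul_hsym (wAt w 0 : MvPowerSeries (Fin 2) ℚ) (wAt w 1) j)
  rw [euler_mul, euler_sub, euler_sub, euler_pow, euler_pow,
    euler_wAt_of_ne w zero_ne_one, Nat.add_sub_cancel] at h
  linear_combination h

/-- Multiplied by `(w₁-w₂)²`, this is an algebraic consequence of the logarithmic derivatives, the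
quotient relations and the differential equation of `w`. -/
theorem euler_add_euler_annulusSeries (hk : 2 ≤ k) :
    euler 0 (annulusSeries k) + euler 1 (annulusSeries k) =
      C ((k : ℚ) - 1) * hsym (wAt (treeSeries k) 0) (wAt (treeSeries k) 1) (k - 2) ^ 2 *
        (euler 0 (wAt (treeSeries k) 0) * euler 1 (wAt (treeSeries k) 1)) := by
  have h1 := coeff_one_treeSeries hk
  have hL0 := mul_euler_zero_logSeries _ h1
  have hL1 := mul_euler_one_logSeries _ h1
  have hQ := X_sub_X_mul_divDiff (treeSeries k)
  have hR0 := mul_euler_zero_hsym (treeSeries k) (k - 1)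
  have hR1 := mul_euler_one_hsym (treeSeries k) (k - 1)
  have hR := sub_mul_hsym (wAt (treeSeries k) 0 : MvPowerSeries (Fin 2) ℚ)
    (wAt (treeSeries k) 1) (k - 1)
  have hh := sub_mul_hsym (wAt (treeSeries k) 0 : MvPowerSeries (Fin 2) ℚ)
    (wAt (treeSeries k) 1) (k - 2)
  have hu := euler_wAt_treeSeries hk (0 : Fin 2)
  have hv := euler_wAt_treeSeries hk (1 : Fin 2)
  have hne := wAt_sub_wAt_ne_zero h1
  have hc : C ((k : ℚ) - 1) = ((k - 1 + 1 : ℕ) : MvPowerSeries (Fin 2) ℚ) - 1 := by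
    rw [map_sub, map_one, map_natCast, Nat.sub_add_cancel (by omega)]
  rw [show k - 2 + 1 = k - 1 by omega] at hh
  rw [pow_succ, pow_succ] at hR
  rw [annulusSeries, euler_sub, euler_sub]
  rw [hc] at hu hv ⊢
  -- The powers `w_i^{k-1}`, the derivatives and the quotients become independent letters, so that
  -- symbolic exponents disappear and `ring` can decide the identity.
  generalize ((k - 1 + 1 : ℕ) : MvPowerSeries (Fin 2) ℚ) = K at *
  generalize euler (0 : Fin 2) (logSeries (divDiff (treeSeries k))) = Lx at *
  generalize euler (1 : Fin 2) (logSeries (divDiff (treeSeries k))) = Ly at *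
  generalize euler (0 : Fin 2)
    (hsym (wAt (treeSeries k) 0 : MvPowerSeries (Fin 2) ℚ) (wAt (treeSeries k) 1) (k - 1)) = Rx at *
  generalize euler (1 : Fin 2)
    (hsym (wAt (treeSeries k) 0 : MvPowerSeries (Fin 2) ℚ) (wAt (treeSeries k) 1) (k - 1)) = Ry at *
  generalize hsym (wAt (treeSeries k) 0 : MvPowerSeries (Fin 2) ℚ) (wAt (treeSeries k) 1) (k - 1) = R at *
  generalize hsym (wAt (treeSeries k) 0 : MvPowerSeries (Fin 2) ℚ) (wAt (treeSeries k) 1) (k - 2) = H at *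
  generalize euler (0 : Fin 2) (wAt (treeSeries k) 0) = u at *
  generalize euler (1 : Fin 2) (wAt (treeSeries k) 1) = v at *
  generalize (wAt (treeSeries k) 0 : MvPowerSeries (Fin 2) ℚ) ^ (k - 1) = A at *
  generalize (wAt (treeSeries k) 1 : MvPowerSeries (Fin 2) ℚ) ^ (k - 1) = B at *
  generalize (wAt (treeSeries k) 0 : MvPowerSeries (Fin 2) ℚ) = a at *
  generalize (wAt (treeSeries k) 1 : MvPowerSeries (Fin 2) ℚ) = b at *
  generalize divDiff (treeSeries k) = Q at *
  refine mul_left_cancel₀ (pow_ne_zero 2 hne) ?_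
  linear_combination (a - b) * (hL0 + hL1 - hR0 - hR1 - hQ) + (u - v) * hR
    - (K - 1) * u * v * ((a - b) * H + A - B) * hh
    + (a - b + A * u - B * v) * (hu - hv) - (u - v) * (A * hu - B * hv)

/-- This is the recursion for `A` as a partial differential equation: the terms with `w_i^{k-1}` are
the cuts, the right-hand side is the join. -/
theorem mul_euler_add_mul_euler_annulusSeries (hk : 2 ≤ k) :
    (1 - C ((k : ℚ) - 1) * wAt (treeSeries k) 0 ^ (k - 1)) * euler 0 (annulusSeries k) +
        (1 - C ((k : ℚ) - 1) * wAt (treeSeries k) 1 ^ (k - 1)) * euler 1 (annulusSeries k) =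
      C ((k : ℚ) - 1) * (hsym (wAt (treeSeries k) 0) (wAt (treeSeries k) 1) (k - 2) *
        sumSeries (treeSeries k)) := by
  have hS := X_sub_X_mul_sumSeries (constantCoeff_treeSeries k)
  have h1 := coeff_one_treeSeries hk
  have hL0 := mul_euler_zero_logSeries _ h1
  have hL1 := mul_euler_one_logSeries _ h1
  have hQ := X_sub_X_mul_divDiff (treeSeries k)
  have hR0 := mul_euler_zero_hsym (treeSeries k) (k - 1)
  have hR1 := mul_euler_one_hsym (treeSeries k) (k - 1)
  have hR := sub_mul_hsym (wAt (treeSeries k) 0 : MvPowerSeries (Fin 2) ℚ)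
    (wAt (treeSeries k) 1) (k - 1)
  have hh := sub_mul_hsym (wAt (treeSeries k) 0 : MvPowerSeries (Fin 2) ℚ)
    (wAt (treeSeries k) 1) (k - 2)
  have hu := euler_wAt_treeSeries hk (0 : Fin 2)
  have hv := euler_wAt_treeSeries hk (1 : Fin 2)
  have hne := wAt_sub_wAt_ne_zero h1
  have hc : C ((k : ℚ) - 1) = ((k - 1 + 1 : ℕ) : MvPowerSeries (Fin 2) ℚ) - 1 := by
    rw [map_sub, map_one, map_natCast, Nat.sub_add_cancel (by omega)]
  rw [show k - 2 + 1 = k - 1 by omega] at hh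
  rw [pow_succ, pow_succ] at hR
  have hne' := X_sub_X_ne_zero
  rw [annulusSeries, euler_sub, euler_sub]
  rw [hc] at hu hv ⊢
  generalize ((k - 1 + 1 : ℕ) : MvPowerSeries (Fin 2) ℚ) = K at *
  generalize euler (0 : Fin 2) (logSeries (divDiff (treeSeries k))) = Lx at *
  generalize euler (1 : Fin 2) (logSeries (divDiff (treeSeries k))) = Ly at *
  generalize euler (0 : Fin 2)
    (hsym (wAt (treeSeries k) 0 : MvPowerSeries (Fin 2) ℚ) (wAt (treeSeries k) 1) (k - 1)) = Rx at *
  generalize euler (1 : Fin 2)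
    (hsym (wAt (treeSeries k) 0 : MvPowerSeries (Fin 2) ℚ) (wAt (treeSeries k) 1) (k - 1)) = Ry at *
  generalize hsym (wAt (treeSeries k) 0 : MvPowerSeries (Fin 2) ℚ) (wAt (treeSeries k) 1) (k - 1) = R at *
  generalize hsym (wAt (treeSeries k) 0 : MvPowerSeries (Fin 2) ℚ) (wAt (treeSeries k) 1) (k - 2) = H at *
  generalize euler (0 : Fin 2) (wAt (treeSeries k) 0) = u at *
  generalize euler (1 : Fin 2) (wAt (treeSeries k) 1) = v at *
  generalize (wAt (treeSeries k) 0 : MvPowerSeries (Fin 2) ℚ) ^ (k - 1) = A at *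
  generalize (wAt (treeSeries k) 1 : MvPowerSeries (Fin 2) ℚ) ^ (k - 1) = B at *
  generalize (wAt (treeSeries k) 0 : MvPowerSeries (Fin 2) ℚ) = a at *
  generalize (wAt (treeSeries k) 1 : MvPowerSeries (Fin 2) ℚ) = b at *
  generalize (X 0 : MvPowerSeries (Fin 2) ℚ) = x at *
  generalize (X 1 : MvPowerSeries (Fin 2) ℚ) = y at *
  generalize sumSeries (treeSeries k) = Φ at *
  generalize divDiff (treeSeries k) = Q at *
  -- The extra factor `x₁ - x₂` clears the denominator of `sumSeries`.
  refine mul_left_cancel₀ (mul_ne_zero hne' (pow_ne_zero 2 hne)) ?_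
  linear_combination (x - y) * (a - b) * ((1 - (K - 1) * A) * (hL0 - hR0) +
    (1 - (K - 1) * B) * (hL1 - hR1) + (1 - K * A + R) * hu - (1 - K * B + R) * hv + hR) +
    (a - b) * (y * (1 - (K - 1) * B) - x * (1 - (K - 1) * A)) * hQ -
    (K - 1) * (a - b) * ((x - y) * Φ * hh + (A - B) * hS)

end AnnulusSeries

end KCycleFactorisation

namespace KCycleFactorisation

/-! ### Nonnegativity and congruences of degrees -/

section Classes

open MvPowerSeries

variable {m : ℕ}

/-- All coefficients of `f` are nonnegative. -/
def NonnegCoeffs (f : MvPowerSeries (Fin m) ℚ) : Prop := ∀ d, 0 ≤ coeff d f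

theorem NonnegCoeffs.add {f g : MvPowerSeries (Fin m) ℚ} (hf : NonnegCoeffs f)
    (hg : NonnegCoeffs g) : NonnegCoeffs (f + g) := fun d => by
  rw [map_add]
  exact add_nonneg (hf d) (hg d)

theorem NonnegCoeffs.mul {f g : MvPowerSeries (Fin m) ℚ} (hf : NonnegCoeffs f)
    (hg : NonnegCoeffs g) : NonnegCoeffs (f * g) := fun d => by
  classical
  rw [coeff_mul]
  exact Finset.sum_nonneg fun p _ => mul_nonneg (hf _) (hg _)

theorem NonnegCoeffs.one : NonnegCoeffs (1 : MvPowerSeries (Fin m) ℚ) := fun d => by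
  classical
  rw [coeff_one]
  split_ifs <;> norm_num

theorem NonnegCoeffs.pow {f : MvPowerSeries (Fin m) ℚ} (hf : NonnegCoeffs f) (n : ℕ) :
    NonnegCoeffs (f ^ n) := by
  induction n with
  | zero => rw [pow_zero]; exact NonnegCoeffs.one
  | succ n ih => rw [pow_succ]; exact ih.mul hf

theorem NonnegCoeffs.hsym {f g : MvPowerSeries (Fin m) ℚ} (hf : NonnegCoeffs f)
    (hg : NonnegCoeffs g) (n : ℕ) : NonnegCoeffs (hsym f g n) := by
  induction n with
  | zero => exact NonnegCoeffs.one
  | succ n ih => exact (hg.mul ih).add (hf.pow _)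

theorem NonnegCoeffs.wAt {f : PowerSeries ℚ} (hf : ∀ n, 0 ≤ PowerSeries.coeff n f) (i : Fin m) :
    NonnegCoeffs (wAt f i) := fun d => by
  rw [coeff_wAt]
  split_ifs
  · exact hf _
  · exact le_rfl

theorem NonnegCoeffs.euler {f : MvPowerSeries (Fin m) ℚ} (hf : NonnegCoeffs f) (i : Fin m) :
    NonnegCoeffs (euler i f) := fun d => by
  rw [coeff_euler]
  exact mul_nonneg (Nat.cast_nonneg _) (hf d)

/-- The total degrees of the monomials of `f` are all congruent to `i` modulo `q`. -/
def DegreesMod (q i : ℕ) (f : MvPowerSeries (Fin m) ℚ) : Prop :=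
  ∀ d, coeff d f ≠ 0 → d.degree ≡ i [MOD q]

theorem DegreesMod.add {q i : ℕ} {f g : MvPowerSeries (Fin m) ℚ} (hf : DegreesMod q i f)
    (hg : DegreesMod q i g) : DegreesMod q i (f + g) := fun d hd => by
  by_contra h
  rw [map_add, not_imp_comm.1 (hf d) h, not_imp_comm.1 (hg d) h, add_zero] at hd
  exact hd rfl

theorem DegreesMod.mul {q i j : ℕ} {f g : MvPowerSeries (Fin m) ℚ} (hf : DegreesMod q i f)
    (hg : DegreesMod q j g) : DegreesMod q (i + j) (f * g) := fun d hd => by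
  classical
  rw [coeff_mul] at hd
  obtain ⟨p, hp, hne⟩ := Finset.exists_ne_zero_of_sum_ne_zero hd
  rw [← Finset.HasAntidiagonal.mem_antidiagonal.1 hp, map_add]
  exact (hf _ (left_ne_zero_of_mul hne)).add (hg _ (right_ne_zero_of_mul hne))

theorem DegreesMod.one {q : ℕ} : DegreesMod q 0 (1 : MvPowerSeries (Fin m) ℚ) := fun d hd => by
  classical
  rw [coeff_one] at hd
  simp only [ne_eq, ite_eq_right_iff, one_ne_zero, imp_false, not_not] at hd
  rw [hd, map_zero]

theorem DegreesMod.pow {q i : ℕ} {f : MvPowerSeries (Fin m) ℚ} (hf : DegreesMod q i f) (n : ℕ) :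
    DegreesMod q (n * i) (f ^ n) := by
  induction n with
  | zero => rw [pow_zero, zero_mul]; exact DegreesMod.one
  | succ n ih => rw [pow_succ, Nat.succ_mul]; exact ih.mul hf

theorem DegreesMod.hsym {q : ℕ} {f g : MvPowerSeries (Fin m) ℚ} (hf : DegreesMod q 1 f)
    (hg : DegreesMod q 1 g) (n : ℕ) : DegreesMod q n (hsym f g n) := by
  induction n with
  | zero => exact DegreesMod.one
  | succ n ih =>
    have h1 := hg.mul ih
    have h2 := hf.pow (n + 1)
    rw [add_comm] at h1
    rw [mul_one] at h2
    exact h1.add h2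

theorem DegreesMod.wAt {q i : ℕ} {f : PowerSeries ℚ} (hf : SupportedMod q i f) (l : Fin m) :
    DegreesMod q i (wAt f l) := fun d hd => by
  rw [coeff_wAt] at hd
  split_ifs at hd with h
  · rw [h, Finsupp.degree_single]
    exact hf _ hd
  · exact absurd rfl hd

theorem DegreesMod.euler {q i : ℕ} {f : MvPowerSeries (Fin m) ℚ} (hf : DegreesMod q i f)
    (l : Fin m) : DegreesMod q i (euler l f) := fun d hd => by
  rw [coeff_euler] at hd
  exact hf d (right_ne_zero_of_mul hd)

theorem bicoeff_zero_mul {f g : MvPowerSeries (Fin 2) ℚ} (hg : ∀ b, bicoeff 0 b g = 0) (b : ℕ) :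
    bicoeff 0 b (f * g) = 0 := by
  classical
  rw [bicoeff, coeff_mul]
  refine Finset.sum_eq_zero fun p hp => ?_
  have h := DFunLike.congr_fun (Finset.HasAntidiagonal.mem_antidiagonal.1 hp) 0
  simp at h
  rw [coeff_eq_bicoeff p.2, h.2, hg, mul_zero]

theorem bicoeff_mul_zero {f g : MvPowerSeries (Fin 2) ℚ} (hg : ∀ a, bicoeff a 0 g = 0) (a : ℕ) :
    bicoeff a 0 (f * g) = 0 := by
  classical
  rw [bicoeff, coeff_mul]
  refine Finset.sum_eq_zero fun p hp => ?_
  have h := DFunLike.congr_fun (Finset.HasAntidiagonal.mem_antidiagonal.1 hp) 1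
  simp at h
  rw [coeff_eq_bicoeff p.2, h.2, hg, mul_zero]

theorem NonnegCoeffs.bicoeff {f : MvPowerSeries (Fin 2) ℚ} (hf : NonnegCoeffs f) (a b : ℕ) :
    0 ≤ bicoeff a b f := hf _

end Classes

/-! ### Symmetry, sign and support of the closed form -/

section AnnulusCoefficients

open MvPowerSeries

variable {k : ℕ}

/-- Away from the constant term, dividing by `a + b` recovers the closed form from an explicit
product, on which symmetry, sign and support are visible although the logarithm hides them. -/
theorem add_mul_bicoeff_annulusSeries (hk : 2 ≤ k) (a b : ℕ) :
    ((a : ℚ) + b) * bicoeff a b (annulusSeries k) = bicoeff a b (C ((k : ℚ) - 1) *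
      hsym (wAt (treeSeries k) 0) (wAt (treeSeries k) 1) (k - 2) ^ 2 *
        (euler 0 (wAt (treeSeries k) 0) * euler 1 (wAt (treeSeries k) 1))) := by
  rw [← euler_add_euler_annulusSeries hk, map_add, bicoeff_euler_zero, bicoeff_euler_one, add_mul]

theorem bicoeff_zero_zero_annulusSeries (hk : 2 ≤ k) : bicoeff 0 0 (annulusSeries k) = 0 := by
  have hw : ∀ i : Fin 2, constantCoeff (wAt (treeSeries k) i) = 0 := by
    intro i
    rw [← coeff_zero_eq_constantCoeff_apply, coeff_wAt]
    simp [constantCoeff_treeSeries]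
  obtain ⟨j, hj⟩ : ∃ j, k - 1 = j + 1 := ⟨k - 2, by omega⟩
  rw [bicoeff_zero_zero, annulusSeries, map_sub,
    constantCoeff_logSeries (constantCoeff_divDiff (coeff_one_treeSeries hk)), map_hsym, hw, hw,
    hj, hsym]
  simp

theorem bicoeff_annulusSeries_comm (hk : 2 ≤ k) (a b : ℕ) :
    bicoeff a b (annulusSeries k) = bicoeff b a (annulusSeries k) := by
  rcases Nat.eq_zero_or_pos (a + b) with h | h
  · rw [(Nat.add_eq_zero_iff.1 h).1, (Nat.add_eq_zero_iff.1 h).2]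
  · have h' : ((a : ℚ) + b) ≠ 0 := by exact_mod_cast h.ne'
    refine mul_left_cancel₀ h' ?_
    rw [add_mul_bicoeff_annulusSeries hk, add_comm (a : ℚ), add_mul_bicoeff_annulusSeries hk,
      ← bicoeff_swapVars]
    congr 1
    rw [euler_wAt_self, euler_wAt_self, map_mul, map_mul, map_mul, map_pow, map_hsym,
      swapVars_wAt_zero, swapVars_wAt_one, swapVars_wAt_zero, swapVars_wAt_one,
      hsym_comm (wAt (treeSeries k) 1)]
    have hC : swapVars (C ((k : ℚ) - 1)) = C ((k : ℚ) - 1) := swapVars.commutes _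
    rw [hC]
    ring

theorem bicoeff_zero_annulusSeries (hk : 2 ≤ k) (b : ℕ) : bicoeff 0 b (annulusSeries k) = 0 := by
  rcases Nat.eq_zero_or_pos b with rfl | h
  · exact bicoeff_zero_zero_annulusSeries hk
  · have h' : ((0 : ℕ) : ℚ) + b ≠ 0 := by rw [Nat.cast_zero, zero_add]; exact_mod_cast h.ne'
    refine (mul_eq_zero.1 ?_).resolve_left h'
    rw [add_mul_bicoeff_annulusSeries hk, mul_comm (euler 0 _), ← mul_assoc]
    refine bicoeff_zero_mul (fun b => ?_) b
    rw [bicoeff_euler_zero, Nat.cast_zero, zero_mul]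

theorem bicoeff_annulusSeries_zero (hk : 2 ≤ k) (a : ℕ) : bicoeff a 0 (annulusSeries k) = 0 := by
  rw [bicoeff_annulusSeries_comm hk, bicoeff_zero_annulusSeries hk]

theorem nonnegCoeffs_wAt_treeSeries (hk : 2 ≤ k) {m : ℕ} (i : Fin m) :
    NonnegCoeffs (wAt (treeSeries k) i) := NonnegCoeffs.wAt (coeff_treeSeries_nonneg hk) i

theorem bicoeff_annulusSeries_nonneg (hk : 2 ≤ k) (a b : ℕ) :
    0 ≤ bicoeff a b (annulusSeries k) := by
  rcases Nat.eq_zero_or_pos (a + b) with h | h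
  · rw [(Nat.add_eq_zero_iff.1 h).1, (Nat.add_eq_zero_iff.1 h).2,
      bicoeff_zero_zero_annulusSeries hk]
  · have h' : (0 : ℚ) < a + b := by exact_mod_cast h
    refine nonneg_of_mul_nonneg_right (a := (a : ℚ) + b) ?_ h'
    rw [add_mul_bicoeff_annulusSeries hk]
    have hw0 := nonnegCoeffs_wAt_treeSeries hk (0 : Fin 2)
    have hw1 := nonnegCoeffs_wAt_treeSeries hk (1 : Fin 2)
    refine NonnegCoeffs.bicoeff (.mul (.mul ?_ ((hw0.hsym hw1 _).pow _))
      ((hw0.euler _).mul (hw1.euler _))) a b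
    intro d
    classical
    rw [coeff_C]
    have : (2 : ℚ) ≤ k := by exact_mod_cast hk
    split_ifs <;> linarith

theorem bicoeff_annulusSeries_eq_zero (hk : 2 ≤ k) {a b : ℕ} (h : ¬ (k - 1) ∣ a + b) :
    bicoeff a b (annulusSeries k) = 0 := by
  have h0 : a + b ≠ 0 := by
    intro h0
    rw [h0] at h
    exact h (dvd_zero _)
  have h' : ((a : ℚ) + b) ≠ 0 := by exact_mod_cast h0
  refine (mul_eq_zero.1 ?_).resolve_left h'
  rw [add_mul_bicoeff_annulusSeries hk]
  have hw : ∀ i : Fin 2, DegreesMod (k - 1) 1 (wAt (treeSeries k) i) :=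
    fun i => DegreesMod.wAt (supportedMod_treeSeries hk) i
  have hd := (((hw 0).hsym (hw 1) (k - 2)).pow 2).mul (((hw 0).euler 0).mul ((hw 1).euler 1))
  by_contra hne
  rw [mul_assoc, bicoeff, coeff_C_mul] at hne
  have := hd _ (right_ne_zero_of_mul hne)
  -- The square of `h_{k-2}` accounts for `2(k-2)`, the two derivatives of `w` for the rest.
  rw [show 2 * (k - 2) + (1 + 1) = (k - 1) * 2 by omega, map_add, Finsupp.degree_single,
    Finsupp.degree_single] at this
  exact h ((Nat.modEq_zero_iff_dvd).1 (this.trans (by rw [Nat.modEq_zero_iff_dvd]; exact dvd_mul_right _ _)))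

end AnnulusCoefficients

/-! ### The numerical recursions as coefficients of power series -/

section CoefficientRecursions

open MvPowerSeries

theorem sum_antidiagonal_eq_sum_Ioo {f g : ℕ → ℚ} (hf : f 0 = 0) (hg : g 0 = 0) (n : ℕ) :
    ∑ p ∈ Finset.HasAntidiagonal.antidiagonal n, f p.1 * g p.2 =
      ∑ r ∈ Finset.Ioo 0 n, f (n - r) * g r := by
  rw [← Finset.Nat.sum_antidiagonal_swap,
    Finset.Nat.sum_antidiagonal_eq_sum_range_succ_mk]
  symm
  refine Finset.sum_subset ?_ ?_
  · intro r hr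
    rw [Finset.mem_Ioo] at hr
    rw [Finset.mem_range]
    omega
  · intro r hr hr'
    rw [Finset.mem_range] at hr
    rw [Finset.mem_Ioo] at hr'
    rcases Nat.eq_zero_or_pos r with rfl | h
    · exact mul_eq_zero_of_right _ hg
    · have hr0 : n - r = 0 := by omega
      exact mul_eq_zero_of_left (by show f (n - r) = 0; rw [hr0, hf]) _

variable {W : PowerSeries ℚ}

theorem cutCoeff_eq (h0 : PowerSeries.constantCoeff W = 0) (j n : ℕ) :
    cutCoeff (fun n => PowerSeries.coeff n W) j n = PowerSeries.coeff n (W ^ (j + 1)) := by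
  induction j generalizing n with
  | zero => rw [cutCoeff, zero_add, pow_one]
  | succ j ih =>
    simp only [cutCoeff, ih]
    rw [pow_succ' W (j + 1), PowerSeries.coeff_mul]
    refine (sum_antidiagonal_eq_sum_Ioo (f := fun n => PowerSeries.coeff n W)
      (g := fun n => PowerSeries.coeff n (W ^ (j + 1))) ?_ ?_ n).symm
    · simpa using h0
    · simp [h0]

/-- The first variation of `W^(j+1)` in the direction `α` is `(j+1) W^j α`. -/
theorem cutVar_eq (h0 : PowerSeries.constantCoeff W = 0) {α : ℕ → ℚ} (hα : α 0 = 0) (j n : ℕ) :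
    cutVar (fun n => PowerSeries.coeff n W) α j n =
      ((j : ℚ) + 1) * PowerSeries.coeff n (W ^ j * PowerSeries.mk α) := by
  induction j generalizing n with
  | zero => simp [cutVar]
  | succ j ih =>
    simp only [cutVar, ih, cutCoeff_eq h0, Finset.sum_add_distrib]
    have h1 := sum_antidiagonal_eq_sum_Ioo (f := fun n => PowerSeries.coeff n W)
      (g := fun n => ((j : ℚ) + 1) * PowerSeries.coeff n (W ^ j * PowerSeries.mk α))
      (by simpa using h0) (by simp [hα]) n
    have h2 := sum_antidiagonal_eq_sum_Ioo (f := α)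
      (g := fun n => PowerSeries.coeff n (W ^ (j + 1))) hα (by simp [h0]) n
    rw [← h1, ← h2]
    have h3 : PowerSeries.coeff n (W ^ (j + 1) * PowerSeries.mk α) =
        ∑ p ∈ Finset.HasAntidiagonal.antidiagonal n, PowerSeries.coeff p.1 W *
          PowerSeries.coeff p.2 (W ^ j * PowerSeries.mk α) := by
      rw [← PowerSeries.coeff_mul, pow_succ', mul_assoc]
    have h4 : PowerSeries.coeff n (W ^ (j + 1) * PowerSeries.mk α) =
        ∑ p ∈ Finset.HasAntidiagonal.antidiagonal n, α p.1 *
          PowerSeries.coeff p.2 (W ^ (j + 1)) := by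
      rw [mul_comm, PowerSeries.coeff_mul]
      simp only [PowerSeries.coeff_mk]
    rw [← h4]
    simp only [mul_left_comm _ ((j : ℚ) + 1)]
    rw [← Finset.mul_sum, ← h3]
    push_cast
    ring

theorem bicoeff_zero_sumSeries (b : ℕ) : bicoeff 0 b (sumSeries W) = 0 := by
  rw [bicoeff_sumSeries, if_pos (Or.inl rfl)]

theorem bicoeff_sumSeries_zero (a : ℕ) : bicoeff a 0 (sumSeries W) = 0 := by
  rw [bicoeff_sumSeries, if_pos (Or.inr rfl)]

theorem swapVars_sumSeries : swapVars (sumSeries W) = sumSeries W := by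
  refine ext_bicoeff fun a b => ?_
  rw [bicoeff_swapVars, bicoeff_sumSeries, bicoeff_sumSeries, add_comm]
  exact if_congr or_comm rfl rfl

/-- The recursion of `hsym` is the case distinction for the first cut: beyond the mark it gives a
factor `w₂`; before it, all `j + 1` resulting pieces other than the marked one give `w₁^(j+1)`. -/
theorem markedCutCoeff_eq (h0 : PowerSeries.constantCoeff W = 0) (j : ℕ) {a b : ℕ} (ha : 0 < a)
    (hb : 0 < b) : markedCutCoeff (fun n => PowerSeries.coeff n W) j a b =
      bicoeff a b (hsym (wAt W 0) (wAt W 1) j * sumSeries W) := by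
  induction j generalizing b with
  | zero =>
    rw [hsym, one_mul, bicoeff_sumSeries, if_neg (by omega)]
    rfl
  | succ j ih =>
    rw [markedCutCoeff, hsym, add_mul, map_add, add_comm, mul_assoc, bicoeff_wAt_one_mul,
      ← wAt_pow, bicoeff_wAt_zero_mul]
    congr 1
    · rw [sum_antidiagonal_eq_sum_Ioo (f := fun n => PowerSeries.coeff n W)
        (g := fun n => bicoeff a n _) (by simpa using h0)
        (bicoeff_mul_zero bicoeff_sumSeries_zero a)]
      refine Finset.sum_congr rfl fun r hr => ?_
      rw [Finset.mem_Ioo] at hr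
      rw [ih hr.1]
    · rw [← Finset.Nat.sum_antidiagonal_swap]
      simp only [Prod.fst_swap, Prod.snd_swap, mul_comm (PowerSeries.coeff _ _)]
      rw [sum_antidiagonal_eq_sum_Ioo (f := fun n => bicoeff n b (sumSeries W))
        (g := fun n => PowerSeries.coeff n (W ^ (j + 1))) (bicoeff_zero_sumSeries b) (by simp [h0])]
      refine Finset.sum_congr rfl fun r hr => ?_
      rw [Finset.mem_Ioo] at hr
      rw [cutCoeff_eq h0, bicoeff_sumSeries, if_neg (by omega), ← Nat.sub_add_comm hr.2.le,
        mul_comm]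

/-- The sum `∑ i < j, aⁱ h_{j - 1 - i}(a, b)`. -/
def hsymSum {R : Type*} [CommRing R] (a b : R) : ℕ → R
  | 0 => 0
  | j + 1 => a * hsymSum a b j + hsym a b j

theorem sub_mul_hsymSum {R : Type*} [CommRing R] (a b : R) (j : ℕ) :
    (a - b) * hsymSum a b (j + 1) = (j + 1) * a ^ (j + 1) - b * hsym a b j := by
  induction j with
  | zero => simp [hsymSum, hsym]
  | succ j ih =>
    rw [hsymSum, hsym_succ']
    have := sub_mul_hsym a b (j + 1)
    rw [hsym_succ'] at this
    push_cast
    linear_combination a * ih + this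

/-- The monomial `a^s b^{j-s}` occurs `s + 1` times in the first sum and `j - s + 1` times in the
second. -/
theorem hsymSum_add_hsymSum {R : Type*} [CommRing R] [NoZeroDivisors R] {a b : R} (h : a ≠ b) (j : ℕ) :
    hsymSum a b (j + 1) + hsymSum b a (j + 1) = (j + 2) * hsym a b j := by
  refine mul_left_cancel₀ (sub_ne_zero.2 h) ?_
  have h1 := sub_mul_hsymSum a b j
  have h2 := sub_mul_hsymSum b a j
  rw [← hsym_comm] at h2
  linear_combination h1 - h2 - (j + 1) * sub_mul_hsym a b j

theorem map_hsymSum {R S F : Type*} [CommRing R] [CommRing S] [FunLike F R S] [RingHomClass F R S]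
    (f : F) (a b : R) (j : ℕ) : f (hsymSum a b j) = hsymSum (f a) (f b) j := by
  induction j with
  | zero => simp [hsymSum]
  | succ j ih => rw [hsymSum, map_add, map_mul, ih, map_hsym, hsymSum]

/-- If `i` cuts precede the join, they contribute `w₁^i`, and the `j - 1 - i` cuts after it
contribute the complete symmetric polynomial of that degree. -/
theorem joinCoeff_eq (h0 : PowerSeries.constantCoeff W = 0) (j : ℕ) {a b : ℕ} (ha : 0 < a)
    (hb : 0 < b) : joinCoeff (fun n => PowerSeries.coeff n W) j a b =
      bicoeff a b (hsymSum (wAt W 0) (wAt W 1) j * sumSeries W) := by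
  induction j generalizing a with
  | zero => rw [hsymSum, zero_mul, map_zero, joinCoeff]
  | succ j ih =>
    rw [joinCoeff, hsymSum, add_mul, map_add, mul_assoc, bicoeff_wAt_zero_mul,
      markedCutCoeff_eq h0 j ha hb]
    congr 1
    rw [sum_antidiagonal_eq_sum_Ioo (f := fun n => PowerSeries.coeff n W)
        (g := fun n => bicoeff n b _) (by simpa using h0)
        (bicoeff_zero_mul bicoeff_zero_sumSeries b)]
    refine Finset.sum_congr rfl fun r hr => ?_
    rw [Finset.mem_Ioo] at hr
    rw [ih hr.1]

theorem joinCoeff_add_joinCoeff (h0 : PowerSeries.constantCoeff W = 0)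
    (h1 : PowerSeries.coeff 1 W = 1) (j : ℕ) {a b : ℕ} (ha : 0 < a) (hb : 0 < b) :
    joinCoeff (fun n => PowerSeries.coeff n W) (j + 1) a b +
        joinCoeff (fun n => PowerSeries.coeff n W) (j + 1) b a =
      ((j : ℚ) + 2) * bicoeff a b (hsym (wAt W 0) (wAt W 1) j * sumSeries W) := by
  have hswap : swapVars (hsymSum (wAt W 0) (wAt W 1) (j + 1) * sumSeries W) =
      hsymSum (wAt W 1) (wAt W 0) (j + 1) * sumSeries W := by
    rw [map_mul, map_hsymSum, swapVars_wAt_zero, swapVars_wAt_one, swapVars_sumSeries]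
  rw [joinCoeff_eq h0 _ ha hb, joinCoeff_eq h0 _ hb ha, ← bicoeff_swapVars _ a b, hswap,
    ← map_add, ← add_mul,
    hsymSum_add_hsymSum (sub_ne_zero.1 (wAt_sub_wAt_ne_zero h1)), mul_assoc]
  have : ((j : MvPowerSeries (Fin 2) ℚ) + 2) = C ((j : ℚ) + 2) := by
    rw [map_add, map_natCast, map_ofNat]
  rw [this, bicoeff, coeff_C_mul]

end CoefficientRecursions

/-! ### Identification of `P k 2` with the closed form -/

section Matching

open MvPowerSeries

variable {k : ℕ}

theorem add_mul_bicoeff_annulusSeries' (hk : 2 ≤ k) (a b : ℕ) :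
    ((a : ℚ) + b) * bicoeff a b (annulusSeries k) = ((k : ℚ) - 1) *
      (bicoeff a b (wAt (treeSeries k ^ (k - 1)) 0 * euler 0 (annulusSeries k)) +
        bicoeff a b (wAt (treeSeries k ^ (k - 1)) 1 * euler 1 (annulusSeries k)) +
        bicoeff a b (hsym (wAt (treeSeries k) 0) (wAt (treeSeries k) 1) (k - 2) *
          sumSeries (treeSeries k))) := by
  have h1 : euler 0 (annulusSeries k) + euler 1 (annulusSeries k) = C ((k : ℚ) - 1) *
      (wAt (treeSeries k ^ (k - 1)) 0 * euler 0 (annulusSeries k) +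
        wAt (treeSeries k ^ (k - 1)) 1 * euler 1 (annulusSeries k) +
        hsym (wAt (treeSeries k) 0) (wAt (treeSeries k) 1) (k - 2) *
          sumSeries (treeSeries k)) := by
    rw [wAt_pow, wAt_pow]
    linear_combination mul_euler_add_mul_euler_annulusSeries hk
  have h2 := congrArg (bicoeff a b) h1
  rw [map_add, bicoeff_euler_zero, bicoeff_euler_one, ← add_mul] at h2
  rw [h2, ← map_add, ← map_add, bicoeff, coeff_C_mul]

theorem bicoeff_wAt_mul_euler_zero (f : PowerSeries ℚ) (G : MvPowerSeries (Fin 2) ℚ) (a b : ℕ) :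
    bicoeff a b (wAt f 0 * euler 0 G) =
      PowerSeries.coeff a (f * PowerSeries.mk fun i => i * bicoeff i b G) := by
  rw [bicoeff_wAt_zero_mul, PowerSeries.coeff_mul]
  simp only [PowerSeries.coeff_mk, bicoeff_euler_zero]

theorem bicoeff_wAt_mul_euler_one (f : PowerSeries ℚ) (G : MvPowerSeries (Fin 2) ℚ) (a b : ℕ) :
    bicoeff a b (wAt f 1 * euler 1 G) =
      PowerSeries.coeff b (f * PowerSeries.mk fun i => i * bicoeff a i G) := by
  rw [bicoeff_wAt_one_mul, PowerSeries.coeff_mul]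
  simp only [PowerSeries.coeff_mk, bicoeff_euler_one]

/-- The factors `a b` in `A` turn the variations into coefficients of `w_i^{k-1}` times an Euler
derivative. Cuts and joins both carry a factor `k`: one from varying a `k`-th power, the other from
the `k = (k-2) + 2` of `joinCoeff_add_joinCoeff`. -/
theorem annulus_rec (hk : 2 ≤ k) {w : ℕ → ℚ} (hw : w = fun n => PowerSeries.coeff n (treeSeries k))
    {A : ℕ → ℕ → ℚ} (hA : A = fun a b : ℕ => (a * b : ℚ) * bicoeff a b (annulusSeries k))
    {a b : ℕ} (ha : 0 < a) (hb : 0 < b) :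
    (k : ℚ) * (a + b) * A a b = ((k : ℚ) - 1) * (a * cutVar w (fun i => A i b) (k - 1) a +
      b * cutVar w (fun i => A i a) (k - 1) b +
      a * b * (joinCoeff w (k - 1) a b + joinCoeff w (k - 1) b a)) := by
  have h0 := constantCoeff_treeSeries k
  have hcut : ∀ a b : ℕ, cutVar w (fun i => A i b) (k - 1) a =
      k * b * PowerSeries.coeff a (treeSeries k ^ (k - 1) *
        PowerSeries.mk fun i => i * bicoeff i b (annulusSeries k)) := by
    intro a b
    have : (fun i => A i b) = fun i : ℕ => (b : ℚ) * (i * bicoeff i b (annulusSeries k)) := by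
      rw [hA]
      funext i
      ring
    rw [this, cutVar_mul, hw, cutVar_eq h0 (by simp)]
    push_cast [Nat.cast_sub (by omega : 1 ≤ k)]
    ring
  have hj := joinCoeff_add_joinCoeff h0 (coeff_one_treeSeries hk) (k - 2) ha hb
  rw [show k - 2 + 1 = k - 1 by omega, ← hw] at hj
  have h2 := add_mul_bicoeff_annulusSeries' hk a b
  rw [bicoeff_wAt_mul_euler_zero, bicoeff_wAt_mul_euler_one] at h2
  rw [hj, hcut, hcut, hA]
  simp only [bicoeff_annulusSeries_comm hk _ a]
  push_cast [Nat.cast_sub hk]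
  linear_combination (k : ℚ) * a * b * h2

/-- One admissible way of cutting has positive weight: detach fixed points beyond the mark as long
as `b > 1`. When `b = 1`, detach at once a piece of length `1 + (k-1)t` and break the remaining `j +
1` points into fixed points; `t > 0` leaves room for this. -/
theorem markedCutCoeff_pos (hk : 2 ≤ k) {t : ℕ} (ht : 0 < t) (j : ℕ) {a b : ℕ} (ha : 0 < a)
    (hb : 0 < b) (hab : a + b = 1 + (k - 1) * t + j) :
    0 < markedCutCoeff (fun n => PowerSeries.coeff n (treeSeries k)) j a b := by
  have h0 := constantCoeff_treeSeries k
  have hw := coeff_treeSeries_nonneg hk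
  have hS : NonnegCoeffs (sumSeries (treeSeries k)) := by
    intro d
    rw [coeff_eq_bicoeff, bicoeff_sumSeries]
    split_ifs
    · exact le_rfl
    · exact hw _
  have hcut : ∀ j n, 0 ≤ cutCoeff (fun n => PowerSeries.coeff n (treeSeries k)) j n := by
    intro j n
    rw [cutCoeff_eq h0]
    exact coeff_pow_nonneg hw _ _
  have hmarked : ∀ j a b, 0 < a → 0 < b →
      0 ≤ markedCutCoeff (fun n => PowerSeries.coeff n (treeSeries k)) j a b := by
    intro j a b ha hb
    rw [markedCutCoeff_eq h0 j ha hb]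
    exact (((nonnegCoeffs_wAt_treeSeries hk 0).hsym (nonnegCoeffs_wAt_treeSeries hk 1) j).mul
      hS).bicoeff a b
  induction j generalizing b with
  | zero =>
    rw [markedCutCoeff, hab]
    exact coeff_treeSeries_pos hk t
  | succ j ih =>
    rw [markedCutCoeff]
    have hpos1 : ∀ r ∈ Finset.Ioo 0 a, 0 ≤ PowerSeries.coeff (a + b - r) (treeSeries k) *
        cutCoeff (fun n => PowerSeries.coeff n (treeSeries k)) j r :=
      fun r _ => mul_nonneg (hw _) (hcut _ _)
    have hpos2 : ∀ r ∈ Finset.Ioo 0 b, 0 ≤ PowerSeries.coeff (b - r) (treeSeries k) *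
        markedCutCoeff (fun n => PowerSeries.coeff n (treeSeries k)) j a r :=
      fun r hr => mul_nonneg (hw _) (hmarked _ _ _ ha (Finset.mem_Ioo.1 hr).1)
    rcases Nat.lt_or_ge 1 b with h | h
    · refine add_pos_of_nonneg_of_pos (Finset.sum_nonneg hpos1) (Finset.sum_pos' hpos2
        ⟨b - 1, Finset.mem_Ioo.2 (by omega), ?_⟩)
      rw [show b - (b - 1) = 1 by omega, coeff_one_treeSeries hk, one_mul]
      exact ih (by omega) (by omega)
    · have hkt : 0 < (k - 1) * t := Nat.mul_pos (by omega) ht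
      refine add_pos_of_pos_of_nonneg (Finset.sum_pos' hpos1
        ⟨j + 1, Finset.mem_Ioo.2 (by omega), ?_⟩) (Finset.sum_nonneg hpos2)
      rw [show a + b - (j + 1) = 1 + (k - 1) * t by omega, cutCoeff_eq h0]
      exact mul_pos (coeff_treeSeries_pos hk t)
        (lt_of_lt_of_le one_pos (one_le_coeff_pow_self hw (coeff_one_treeSeries hk) _))

/-- In the partial differential equation all terms are nonnegative, and the join term is already
positive. -/
theorem bicoeff_annulusSeries_pos (hk : 2 ≤ k) {a b : ℕ} (ha : 0 < a) (hb : 0 < b)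
    (hdvd : (k - 1) ∣ a + b) (hle : 2 * (k - 1) ≤ a + b) :
    0 < bicoeff a b (annulusSeries k) := by
  obtain ⟨s, hs⟩ := hdvd
  have hs2 : 2 ≤ s := by
    rw [hs, mul_comm] at hle
    exact Nat.le_of_mul_le_mul_left hle (by omega)
  obtain ⟨t, rfl⟩ : ∃ t, s = t + 1 := ⟨s - 1, by omega⟩
  have hm := markedCutCoeff_pos hk (t := t) (by omega) (k - 2) ha hb
    (by rw [hs, Nat.mul_succ]; omega)
  rw [markedCutCoeff_eq (constantCoeff_treeSeries k) _ ha hb] at hm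
  have hk' : (0 : ℚ) < (k : ℚ) - 1 := by
    have : (2 : ℚ) ≤ k := by exact_mod_cast hk
    linarith
  have hP : NonnegCoeffs (annulusSeries k) := by
    intro d
    rw [coeff_eq_bicoeff]
    exact bicoeff_annulusSeries_nonneg hk _ _
  have hE : ∀ i : Fin 2, NonnegCoeffs (wAt (treeSeries k ^ (k - 1)) i *
      euler i (annulusSeries k)) := fun i =>
    (NonnegCoeffs.wAt (coeff_pow_nonneg (coeff_treeSeries_nonneg hk) _) i).mul (hP.euler i)
  have hpos : 0 < ((a : ℚ) + b) * bicoeff a b (annulusSeries k) := by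
    rw [add_mul_bicoeff_annulusSeries' hk]
    exact mul_pos hk' (add_pos_of_nonneg_of_pos
      (add_nonneg ((hE 0).bicoeff a b) ((hE 1).bicoeff a b)) hm)
  exact (pos_iff_pos_of_mul_pos hpos).1 (by positivity)

theorem P_two_eq (hk : 2 ≤ k) : P k 2 = annulusSeries k := by
  ext d
  rw [coeff_eq_bicoeff d (annulusSeries k)]
  by_cases h : 0 < d 0 ∧ 0 < d 1 ∧ (k - 1) ∣ d 0 + d 1
  · obtain ⟨h0, h1, hdvd⟩ := h
    let α : (d 0 + d 1).Partition :=
      { parts := {d 0, d 1}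
        parts_pos := by
          intro i hi
          simp only [Multiset.insert_eq_cons, Multiset.mem_cons, Multiset.mem_singleton] at hi
          omega
        parts_sum := by simp }
    rw [coeff_P_two k d α rfl hdvd,
      c_eq hk (w := fun n => PowerSeries.coeff n (treeSeries k))
        (A := fun a b : ℕ => (a * b : ℚ) * bicoeff a b (annulusSeries k))
        (coeff_one_treeSeries hk) ?_ ?_ ?_ ?_ α rfl hdvd]
    · have hm : ((mu k 2 (d 0 + d 1)).factorial : ℚ) ≠ 0 := by positivity
      have h0' : (d 0 : ℚ) ≠ 0 := by positivity
      have h1' : (d 1 : ℚ) ≠ 0 := by positivity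
      field_simp
    · intro n
      rw [cutCoeff_eq (constantCoeff_treeSeries k), Nat.sub_add_cancel (by omega)]
      exact treeSeries_coeff_rec hk n
    · intro a b
      show _ = _ * _
      rw [bicoeff_annulusSeries_comm hk, mul_comm (a : ℚ)]
    · intro a b ha hb
      exact annulus_rec hk rfl rfl ha hb
    · intro a b ha hb hdvd hle
      have := bicoeff_annulusSeries_pos hk ha hb hdvd hle
      show _ * _ ≠ _
      positivity
  · rw [coeff_P_two_eq_zero k d h]
    by_cases h0 : d 0 = 0
    · rw [h0, bicoeff_zero_annulusSeries hk]
    · by_cases h1 : d 1 = 0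
      · rw [h1, bicoeff_annulusSeries_zero hk]
      · exact (bicoeff_annulusSeries_eq_zero hk fun h' => h ⟨by omega, by omega, h'⟩).symm

theorem isSymmetric_hsym_X (j : ℕ) :
    (hsym (MvPolynomial.X 0) (MvPolynomial.X 1) j : MvPolynomial (Fin 2) ℚ).IsSymmetric := by
  intro σ
  rw [map_hsym, MvPolynomial.rename_X, MvPolynomial.rename_X]
  have hσ : σ ∈ (Finset.univ : Finset (Equiv.Perm (Fin 2))) := Finset.mem_univ _
  rw [perm_fin_two_univ, Finset.mem_insert, Finset.mem_singleton] at hσ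
  rcases hσ with rfl | rfl
  · rfl
  · rw [Equiv.swap_apply_left, Equiv.swap_apply_right, hsym_comm]

end Matching

end KCycleFactorisation

/-! ### The theorem -/

open KCycleFactorisation in
theorem theorem1p4 (k : ℕ) (hk : 2 ≤ k) :
    ∃ w : PowerSeries ℚ,
      (SolvesFunctionalEquation k w ∧ ∀ w', SolvesFunctionalEquation k w' → w' = w) ∧
      -- `S = (k-1) (w₁^{k-1} - w₂^{k-1})² / (w₁ - w₂)²`, a symmetric polynomial
      (∃ S : MvPolynomial (Fin 2) ℚ,
        S.IsSymmetric ∧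
        (MvPolynomial.X 0 - MvPolynomial.X 1) ^ 2 * S =
          MvPolynomial.C ((k : ℚ) - 1) *
            (MvPolynomial.X 0 ^ (k - 1) - MvPolynomial.X 1 ^ (k - 1)) ^ 2 ∧
        euler 0 (P k 2) + euler 1 (P k 2) =
          MvPolynomial.aeval (fun i : Fin 2 => wAt w i) S *
            ∏ i : Fin 2, euler i (wAt w i)) ∧
      -- `P = log Q - R`, `Q = (w₁ - w₂) / (x₁ - x₂)`, `R = (w₁^k - w₂^k) / (w₁ - w₂)`
      (∃ Q R : MvPowerSeries (Fin 2) ℚ,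
        (MvPowerSeries.X 0 - MvPowerSeries.X 1) * Q = wAt w 0 - wAt w 1 ∧
        MvPowerSeries.constantCoeff Q = 1 ∧
        (wAt w 0 - wAt w 1) * R = wAt w 0 ^ k - wAt w 1 ^ k ∧
        P k 2 = logSeries Q - R) := by
  refine ⟨treeSeries k, ⟨treeSeries_eq hk, fun w' hw' =>
    treeStep_fixed_unique hk hw' (treeSeries_eq hk)⟩, ?_, ?_⟩
  · refine ⟨MvPolynomial.C ((k : ℚ) - 1) *
      hsym (MvPolynomial.X 0) (MvPolynomial.X 1) (k - 2) ^ 2, ?_, ?_, ?_⟩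
    · exact (MvPolynomial.symmetricSubalgebra (Fin 2) ℚ).mul_mem (MvPolynomial.IsSymmetric.C _)
        ((MvPolynomial.symmetricSubalgebra (Fin 2) ℚ).pow_mem (isSymmetric_hsym_X _) 2)
    · have h := sub_mul_hsym (MvPolynomial.X 0 : MvPolynomial (Fin 2) ℚ) (MvPolynomial.X 1) (k - 2)
      rw [show k - 2 + 1 = k - 1 by omega] at h
      rw [← h]
      ring
    · rw [P_two_eq hk, euler_add_euler_annulusSeries hk, Fin.prod_univ_two, map_mul, map_pow,
        map_hsym, MvPolynomial.aeval_X, MvPolynomial.aeval_X, MvPolynomial.aeval_C]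
      rfl
  · refine ⟨divDiff (treeSeries k), hsym (wAt (treeSeries k) 0) (wAt (treeSeries k) 1) (k - 1),
      X_sub_X_mul_divDiff _, constantCoeff_divDiff (coeff_one_treeSeries hk), ?_, P_two_eq hk⟩
    rw [sub_mul_hsym, Nat.sub_add_cancel (by omega)]
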